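/- Fix an infinite set $D$ of data values. A database schema $\sigma$ is a finite set of relation names, each with an arity. An instance over $\sigma$ is a finite set of facts $R(a_1,\dots,a_r)$ with $R\in\sigma$ of arity $r$ and $a_i\in D$. A conjunctive query with negation and inequalities over $\sigma$ is an expression $$T(\bar x)\leftarrow R_1(\bar y_1),\dots,R_m(\bar y_m),\ \lnot S_1(\bar z_1),\dots,\lnot S_n(\bar z_n),\ \beta_1,\dots,\beta_p,$$ where the $R_i(\bar y_i)$ and $S_j(\bar z_j)$ are atoms over $\sigma$ with variables as arguments, $T\notin\sigma$, each $\beta_l$ is an inequality $s\neq s'$ between distinct variables occurring in the $\bar y_i$ or $\bar z_j$, and every variable of $\bar x$ and of every $\bar z_j$ occurs in some $\bar y_i$. Its result on an instance $I$ is the set of facts $T(V(\bar x))$, where $V$ maps variables to $D$ such that $V(s)\neq V(s')$ for every inequality $s\neq s'$ of the query, all facts $R_i(V(\bar y_i))$ are in $I$, and no fact $S_j(V(\bar z_j))$ is in $I$. A union of conjunctive queries with negation and inequalities ($\mathrm{UCQ}^{\lnot,\neq}$) over $\sigma$ is a finite nonempty union of such queries with the same head relation name $T$; its result on $I$ is the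 union of the results of its disjuncts. For two such queries over the same schema $\sigma$, $Q_1\subseteq Q_2$ means that $Q_1(I)\subseteq Q_2(I)$ for every instance $I$ over $\sigma$. Queries are given to algorithms as strings over a finite alphabet, in which relation names and variables are written as binary strings. Then: 1. The problem to decide, given two $\mathrm{UCQ}^{\lnot,\neq}$s $Q_1,Q_2$ over a common schema, whether $Q_1\subseteq Q_2$, is in $\mathrm{coNEXPTIME}$. 2. For every $k\in\mathbb N$, the problem to decide, given two $\mathrm{UCQ}^{\lnot,\neq}$s $Q_1,Q_2$ over a common schema whose relations all have arity at most $k$, whether $Q_1\subseteq Q_2$, is in $\Pi_2^p$. -/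

import Mathlib

/-! ## Complexity classes

The deterministic machine model is Mathlib's multi-stack Turing machine `Turing.FinTM2`, with its
notion `Turing.TM2ComputableInPolyTime` of polynomial-time computability. -/

namespace Complexity

/-- A nondeterministic multi-stack Turing machine: a machine with two programs `m` and `m'`, either
of which may be used in each step, and an accepting label. -/
structure NTM extends Turing.FinTM2 where
  /-- the alternative program -/
  m' : Λ → Turing.TM2.Stmt Γ Λ σ
  /-- the accepting label -/
  accept : Λ

namespace NTM

/-- One step of a nondeterministic machine. -/
def Step (M : NTM) (c c' : M.toFinTM2.Cfg) : Prop :=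
  c' ∈ Turing.TM2.step M.m c ∨ c' ∈ Turing.TM2.step M.m' c

/-- `M.ReachesIn n c c'`: some run of exactly `n` steps leads from `c` to `c'`. -/
def ReachesIn (M : NTM) : ℕ → M.toFinTM2.Cfg → M.toFinTM2.Cfg → Prop
  | 0, c, c' => c = c'
  | n + 1, c, c' => ∃ d, M.Step c d ∧ M.ReachesIn n d c'

/-- `M` has an accepting run of at most `t` steps on the input `x`. -/
def AcceptsWithin (M : NTM) (x : List (M.Γ M.k₀)) (t : ℕ) : Prop :=
  ∃ n ≤ t, ∃ c : M.toFinTM2.Cfg,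
    M.ReachesIn n (Turing.initList M.toFinTM2 x) c ∧ c.l = some M.accept

end NTM

/-- `L ∈ NEXPTIME`: some nondeterministic machine has, for some polynomial `p`, an accepting run of
at most `2 ^ p(|x|)` steps on exactly those inputs `x` that belong to `L`. -/
def NEXPTIME {α : Type} (L : Set (List α)) : Prop :=
  ∃ (M : NTM) (e : M.Γ M.k₀ ≃ α) (p : Polynomial ℕ),
    ∀ x : List α, x ∈ L ↔ M.AcceptsWithin (x.map e.symm) (2 ^ p.eval x.length)

/-- `L ∈ coNEXPTIME`. -/
def CoNEXPTIME {α : Type} (L : Set (List α)) : Prop :=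
  NEXPTIME Lᶜ

/-- The string `x # u # v`. -/
def encodeTriple {α : Type} (t : List α × List Bool × List Bool) : List (Option (α ⊕ Bool)) :=
  t.1.map (fun a => some (Sum.inl a)) ++ none ::
    (t.2.1.map (fun b => some (Sum.inr b)) ++ none :: t.2.2.map (fun b => some (Sum.inr b)))

/-- `L ∈ Π₂ᵖ`: there are a polynomial `p` and a relation `R`, decidable in polynomial time, such
that `x ∈ L` iff for all `u` with `|u| ≤ p(|x|)` there is a `v` with `|v| ≤ p(|x|)` and
`R (x, u, v)`. -/
def Pi2P {α : Type} (L : Set (List α)) : Prop :=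
  ∃ (p : Polynomial ℕ) (R : List α × List Bool × List Bool → Bool),
    Nonempty (Turing.TM2ComputableInPolyTime encodeTriple Computability.encodeBool R) ∧
    ∀ x : List α, x ∈ L ↔
      ∀ u : List Bool, u.length ≤ p.eval x.length →
        ∃ v : List Bool, v.length ≤ p.eval x.length ∧ R (x, u, v) = true

end Complexity

/-! ## Unions of conjunctive queries with negation and inequalities -/

namespace UCQNeg

/-- Relation names and variables are strings over `{0, 1}`. -/
abbrev Name := List Bool

/-- A database schema: a finite set of relation names, where every relation name has an arity
(also those outside the schema, which serve as output relations). -/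
structure Schema where
  rels : Finset Name
  ar : Name → ℕ

/-- `R(x₁, …, x_k)` with entries from `X`: an atom if `X` is the set of variables, a fact if `X` is
the set of data values. -/
structure Atom (X : Type*) where
  rel : Name
  args : List X

namespace Atom

/-- The atom or fact is over the schema `S`. -/
def Over {X : Type*} (S : Schema) (A : Atom X) : Prop :=
  A.rel ∈ S.rels ∧ A.args.length = S.ar A.rel

/-- The fact `V(A)`. -/
def map {X Y : Type*} (V : X → Y) (A : Atom X) : Atom Y :=
  ⟨A.rel, A.args.map V⟩

end Atom

/-- The expression
`head ← pos₁, …, pos_m, ¬ neg₁, …, ¬ neg_n, ineqs₁, …, ineqs_p`,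
where `(s, s')` in `ineqs` stands for `s ≠ s'`. -/
structure CQ where
  head : Atom Name
  pos : List (Atom Name)
  neg : List (Atom Name)
  ineqs : List (Name × Name)

namespace CQ

/-- `x` occurs in a positive atom. -/
def PosVar (q : CQ) (x : Name) : Prop := ∃ A ∈ q.pos, x ∈ A.args

/-- `x` occurs in a negated atom. -/
def NegVar (q : CQ) (x : Name) : Prop := ∃ A ∈ q.neg, x ∈ A.args

/-- `q` is a conjunctive query with (safe) negation and inequalities over the input schema `S`. -/
structure WF (S : Schema) (q : CQ) : Prop where
  pos_over : ∀ A ∈ q.pos, A.Over S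
  neg_over : ∀ A ∈ q.neg, A.Over S
  ineqs_ne : ∀ b ∈ q.ineqs, b.1 ≠ b.2
  ineqs_vars : ∀ b ∈ q.ineqs, (q.PosVar b.1 ∨ q.NegVar b.1) ∧ (q.PosVar b.2 ∨ q.NegVar b.2)
  head_rel : q.head.rel ∉ S.rels
  head_ar : q.head.args.length = S.ar q.head.rel
  head_safe : ∀ x ∈ q.head.args, q.PosVar x
  neg_safe : ∀ x, q.NegVar x → q.PosVar x

/-- `V` is a valuation for `q`, i.e. consistent. (Its values outside the variables of `q` play no
role.) -/
def Consistent {D : Type*} (q : CQ) (V : Name → D) : Prop :=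
  (∀ A ∈ q.pos, ∀ B ∈ q.neg, A.map V ≠ B.map V) ∧ ∀ b ∈ q.ineqs, V b.1 ≠ V b.2

/-- The valuation `V` satisfies `q` on the instance `I`. -/
def Satisfies {D : Type*} (q : CQ) (I : Finset (Atom D)) (V : Name → D) : Prop :=
  q.Consistent V ∧ (∀ A ∈ q.pos, A.map V ∈ I) ∧ ∀ A ∈ q.neg, A.map V ∉ I

/-- The result `q(I)`. -/
def result {D : Type*} (q : CQ) (I : Finset (Atom D)) : Set (Atom D) :=
  {f | ∃ V : Name → D, q.Satisfies I V ∧ f = q.head.map V}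

end CQ

/-- The disjuncts of a union of conjunctive queries with negation and inequalities. -/
abbrev UCQ := List CQ

namespace UCQ

/-- `Q` is a union of conjunctive queries with negation and inequalities over the input schema
`S`. -/
structure WF (S : Schema) (Q : UCQ) : Prop where
  ne_nil : Q ≠ []
  disjuncts : ∀ q ∈ Q, CQ.WF S q
  head_rel : ∀ q ∈ Q, ∀ q' ∈ Q, q.head.rel = q'.head.rel

/-- The result `Q(I)`. -/
def result {D : Type*} (Q : UCQ) (I : Finset (Atom D)) : Set (Atom D) :=
  {f | ∃ q ∈ Q, f ∈ CQ.result q I}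

/-- `Q₁ ⊆ Q₂`: on every instance over the schema `S`, with data values from `D`, the result of `Q₁`
is contained in the result of `Q₂`. -/
def Contained (D : Type*) (S : Schema) (Q₁ Q₂ : UCQ) : Prop :=
  ∀ I : Finset (Atom D), (∀ f ∈ I, f.Over S) → result Q₁ I ⊆ result Q₂ I

end UCQ

/-! ## Queries as strings -/

/-- The alphabet in which queries are written. -/
inductive Letter
  | bit (b : Bool)
  | endName
  | endAtom
  | endAtoms
  | endCQ
  | endUCQ

def encodeName (w : Name) : List Letter :=
  w.map Letter.bit ++ [Letter.endName]

def encodeAtom (A : Atom Name) : List Letter :=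
  encodeName A.rel ++ A.args.flatMap encodeName ++ [Letter.endAtom]

def encodeCQ (q : CQ) : List Letter :=
  encodeAtom q.head ++
    (q.pos.flatMap encodeAtom ++ [Letter.endAtoms]) ++
    (q.neg.flatMap encodeAtom ++ [Letter.endAtoms]) ++
    (q.ineqs.flatMap (fun b => encodeName b.1 ++ encodeName b.2) ++ [Letter.endCQ])

def encodeUCQ (Q : UCQ) : List Letter :=
  Q.flatMap encodeCQ ++ [Letter.endUCQ]

/-- The containment problem, as a language: the encodings of the pairs `(Q₁, Q₂)` of unions of
conjunctive queries with negation and inequalities over a common schema such that `Q₁ ⊆ Q₂`. -/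
def Containment (D : Type*) : Set (List Letter) :=
  {x | ∃ (S : Schema) (Q₁ Q₂ : UCQ), UCQ.WF S Q₁ ∧ UCQ.WF S Q₂ ∧
    x = encodeUCQ Q₁ ++ encodeUCQ Q₂ ∧ UCQ.Contained D S Q₁ Q₂}

/-- The containment problem for queries over schemas all of whose relations have arity at most
`k`. -/
def BoundedContainment (D : Type*) (k : ℕ) : Set (List Letter) :=
  {x | ∃ (S : Schema) (Q₁ Q₂ : UCQ), (∀ R ∈ S.rels, S.ar R ≤ k) ∧
    UCQ.WF S Q₁ ∧ UCQ.WF S Q₂ ∧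
    x = encodeUCQ Q₁ ++ encodeUCQ Q₂ ∧ UCQ.Contained D S Q₁ Q₂}

end UCQNeg

/-!
Let `q` be a disjunct of `Q₁` and let `V` be a valuation witnessing that some fact is in `Q₁(I)` but
not in `Q₂(I)`. Restricting `I` to the facts over the relations of the two queries whose entries lie
in the image of `V` keeps both properties, since every variable of a negated atom or of the head is
bound by a positive atom. The image has at most as many values as `q` has variables, so a
counterexample exists if and only if there is one whose size is exponential in the input, and even
polynomial in the input when the arity is bounded.

For bounded arity this gives the `∀∃` form directly: for every small candidate `u` for a
counterexample there is a valuation `v` of a disjunct of `Q₂` that yields the fact. For unbounded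
arity, a nondeterministic machine guesses the counterexample together with a list of all valuations
of the variables of `Q₂`. That the list is complete is checked in polynomial time: it is nonempty
and closed under changing the value of one variable.

Since `D` is infinite, the finitely many names occurring in a query can serve as data values.
-/

namespace StackProg

open Function Turing Complexity

variable {A : Type}

/-! ### Stack programs -/

/-- Structured programs that manipulate stacks indexed by `ℕ`. -/
inductive Prog (A : Type) : Type
  | skip : Prog A
  | push (k : ℕ) (a : A) : Prog A
  | seq (P Q : Prog A) : Prog A
  /-- pop from stack `k` and branch on the result -/
  | case (k : ℕ) (P : Option A → Prog A) : Prog A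
  /-- while stack `k` is nonempty, pop a symbol `a` and run `P a` -/
  | loop (k : ℕ) (P : A → Prog A) : Prog A

/-- The contents of the stacks. -/
abbrev Store (A : Type) := ℕ → List A

/-- `Run P S S' t`: the program `P` turns the store `S` into `S'` in `t` steps. -/
inductive Run : Prog A → Store A → Store A → ℕ → Prop
  | skip (S : Store A) : Run .skip S S 1
  | push (k : ℕ) (a : A) (S : Store A) : Run (.push k a) S (update S k (a :: S k)) 1
  | seq {P Q : Prog A} {S S' S'' : Store A} {t t' : ℕ} :
      Run P S S' t → Run Q S' S'' t' → Run (.seq P Q) S S'' (t + t')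
  | case {k : ℕ} {P : Option A → Prog A} {S S' : Store A} {t : ℕ} :
      Run (P (S k).head?) (update S k (S k).tail) S' t → Run (.case k P) S S' (t + 1)
  | loop_nil {k : ℕ} {P : A → Prog A} {S : Store A} : S k = [] → Run (.loop k P) S S 1
  | loop_cons {k : ℕ} {P : A → Prog A} {S S' S'' : Store A} {a : A} {l : List A} {t t' : ℕ} :
      S k = a :: l → Run (P a) (update S k l) S' t → Run (.loop k P) S' S'' t' →
        Run (.loop k P) S S'' (t + t' + 1)

namespace Prog

/-- The program that works on the stacks from `n` on. -/
def shift (n : ℕ) : Prog A → Prog A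
  | skip => skip
  | push k a => push (n + k) a
  | seq P Q => seq (P.shift n) (Q.shift n)
  | case k P => case (n + k) fun o => (P o).shift n
  | loop k P => loop (n + k) fun a => (P a).shift n

/-- A strict upper bound on the stacks used by a program. -/
def bound [Fintype A] : Prog A → ℕ
  | skip => 0
  | push k _ => k + 1
  | seq P Q => max P.bound Q.bound
  | case k P => max (k + 1) (Finset.univ.sup fun o => (P o).bound)
  | loop k P => max (k + 1) (Finset.univ.sup fun a => (P a).bound)

section bound

variable [Fintype A] {k N : ℕ}

theorem bound_case_le_iff {P : Option A → Prog A} :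
    (case k P).bound ≤ N ↔ k < N ∧ ∀ o, (P o).bound ≤ N := by
  simp [bound]

theorem bound_loop_le_iff {P : A → Prog A} :
    (loop k P).bound ≤ N ↔ k < N ∧ ∀ a, (P a).bound ≤ N := by
  simp [bound]

end bound

end Prog

/-- The store with the first `n` stacks from `T`, followed by the stacks of `S`. -/
def frame (n : ℕ) (T S : Store A) : Store A := fun i => if i < n then T i else S (i - n)

@[simp] theorem frame_add (n : ℕ) (T S : Store A) (k : ℕ) : frame n T S (n + k) = S k := by
  simp [frame]

theorem update_frame (n : ℕ) (T S : Store A) (k : ℕ) (x : List A) :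
    update (frame n T S) (n + k) x = frame n T (update S k x) := by
  funext i
  by_cases h : i = n + k
  · subst h
    simp
  · rw [update_of_ne h]
    unfold frame
    split_ifs with hi
    · rfl
    · rw [update_of_ne (by omega)]

theorem Run.shift (n : ℕ) (T : Store A) {P : Prog A} {S S' : Store A} {t : ℕ}
    (h : Run P S S' t) : Run (P.shift n) (frame n T S) (frame n T S') t := by
  induction h with
  | skip S => exact .skip _
  | push k a S =>
    rw [← update_frame]
    simpa [Prog.shift] using Run.push (n + k) a (frame n T S)
  | seq _ _ ih ih' => exact .seq ih ih'
  | case _ ih =>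
    refine Run.case ?_
    simpa [update_frame] using ih
  | loop_nil h => exact .loop_nil (by simpa using h)
  | loop_cons h _ _ ih ih' =>
    refine Run.loop_cons (by simpa using h) ?_ ih'
    simpa [update_frame] using ih

/-! ### Runs on lists of stacks -/

/-- The store with the stacks listed in `l`, followed by empty ones. -/
def store (l : List (List A)) : Store A := fun i => l.getD i []

@[simp] theorem store_apply (l : List (List A)) (i : ℕ) : store l i = l.getD i [] := rfl

/-- Replace the `k`-th stack of a list of stacks, which is extended by empty stacks if necessary. -/
def setStack : List (List A) → ℕ → List A → List (List A)
  | [], 0, x => [x]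
  | [], k + 1, x => [] :: setStack [] k x
  | _ :: l, 0, x => x :: l
  | y :: l, k + 1, x => y :: setStack l k x

theorem update_store (l : List (List A)) (k : ℕ) (x : List A) :
    update (store l) k x = store (setStack l k x) := by
  funext i
  induction k generalizing l i with
  | zero => cases l <;> cases i <;> simp [setStack]
  | succ k ih =>
    rcases l with _ | ⟨y, l⟩ <;> rcases i with _ | i
    · simp [setStack]
    · simpa [setStack, update_apply] using ih [] i
    · simp [setStack]
    · simpa [setStack, update_apply] using ih l i

theorem frame_store (e l : List (List A)) :
    frame e.length (store e) (store l) = store (e ++ l) := by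
  funext i
  simp only [frame, store_apply]
  split_ifs with h
  · rw [List.getD_append _ _ _ _ h]
  · rw [List.getD_append_right _ _ _ _ (by omega)]

theorem store_append_nil (l : List (List A)) (n : ℕ) :
    store (l ++ List.replicate n []) = store l := by
  funext i
  simp only [store_apply]
  by_cases h : i < l.length
  · rw [List.getD_append _ _ _ _ h]
  · rw [List.getD_append_right _ _ _ _ (by omega), List.getD_eq_default l _ (by omega)]
    grind

/-- `P` turns `S` into `S'` in at most `b` steps. -/
def RunLe (P : Prog A) (S S' : Store A) (b : ℕ) : Prop := ∃ t ≤ b, Run P S S' t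

namespace RunLe

variable {P Q : Prog A} {S S' S'' : Store A} {b b' k : ℕ}

theorem mono (h : RunLe P S S' b) (hb : b ≤ b') : RunLe P S S' b' :=
  let ⟨t, ht, hr⟩ := h
  ⟨t, ht.trans hb, hr⟩

theorem congr (h : RunLe P S S' b) (hS : S' = S'') (hb : b ≤ b') : RunLe P S S'' b' :=
  hS ▸ h.mono hb

theorem skip : RunLe .skip S S 1 := ⟨1, le_rfl, .skip S⟩

theorem push {a : A} (h : update S k (a :: S k) = S') : RunLe (.push k a) S S' 1 :=
  ⟨1, le_rfl, h ▸ .push k a S⟩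

theorem seq (h : RunLe P S S' b) (h' : RunLe Q S' S'' b') : RunLe (.seq P Q) S S'' (b + b') :=
  let ⟨t, ht, hr⟩ := h
  let ⟨t', ht', hr'⟩ := h'
  ⟨t + t', by omega, .seq hr hr'⟩

theorem case {P : Option A → Prog A}
    (h : RunLe (P (S k).head?) (update S k (S k).tail) S' b) : RunLe (.case k P) S S' (b + 1) :=
  let ⟨t, ht, hr⟩ := h
  ⟨t + 1, by omega, .case hr⟩

theorem loop_nil {P : A → Prog A} (h : S k = []) : RunLe (.loop k P) S S 1 :=
  ⟨1, le_rfl, .loop_nil h⟩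

theorem loop_cons {P : A → Prog A} {a : A} {l : List A} (hS : S k = a :: l)
    (h : RunLe (P a) (update S k l) S' b) (h' : RunLe (.loop k P) S' S'' b') :
    RunLe (.loop k P) S S'' (b + b' + 1) :=
  let ⟨t, ht, hr⟩ := h
  let ⟨t', ht', hr'⟩ := h'
  ⟨t + t' + 1, by omega, .loop_cons hS hr hr'⟩

theorem shift {l l' : List (List A)} (e : List (List A))
    (h : RunLe P (store l) (store l') b) {n : ℕ} (hn : e.length = n) :
    RunLe (P.shift n) (store (e ++ l)) (store (e ++ l')) b := by
  obtain ⟨t, ht, hr⟩ := h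
  subst hn
  refine ⟨t, ht, ?_⟩
  rw [← frame_store, ← frame_store]
  exact hr.shift _ _

end RunLe

/-! ### Compilation to multi-stack machines -/

/-- The stacks of a machine: an input stack, an output stack and `N` work stacks. -/
abbrev Idx (N : ℕ) := Option (Option (Fin N))

/-- The alphabets of the stacks. -/
@[reducible] def Alph (α β A : Type) {N : ℕ} : Idx N → Type
  | none => α
  | some none => β
  | some (some _) => A

/-- The `i`-th work stack. -/
@[reducible] def work (N : ℕ) [NeZero N] (i : ℕ) : Idx N := some (some (Fin.ofNat N i))

variable {α β : Type} {N : ℕ}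

/-- The stack contents of a machine, with `x` on the input stack, `y` on the output stack and the
stacks of `S` on the work stacks. -/
def tapes (x : List α) (y : List β) (S : Store A) : ∀ k : Idx N, List (Alph α β A k)
  | none => x
  | some none => y
  | some (some j) => S j

theorem update_tapes_input (x x' : List α) (y : List β) (S : Store A) :
    update (tapes (N := N) x y S) none x' = tapes x' y S := by
  funext k
  rcases k with _ | _ | j <;> rfl

theorem update_tapes_output (x : List α) (y y' : List β) (S : Store A) :
    update (tapes (N := N) x y S) (some none) y' = tapes x y' S := by
  funext k
  rcases k with _ | _ | j <;> rfl

section work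

variable [NeZero N]

theorem some_some_eq_work_iff {i : ℕ} (h : i < N) (j : Fin N) :
    some (some j) = work N i ↔ (j : ℕ) = i := by
  simp [work, Fin.ext_iff, Fin.ofNat, Nat.mod_eq_of_lt h]

theorem tapes_work (x : List α) (y : List β) (S : Store A) {i : ℕ} (h : i < N) :
    tapes x y S (work N i) = S i := by
  simp only [tapes, Fin.ofNat, Nat.mod_eq_of_lt h]

theorem update_tapes_work (x : List α) (y : List β) (S : Store A) {i : ℕ} (h : i < N)
    (z : List A) :
    update (tapes x y S) (work N i) z = tapes x y (update S i z) := by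
  funext k
  rcases k with _ | _ | j
  · exact update_of_ne (by simp [work]) _ _
  · exact update_of_ne (by simp [work]) _ _
  · by_cases hj : (j : ℕ) = i
    · cases (some_some_eq_work_iff h j).2 hj
      rw [update_self]
      simp [tapes, Nat.mod_eq_of_lt h]
    · rw [update_of_ne (mt (some_some_eq_work_iff h j).1 hj)]
      simp [tapes, update_of_ne hj]

variable {Λ σ : Type}

theorem stepAux_push_work (x : List α) (y : List β) (S : Store A) {i : ℕ} (h : i < N)
    (f : σ → A) (q : TM2.Stmt (Alph α β A (N := N)) Λ σ) (v : σ) :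
    TM2.stepAux (.push (work N i) f q) v (tapes x y S) =
      TM2.stepAux q v (tapes x y (update S i (f v :: S i))) := by
  rw [TM2.stepAux, tapes_work x y S h]
  exact congrArg _ (update_tapes_work x y S h _)

theorem stepAux_pop_work (x : List α) (y : List β) (S : Store A) {i : ℕ} (h : i < N)
    (f : σ → Option A → σ) (q : TM2.Stmt (Alph α β A (N := N)) Λ σ) (v : σ) :
    TM2.stepAux (.pop (work N i) f q) v (tapes x y S) =
      TM2.stepAux q (f v (S i).head?) (tapes x y (update S i (S i).tail)) := by
  rw [TM2.stepAux, tapes_work x y S h]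
  exact congrArg _ (update_tapes_work x y S h _)

end work

section stepAux

variable {Λ σ : Type}

theorem stepAux_pop_input (x : List α) (y : List β) (S : Store A) (f : σ → Option α → σ)
    (q : TM2.Stmt (Alph α β A (N := N)) Λ σ) (v : σ) :
    TM2.stepAux (.pop none f q) v (tapes x y S) =
      TM2.stepAux q (f v x.head?) (tapes x.tail y S) :=
  congrArg (TM2.stepAux q _) (update_tapes_input x _ y S)

theorem stepAux_push_output (x : List α) (y : List β) (S : Store A) (f : σ → β)
    (q : TM2.Stmt (Alph α β A (N := N)) Λ σ) (v : σ) :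
    TM2.stepAux (.push (some none) f q) v (tapes x y S) =
      TM2.stepAux q v (tapes x (f v :: y) S) :=
  congrArg (TM2.stepAux q _) (update_tapes_output x y _ S)

end stepAux

namespace Prog

/-- The control points of a program. -/
@[reducible] def Lab : Prog A → Type
  | skip => Unit
  | push _ _ => Unit
  | seq P Q => P.Lab ⊕ Q.Lab
  | case _ P => Option (Σ o, (P o).Lab)
  | loop _ P => Option (Σ a, (P a).Lab)

noncomputable instance fintypeLab [Fintype A] : ∀ P : Prog A, Fintype P.Lab
  | skip => inferInstanceAs (Fintype Unit)
  | push _ _ => inferInstanceAs (Fintype Unit)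
  | seq P Q =>
    have := P.fintypeLab
    have := Q.fintypeLab
    inferInstanceAs (Fintype (P.Lab ⊕ Q.Lab))
  | case _ P =>
    have := fun o => (P o).fintypeLab
    inferInstanceAs (Fintype (Option (Σ o, (P o).Lab)))
  | loop _ P =>
    have := fun a => (P a).fintypeLab
    inferInstanceAs (Fintype (Option (Σ a, (P a).Lab)))

/-- The control point at which a program starts. -/
def entry : ∀ P : Prog A, P.Lab
  | skip => ()
  | push _ _ => ()
  | seq P _ => Sum.inl P.entry
  | case _ _ => (none : Option _)
  | loop _ _ => (none : Option _)

/-- The machine code of a program, with labels embedded by `emb`, which continues at `exit`. The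
internal state holds the symbols last popped from the input stack and from a work stack. -/
def code [NeZero N] {Λ : Type} : ∀ (P : Prog A) (_ : P.Lab → Λ) (_ : Λ),
    P.Lab → TM2.Stmt (Alph α β A (N := N)) Λ (Option α × Option A)
  | skip, _, exit, _ => .goto fun _ => exit
  | push k a, _, exit, _ => .push (work N k) (fun _ => a) (.goto fun _ => exit)
  | seq P Q, emb, exit, l =>
    match l with
    | Sum.inl l => P.code (fun l => emb (Sum.inl l)) (emb (Sum.inr Q.entry)) l
    | Sum.inr l => Q.code (fun l => emb (Sum.inr l)) exit l
  | case k P, emb, exit, l =>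
    match l with
    | none => .pop (work N k) (fun s o => (s.1, o)) (.goto fun s => emb (some ⟨s.2, (P s.2).entry⟩))
    | some ⟨o, l⟩ => (P o).code (fun l => emb (some ⟨o, l⟩)) exit l
  | loop k P, emb, exit, l =>
    match l with
    | none => .pop (work N k) (fun s o => (s.1, o)) (.goto fun s =>
        match s.2 with
        | none => exit
        | some a => emb (some ⟨a, (P a).entry⟩))
    | some ⟨a, l⟩ => (P a).code (fun l => emb (some ⟨a, l⟩)) (emb none) l

end Prog

/-- `StepsIn R n c d`: a path of `n` steps of `R` leads from `c` to `d`. -/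
def StepsIn {C : Type*} (R : C → C → Prop) : ℕ → C → C → Prop
  | 0, c, d => c = d
  | n + 1, c, d => ∃ b, R c b ∧ StepsIn R n b d

namespace StepsIn

variable {C : Type*} {R : C → C → Prop} {c d e : C} {m n : ℕ}

theorem single (h : R c d) : StepsIn R 1 c d :=
  ⟨d, h, rfl⟩

theorem trans (h : StepsIn R m c d) (h' : StepsIn R n d e) : StepsIn R (m + n) c e := by
  induction m generalizing c with
  | zero =>
    cases h
    simpa using h'
  | succ m ih =>
    obtain ⟨b, hb, h⟩ := h
    rw [Nat.succ_add]
    exact ⟨b, hb, ih h⟩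

theorem mono {R' : C → C → Prop} (hR : ∀ c d, R c d → R' c d) (h : StepsIn R n c d) :
    StepsIn R' n c d := by
  induction n generalizing c with
  | zero => exact h
  | succ n ih =>
    obtain ⟨b, hb, h⟩ := h
    exact ⟨b, hR _ _ hb, ih h⟩

theorem bind_iterate {f : C → Option C} (h : StepsIn (fun c d => f c = some d) n c d) :
    (flip bind f)^[n] (some c) = some d := by
  induction n generalizing c with
  | zero =>
    cases h
    rfl
  | succ n ih =>
    obtain ⟨b, hb, h⟩ := h
    rw [iterate_succ_apply, ← ih h]
    exact congrArg _ hb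

end StepsIn

/-- `R` contains the steps of a machine into which the code of `P` is embedded. -/
theorem Run.stepsIn_code [Fintype A] [NeZero N] {Λ : Type} {P : Prog A} {S S' : Store A} {t : ℕ}
    (h : Run P S S' t) (hN : P.bound ≤ N) (emb : P.Lab → Λ) (exit : Λ)
    (R : TM2.Cfg (Alph α β A (N := N)) Λ (Option α × Option A) →
      TM2.Cfg (Alph α β A (N := N)) Λ (Option α × Option A) → Prop)
    (hR : ∀ l v T, R ⟨some (emb l), v, T⟩ (TM2.stepAux (P.code emb exit l) v T))
    (x : List α) (y : List β) (v : Option α × Option A) :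
    ∃ o, StepsIn R t ⟨some (emb P.entry), v, tapes x y S⟩
      ⟨some exit, (v.1, o), tapes x y S'⟩ := by
  induction h generalizing v exit with
  | skip S => exact ⟨v.2, .single (hR () v _)⟩
  | push k a S =>
    have h := hR () v (tapes x y S)
    rw [Prog.code, stepAux_push_work x y S hN] at h
    exact ⟨v.2, .single h⟩
  | seq _ _ ih ih' =>
    obtain ⟨hP, hQ⟩ := max_le_iff.1 hN
    obtain ⟨o, ho⟩ := ih hP (fun l => emb (Sum.inl l)) (emb (Sum.inr (Prog.entry _)))
      (fun l => hR (Sum.inl l)) v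
    obtain ⟨o', ho'⟩ := ih' hQ (fun l => emb (Sum.inr l)) exit (fun l => hR (Sum.inr l)) (v.1, o)
    exact ⟨o', ho.trans ho'⟩
  | @case k P S S' t _ ih =>
    obtain ⟨hk, hP⟩ := Prog.bound_case_le_iff.1 hN
    have h := hR none v (tapes x y S)
    rw [Prog.code, stepAux_pop_work x y S hk] at h
    obtain ⟨o, ho⟩ := ih (hP _) (fun l => emb (some ⟨_, l⟩)) exit (fun l => hR (some ⟨_, l⟩))
      (v.1, (S k).head?)
    exact ⟨o, _, h, ho⟩
  | @loop_nil k P S hS =>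
    have h := hR none v (tapes x y S)
    rw [Prog.code, stepAux_pop_work x y S (Prog.bound_loop_le_iff.1 hN).1,
      show (S k).tail = S k by rw [hS, List.tail_nil], update_eq_self, hS] at h
    exact ⟨none, .single h⟩
  | @loop_cons k P S S' S'' a l t t' hS _ _ ih ih' =>
    obtain ⟨hk, hP⟩ := Prog.bound_loop_le_iff.1 hN
    have h := hR none v (tapes x y S)
    rw [Prog.code, stepAux_pop_work x y S hk, hS] at h
    obtain ⟨o, ho⟩ := ih (hP a) (fun l => emb (some ⟨a, l⟩)) (emb none) (fun l => hR (some ⟨a, l⟩))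
      (v.1, some a)
    obtain ⟨o', ho'⟩ := ih' hN emb exit hR (v.1, o)
    exact ⟨o', _, h, ho.trans ho'⟩

/-! ### Deterministic machines -/

theorem monotone_polynomial_eval (p : Polynomial ℕ) : Monotone fun n => p.eval n := by
  intro m n h
  induction p using Polynomial.induction_on' with
  | add p q hp hq => simpa using Nat.add_le_add hp hq
  | monomial k c =>
    simpa [Polynomial.eval_monomial] using Nat.mul_le_mul_left c (Nat.pow_le_pow_left h k)

/-- The control points of `machine` outside its program. -/
inductive AnswerLabel
  | read
  | answer
  deriving DecidableEq

instance : Fintype AnswerLabel := ⟨{.read, .answer}, by rintro (_ | _) <;> decide⟩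

section statements

variable {Λ : Type} [NeZero N] (emb : α → A) (a₀ : A)

/-- The statement that moves one symbol of the input to work stack `0`; the symbol `a₀` is never
used. -/
def readStmt (read next : Λ) : TM2.Stmt (Alph α β A (N := N)) Λ (Option α × Option A) :=
  .pop none (fun s o => (o, s.2)) <|
    .branch (fun s => s.1.isSome)
      (.push (work N 0) (fun s => (s.1.map emb).getD a₀) (.goto fun _ => read))
      (.goto fun _ => next)

theorem stepsIn_read (read next : Λ)
    (R : TM2.Cfg (Alph α β A (N := N)) Λ (Option α × Option A) →
      TM2.Cfg (Alph α β A (N := N)) Λ (Option α × Option A) → Prop)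
    (hR : ∀ v T, R ⟨some read, v, T⟩ (TM2.stepAux (readStmt emb a₀ read next) v T))
    (x : List α) (y : List β) (l : List A) (v : Option α × Option A) :
    StepsIn R (x.length + 1) ⟨some read, v, tapes x y (store [l])⟩
      ⟨some next, (none, v.2), tapes [] y (store [(x.map emb).reverse ++ l])⟩ := by
  induction x generalizing l v with
  | nil =>
    have h := hR v (tapes [] y (store [l]))
    rw [readStmt, stepAux_pop_input] at h
    exact .single h
  | cons a x ih =>
    have h := hR v (tapes (a :: x) y (store [l]))
    rw [readStmt, stepAux_pop_input, TM2.stepAux, List.head?_cons, Option.isSome_some, cond_true,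
      stepAux_push_work _ _ _ (NeZero.pos N), update_store] at h
    refine ⟨_, h, ?_⟩
    simpa [setStack] using ih (emb a :: l) (some a, v.2)

/-- The statement that outputs whether work stack `0` is nonempty and halts. -/
def answerStmt : TM2.Stmt (Alph α Bool A (N := N)) Λ (Option α × Option A) :=
  .pop (work N 0) (fun s o => (s.1, o)) <|
    .push (some none) (fun s => s.2.isSome) <| .load (fun _ => (none, none)) .halt

theorem stepAux_answerStmt (x : List α) (y : List Bool) (b : Bool) (v : Option α × Option A) :
    TM2.stepAux (answerStmt (Λ := Λ)) v
        (tapes (N := N) x y (store [if b then [a₀] else []])) =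
      ⟨none, (none, none), tapes x (b :: y) (store [])⟩ := by
  rw [answerStmt, stepAux_pop_work _ _ _ (NeZero.pos N), stepAux_push_output, update_store,
    ← store_append_nil [] 1]
  cases b <;> rfl

/-- The statement that branches on whether work stack `0` is nonempty. -/
def testStmt (accept reject : Λ) : TM2.Stmt (Alph α β A (N := N)) Λ (Option α × Option A) :=
  .pop (work N 0) (fun s o => (s.1, o)) <|
    .goto fun s => if s.2.isSome then accept else reject

theorem stepAux_testStmt (accept reject : Λ) (x : List α) (y : List β) (b : Bool)
    (v : Option α × Option A) :
    (TM2.stepAux (testStmt accept reject) v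
      (tapes (N := N) x y (store [if b then [a₀] else []]))).l =
        some (if b then accept else reject) := by
  rw [testStmt, stepAux_pop_work _ _ _ (NeZero.pos N)]
  cases b <;> rfl

end statements

section machine

variable [Fintype A] [Fintype α] (emb : α → A) (a₀ : A) (P : Prog A)

/-- The machine that reads its input, runs the program `P`, and outputs whether work stack `0` is
nonempty. -/
noncomputable def machine : FinTM2 where
  K := Idx (P.bound + 1)
  k₀ := none
  k₁ := some none
  Γ := Alph α Bool A
  Λ := P.Lab ⊕ AnswerLabel
  main := .inr .read
  σ := Option α × Option A
  initialState := (none, none)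
  Γk₀Fin := inferInstanceAs (Fintype α)
  m l :=
    match l with
    | .inl l => P.code .inl (.inr .answer) l
    | .inr .read => readStmt emb a₀ (.inr .read) (.inl P.entry)
    | .inr .answer => answerStmt

theorem initList_machine (x : List α) :
    initList (machine emb a₀ P) x = ⟨some (.inr .read), (none, none), tapes x [] (store [[]])⟩ := by
  rw [show store [([] : List A)] = store [] from store_append_nil [] 1]
  simp only [initList, machine]
  congr 1
  funext k
  rcases k with _ | _ | j <;> rfl

theorem machine_answer (b : Bool) (v : Option α × Option A) :
    (machine emb a₀ P).step ⟨some (.inr .answer), v, tapes [] [] (store [if b then [a₀] else []])⟩ =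
      some (haltList (machine emb a₀ P) [b]) := by
  refine congrArg some ((stepAux_answerStmt a₀ [] [] b v).trans ?_)
  simp only [haltList]
  congr 1
  funext k
  rcases k with _ | _ | j <;> rfl

theorem machine_outputs {x : List α} {b : Bool} {t : ℕ}
    (h : Run P (store [(x.map emb).reverse]) (store [if b then [a₀] else []]) t) :
    Nonempty (TM2OutputsInTime (machine emb a₀ P) x (some [b]) (x.length + t + 2)) := by
  let R (c d : (machine emb a₀ P).Cfg) : Prop := (machine emb a₀ P).step c = some d
  have hread := stepsIn_read (N := P.bound + 1) (β := Bool) (Λ := P.Lab ⊕ AnswerLabel) emb a₀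
    (.inr .read) (.inl P.entry) R (fun v T => rfl) x [] [] (none, none)
  rw [List.append_nil] at hread
  obtain ⟨o, hrun⟩ := h.stepsIn_code (N := P.bound + 1) (Nat.le_succ _)
    (Λ := P.Lab ⊕ AnswerLabel) .inl (.inr .answer) R (fun l v T => rfl) [] [] (none, none)
  have hpath := (hread.trans hrun).trans (.single (machine_answer emb a₀ P b (none, o)))
  refine ⟨⟨⟨x.length + t + 2, ?_⟩, le_rfl⟩⟩
  rw [initList_machine, show x.length + t + 2 = x.length + 1 + t + 1 by ring]
  exact hpath.bind_iterate

end machine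

theorem computableInPolyTime_of_run {τ : Type} [Finite A] [Finite α] (emb : α → A) (a₀ : A)
    (P : Prog A) {ea : τ → List α} {f : τ → Bool} (p : Polynomial ℕ)
    (h : ∀ w, RunLe P (store [((ea w).map emb).reverse]) (store [if f w then [a₀] else []])
      (p.eval (ea w).length)) :
    Nonempty (TM2ComputableInPolyTime ea Computability.encodeBool f) := by
  have := Fintype.ofFinite A
  have := Fintype.ofFinite α
  refine ⟨⟨⟨machine emb a₀ P, .refl _, .refl _⟩, p + Polynomial.X + 2, fun w => ?_⟩⟩
  refine Classical.choice ?_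
  obtain ⟨t, ht, hr⟩ := h w
  obtain ⟨s⟩ := machine_outputs emb a₀ P hr
  have hmap : List.map (Equiv.refl α).invFun (ea w) = ea w := List.map_id _
  refine ⟨⟨⟨s.steps, ?_⟩, s.steps_le_m.trans ?_⟩⟩
  · have := s.evals_in_steps
    erw [hmap]
    exact this
  · simp only [Polynomial.eval_add, Polynomial.eval_X, Polynomial.eval_ofNat]
    omega

/-! ### Nondeterministic machines -/

/-- The function is bounded by `2 ^ r(n)` for some polynomial `r`. -/
def ExpBounded (e : ℕ → ℕ) : Prop := ∃ r : Polynomial ℕ, ∀ n, e n ≤ 2 ^ r.eval n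

namespace ExpBounded

variable {e e' : ℕ → ℕ}

theorem const (c : ℕ) : ExpBounded fun _ => c :=
  ⟨Polynomial.C c, fun n => by simpa using Nat.lt_two_pow_self.le⟩

theorem id : ExpBounded fun n => n :=
  ⟨Polynomial.X, fun n => by simpa using Nat.lt_two_pow_self.le⟩

theorem mul (h : ExpBounded e) (h' : ExpBounded e') : ExpBounded fun n => e n * e' n :=
  let ⟨r, hr⟩ := h
  let ⟨r', hr'⟩ := h'
  ⟨r + r', fun n => by simpa [pow_add] using Nat.mul_le_mul (hr n) (hr' n)⟩

theorem add (h : ExpBounded e) (h' : ExpBounded e') : ExpBounded fun n => e n + e' n :=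
  let ⟨r, hr⟩ := h
  let ⟨r', hr'⟩ := h'
  ⟨r + r' + 1, fun n => calc
    e n + e' n ≤ 2 ^ r.eval n + 2 ^ r'.eval n := Nat.add_le_add (hr n) (hr' n)
    _ ≤ 2 ^ (r.eval n + r'.eval n) + 2 ^ (r.eval n + r'.eval n) := by gcongr <;> omega
    _ = 2 ^ (r + r' + 1).eval n := by simp [pow_succ, mul_two]⟩

theorem pow (h : ExpBounded e) (q : Polynomial ℕ) : ExpBounded fun n => e n ^ q.eval n :=
  let ⟨r, hr⟩ := h
  ⟨r * q, fun n => by simpa [pow_mul] using Nat.pow_le_pow_left (hr n) (q.eval n)⟩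

theorem polynomial (h : ExpBounded e) (p : Polynomial ℕ) : ExpBounded fun n => p.eval (e n) := by
  induction p using Polynomial.induction_on' with
  | add p q hp hq => simpa using hp.add hq
  | monomial k c =>
    simpa [Polynomial.eval_monomial] using (const c).mul (h.pow (Polynomial.C k))

end ExpBounded

section NTM

variable {M : NTM} {c d : M.toFinTM2.Cfg}

theorem reachesIn_iff_stepsIn {n : ℕ} : M.ReachesIn n c d ↔ StepsIn M.Step n c d := by
  induction n generalizing c with
  | zero => rfl
  | succ n ih => simp only [NTM.ReachesIn, StepsIn, ih]

/-- `d` is the only successor of `c`. -/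
def OnlyStep (M : NTM) (c d : M.toFinTM2.Cfg) : Prop := ∀ e, M.Step c e ↔ e = d

theorem OnlyStep.step (h : OnlyStep M c d) : M.Step c d := (h d).2 rfl

theorem onlyStep_of_eq {l : M.Λ} (h : M.m l = M.m' l) (v : M.σ) (T : ∀ k, List (M.Γ k)) :
    OnlyStep M ⟨some l, v, T⟩ (TM2.stepAux (M.m l) v T) := by
  refine fun e => ⟨?_, fun he => .inl (congrArg some he.symm)⟩
  rintro (he | he)
  · exact (Option.some.inj he).symm
  · rw [h]
    exact (Option.some.inj he).symm

/-- A run from `c` can still accept. -/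
def CanAccept (M : NTM) (c : M.toFinTM2.Cfg) : Prop :=
  ∃ n d, StepsIn M.Step n c d ∧ d.l = some M.accept

/-- No step leaves the label `l`. -/
def Halting (M : NTM) (l : M.Λ) : Prop :=
  ∀ c d : M.toFinTM2.Cfg, c.l = some l → M.Step c d → d.l = some l

theorem Halting.of_goto {l : M.Λ} (h : M.m l = .goto fun _ => l) (h' : M.m' l = .goto fun _ => l) :
    Halting M l := by
  rintro ⟨_, v, T⟩ d rfl (hd | hd)
  · rw [← Option.some.inj hd, h]
    rfl
  · rw [← Option.some.inj hd, h']
    rfl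

theorem Halting.stepsIn {l : M.Λ} (hl : Halting M l) {n : ℕ} (h : StepsIn M.Step n c d)
    (hc : c.l = some l) : d.l = some l := by
  induction n generalizing c with
  | zero => exact h ▸ hc
  | succ n ih =>
    obtain ⟨b, hb, h⟩ := h
    exact ih h (hl _ _ hc hb)

theorem CanAccept.of_onlyStep (hM : Halting M M.accept) (hc : CanAccept M c) {n : ℕ}
    (h : StepsIn (OnlyStep M) n c d) : CanAccept M d := by
  induction n generalizing c with
  | zero => exact h ▸ hc
  | succ n ih =>
    obtain ⟨b, hb, h⟩ := h
    refine ih ?_ h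
    obtain ⟨m, e, he, hl⟩ := hc
    cases m with
    | zero =>
      cases he
      exact ⟨0, b, rfl, hM _ _ hl hb.step⟩
    | succ m =>
      obtain ⟨b', hb', he⟩ := he
      cases (hb b').1 hb'
      exact ⟨m, e, he, hl⟩

end NTM

/-- The control points of `guessMachine` outside its program. -/
inductive GuessLabel
  | read
  | choose
  | write
  | test
  | accept
  | reject
  deriving DecidableEq

instance : Fintype GuessLabel :=
  ⟨{.read, .choose, .write, .test, .accept, .reject}, by rintro (_ | _) <;> decide⟩

section guessMachine

variable [Fintype A] [Fintype α] (emb : α → A) (bit : Bool → A) (a₀ : A) (P : Prog A)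

/-- The machine that reads its input, writes some bits onto work stack `1`, runs the program `P`,
and accepts if then work stack `0` is nonempty. Its two programs differ in the labels `choose`,
where it either starts `P` or writes another bit, and `write`, where it picks that bit. -/
noncomputable def guessMachine : NTM where
  K := Idx (P.bound + 2)
  k₀ := none
  k₁ := some none
  Γ := Alph α Unit A
  Λ := P.Lab ⊕ GuessLabel
  main := .inr .read
  σ := Option α × Option A
  initialState := (none, none)
  Γk₀Fin := inferInstanceAs (Fintype α)
  m l :=
    match l with
    | .inl l => P.code .inl (.inr .test) l
    | .inr .read => readStmt emb a₀ (.inr .read) (.inr .choose)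
    | .inr .choose => .goto fun _ => .inl P.entry
    | .inr .write => .push (work _ 1) (fun _ => bit false) (.goto fun _ => .inr .choose)
    | .inr .test => testStmt (.inr .accept) (.inr .reject)
    | .inr .accept => .goto fun _ => .inr .accept
    | .inr .reject => .goto fun _ => .inr .reject
  m' l :=
    match l with
    | .inl l => P.code .inl (.inr .test) l
    | .inr .read => readStmt emb a₀ (.inr .read) (.inr .choose)
    | .inr .choose => .goto fun _ => .inr .write
    | .inr .write => .push (work _ 1) (fun _ => bit true) (.goto fun _ => .inr .choose)
    | .inr .test => testStmt (.inr .accept) (.inr .reject)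
    | .inr .accept => .goto fun _ => .inr .accept
    | .inr .reject => .goto fun _ => .inr .reject
  accept := .inr .accept

variable {emb bit a₀ P}

theorem initList_guessMachine (x : List α) :
    initList (guessMachine emb bit a₀ P).toFinTM2 x =
      ⟨some (.inr .read), (none, none), tapes x [] (store [[]])⟩ := by
  rw [show store [([] : List A)] = store [] from store_append_nil [] 1]
  simp only [initList, guessMachine]
  congr 1
  funext k
  rcases k with _ | _ | j <;> rfl

/-- The configuration of `guessMachine` with label `l` after the input `x` has been read and the
bits `y` have been guessed. -/
def guessed (x : List α) (y : List Bool) (l : P.Lab ⊕ GuessLabel) :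
    (guessMachine emb bit a₀ P).toFinTM2.Cfg :=
  ⟨some l, (none, none), tapes [] [] (store [(x.map emb).reverse, y.map bit])⟩

theorem guessMachine_read (x : List α) :
    StepsIn (OnlyStep (guessMachine emb bit a₀ P)) (x.length + 1)
      (initList (guessMachine emb bit a₀ P).toFinTM2 x) (guessed x [] (.inr .choose)) := by
  rw [initList_guessMachine]
  have h := stepsIn_read (N := P.bound + 2) (β := Unit) (Λ := P.Lab ⊕ GuessLabel) emb a₀
    (.inr .read) (.inr .choose) (OnlyStep (guessMachine emb bit a₀ P))
    (onlyStep_of_eq (M := guessMachine emb bit a₀ P) (l := .inr .read) rfl) x [] [] (none, none)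
  rw [List.append_nil, ← store_append_nil [(x.map emb).reverse] 1] at h
  exact h

theorem guessMachine_run {x : List α} {y : List Bool} {b : Bool} {t : ℕ}
    (h : Run P (store [(x.map emb).reverse, y.map bit]) (store [if b then [a₀] else []]) t) :
    ∃ c, StepsIn (OnlyStep (guessMachine emb bit a₀ P)) (t + 1) (guessed x y (.inl P.entry)) c ∧
      c.l = some (.inr (if b then .accept else .reject)) := by
  let M := guessMachine emb bit a₀ P
  obtain ⟨o, h⟩ := h.stepsIn_code (N := P.bound + 2) (by omega) (Λ := P.Lab ⊕ GuessLabel) .inl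
    (.inr .test) (OnlyStep M) (fun l => onlyStep_of_eq (M := M) (l := .inl l) rfl) [] []
    (none, none)
  refine ⟨_, h.trans (.single (onlyStep_of_eq (M := M) (l := .inr .test) rfl _ _)), ?_⟩
  refine (stepAux_testStmt (Λ := P.Lab ⊕ GuessLabel) a₀ (.inr .accept) (.inr .reject) [] [] b
    (none, o)).trans ?_
  cases b <;> rfl

theorem step_choose_iff {x : List α} {y : List Bool}
    {c : (guessMachine emb bit a₀ P).toFinTM2.Cfg} :
    (guessMachine emb bit a₀ P).Step (guessed x y (.inr .choose)) c ↔
      c = guessed x y (.inl P.entry) ∨ c = guessed x y (.inr .write) :=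
  or_congr (Option.some_inj.trans eq_comm) (Option.some_inj.trans eq_comm)

theorem step_write_iff {x : List α} {y : List Bool}
    {c : (guessMachine emb bit a₀ P).toFinTM2.Cfg} :
    (guessMachine emb bit a₀ P).Step (guessed x y (.inr .write)) c ↔
      ∃ b, c = guessed x (b :: y) (.inr .choose) := by
  have hwrite (b : Bool) : TM2.stepAux (.push (work (P.bound + 2) 1) (fun _ => bit b)
      (.goto fun _ => .inr .choose)) (none, none) (tapes (α := α) (β := Unit) [] []
        (store [(x.map emb).reverse, y.map bit])) =
      guessed (emb := emb) (bit := bit) (a₀ := a₀) x (b :: y) (.inr .choose) := by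
    rw [stepAux_push_work _ _ _ (by omega), update_store]
    rfl
  rw [Bool.exists_bool, ← hwrite, ← hwrite]
  exact or_congr (Option.some_inj.trans eq_comm) (Option.some_inj.trans eq_comm)

theorem guessMachine_guess (x : List α) (y : List Bool) :
    StepsIn (guessMachine emb bit a₀ P).Step (2 * y.length)
      (guessed x [] (.inr .choose)) (guessed x y (.inr .choose)) := by
  induction y with
  | nil => rfl
  | cons b y ih =>
    exact ih.trans ⟨_, step_choose_iff.2 (.inr rfl), .single (step_write_iff.2 ⟨b, rfl⟩)⟩

theorem guessMachine_acceptsWithin {x : List α} {y : List Bool} {t : ℕ}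
    (h : Run P (store [(x.map emb).reverse, y.map bit]) (store [[a₀]]) t) :
    (guessMachine emb bit a₀ P).AcceptsWithin x (x.length + 2 * y.length + t + 3) := by
  obtain ⟨c, hc, hl⟩ := guessMachine_run (b := true) h
  have hread := (guessMachine_read (emb := emb) (bit := bit) (a₀ := a₀) (P := P) x).mono
    fun _ _ h => h.step
  have hrun := hc.mono fun _ _ h => h.step
  refine ⟨x.length + 1 + 2 * y.length + (t + 2), by omega, c, reachesIn_iff_stepsIn.2 ?_, hl⟩
  exact (hread.trans (guessMachine_guess x y)).trans ⟨_, step_choose_iff.2 (.inl rfl), hrun⟩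

theorem halting_accept : Halting (guessMachine emb bit a₀ P) (.inr .accept) :=
  .of_goto rfl rfl

theorem halting_reject : Halting (guessMachine emb bit a₀ P) (.inr .reject) :=
  .of_goto rfl rfl

theorem eq_true_of_canAccept {x : List α} {y : List Bool} {b : Bool} {t : ℕ}
    (h : Run P (store [(x.map emb).reverse, y.map bit]) (store [if b then [a₀] else []]) t)
    (hacc : CanAccept (guessMachine emb bit a₀ P) (guessed x y (.inl P.entry))) : b = true := by
  obtain ⟨c, hc, hl⟩ := guessMachine_run h
  obtain ⟨n, d, hd, hd'⟩ := hacc.of_onlyStep halting_accept hc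
  by_contra hb
  rw [if_neg hb] at hl
  cases (halting_reject.stepsIn hd hl).symm.trans hd'

theorem exists_canAccept_entry {x : List α} {n : ℕ}
    {c : (guessMachine emb bit a₀ P).toFinTM2.Cfg} (hc : c.l = some (.inr .accept)) :
    ∀ {y : List Bool} {l : GuessLabel}, l = .choose ∨ l = .write →
      StepsIn (guessMachine emb bit a₀ P).Step n (guessed x y (.inr l)) c →
      ∃ y, CanAccept (guessMachine emb bit a₀ P) (guessed x y (.inl P.entry)) := by
  induction n with
  | zero =>
    rintro y l hl rfl
    rcases hl with rfl | rfl <;> cases hc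
  | succ n ih =>
    rintro y l (rfl | rfl) ⟨d, hd, h⟩
    · rcases step_choose_iff.1 hd with rfl | rfl
      · exact ⟨y, n, c, h, hc⟩
      · exact ih (.inr rfl) h
    · obtain ⟨b, rfl⟩ := step_write_iff.1 hd
      exact ih (.inl rfl) h

theorem exists_canAccept_entry_of_acceptsWithin {x : List α} {t : ℕ}
    (h : (guessMachine emb bit a₀ P).AcceptsWithin x t) :
    ∃ y, CanAccept (guessMachine emb bit a₀ P) (guessed x y (.inl P.entry)) := by
  obtain ⟨n, -, c, hc, hl⟩ := h
  have hinit : CanAccept (guessMachine emb bit a₀ P) _ := ⟨n, c, reachesIn_iff_stepsIn.1 hc, hl⟩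
  obtain ⟨n, c, hc, hl⟩ := hinit.of_onlyStep halting_accept (guessMachine_read x)
  exact exists_canAccept_entry hl (.inl rfl) hc

end guessMachine

theorem nexptime_of_run [Finite A] [Finite α] (emb : α → A) (bit : Bool → A) (a₀ : A)
    (P : Prog A) {L : Set (List α)} {f : List α → List Bool → Bool} {e : ℕ → ℕ}
    (he : ExpBounded e) (p : Polynomial ℕ)
    (hf : ∀ x y, RunLe P (store [(x.map emb).reverse, y.map bit])
      (store [if f x y then [a₀] else []]) (p.eval (x.length + y.length)))
    (sound : ∀ x y, f x y = true → x ∈ L)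
    (complete : ∀ x ∈ L, ∃ y, y.length ≤ e x.length ∧ f x y = true) : NEXPTIME L := by
  have := Fintype.ofFinite A
  have := Fintype.ofFinite α
  obtain ⟨r, hr⟩ := ((ExpBounded.id.add ((ExpBounded.const 2).mul he)).add
    ((ExpBounded.id.add he).polynomial p)).add (.const 3)
  refine ⟨guessMachine emb bit a₀ P, .refl _, r, fun x => ?_⟩
  have hmap : List.map (Equiv.refl α).symm x = x := List.map_id _
  erw [hmap]
  constructor
  · intro hx
    obtain ⟨y, hy, hxy⟩ := complete x hx
    obtain ⟨t, ht, hrun⟩ := hf x y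
    rw [hxy] at hrun
    obtain ⟨n, hn, hacc⟩ := guessMachine_acceptsWithin hrun
    have ht' := ht.trans (monotone_polynomial_eval p (Nat.add_le_add_left hy x.length))
    have hr' := hr x.length
    beta_reduce at hr' ht'
    exact ⟨n, by omega, hacc⟩
  · intro h
    obtain ⟨y, hy⟩ := exists_canAccept_entry_of_acceptsWithin h
    obtain ⟨t, -, hrun⟩ := hf x y
    exact sound x y (eq_true_of_canAccept hrun hy)

/-! ### Stack manipulation -/

/-- The program that empties stack `k`. -/
def clear (k : ℕ) : Prog A := .loop k fun _ => .skip

theorem runLe_clear (k : ℕ) (S : Store A) :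
    RunLe (clear k) S (update S k []) (2 * (S k).length + 1) := by
  generalize hl : S k = l
  induction l generalizing S with
  | nil =>
    rw [show update S k [] = S by rw [← hl, update_eq_self]]
    exact .loop_nil hl
  | cons a l ih =>
    have h := ih (update S k l) (update_self ..)
    rw [update_idem] at h
    exact (RunLe.loop_cons hl .skip h).mono (by rw [List.length_cons]; omega)

theorem runLe_clear_zero (x : List A) (l : List (List A)) :
    RunLe (clear 0) (store (x :: l)) (store ([] :: l)) (2 * x.length + 1) :=
  (runLe_clear 0 _).congr (update_store ..) le_rfl

/-- The program that moves the contents of stack `j` to stack `k`, in reverse order. -/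
def move (j k : ℕ) : Prog A := .loop j fun a => .push k a

theorem runLe_move {j k : ℕ} (hjk : j ≠ k) (S : Store A) :
    RunLe (move j k) S (update (update S j []) k ((S j).reverse ++ S k))
      (2 * (S j).length + 1) := by
  generalize hl : S j = l
  induction l generalizing S with
  | nil =>
    rw [show update S j [] = S by rw [← hl, update_eq_self]]
    simp only [List.reverse_nil, List.nil_append, update_eq_self]
    exact .loop_nil hl
  | cons a l ih =>
    have hpush : RunLe (.push k a) (update S j l) (update (update S j l) k (a :: S k)) 1 :=
      .push (by rw [update_of_ne hjk.symm])
    refine (RunLe.loop_cons hl hpush (ih _ (by simp [hjk]))).congr ?_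
      (by rw [List.length_cons]; omega)
    funext i
    grind [update_apply]

/-- The program that moves the contents of stack `k` to both stacks `i` and `j`, in reverse
order. -/
def fork (k i j : ℕ) : Prog A := .loop k fun a => .seq (.push i a) (.push j a)

theorem runLe_fork {i j k : ℕ} (hik : i ≠ k) (hjk : j ≠ k) (hij : i ≠ j) (S : Store A) :
    RunLe (fork k i j) S (update (update (update S k []) i ((S k).reverse ++ S i)) j
      ((S k).reverse ++ S j)) (3 * (S k).length + 1) := by
  generalize hl : S k = l
  induction l generalizing S with
  | nil =>
    rw [show update S k [] = S by rw [← hl, update_eq_self]]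
    simp only [List.reverse_nil, List.nil_append, update_eq_self]
    exact .loop_nil hl
  | cons a l ih =>
    have hpush : RunLe (.seq (.push i a) (.push j a)) (update S k l)
        (update (update (update S k l) i (a :: S i)) j (a :: S j)) (1 + 1) :=
      .seq (.push rfl) (.push (by simp [hij.symm, hjk, hik]))
    refine (RunLe.loop_cons hl hpush (ih _ (by simp [hik.symm, hjk.symm]))).congr ?_
      (by rw [List.length_cons]; omega)
    funext n
    grind [update_apply]

/-- The program that copies stack `j` to the empty stack `n`, using the empty stack `n + 1`. -/
def copy (j n : ℕ) : Prog A := .seq (move j (n + 1)) (fork (n + 1) j n)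

theorem runLe_copy {l : List (List A)} {j : ℕ} (h : j < l.length) :
    RunLe (copy j l.length) (store l) (store (l ++ [l[j]])) (5 * l[j].length + 2) := by
  have hj : store l j = l[j] := List.getD_eq_getElem _ _ h
  have hempty : store l (l.length + 1) = [] := List.getD_eq_default _ _ (by omega)
  refine ((runLe_move (by omega) _).seq (runLe_fork (by omega) (by omega) (by omega) _)).congr
    (funext fun i => ?_) ?_
  · simp only [update_apply, store_apply, List.getD_eq_getElem?_getD, List.getElem?_append]
    grind
  · rw [update_self, hj, hempty, List.append_nil, List.length_reverse]
    omega

/-- The total length of the stacks. -/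
def total (l : List (List A)) : ℕ := (l.map List.length).sum

@[simp] theorem total_nil : total ([] : List (List A)) = 0 := rfl

@[simp] theorem total_cons (x : List A) (l : List (List A)) :
    total (x :: l) = x.length + total l := by simp [total]

@[simp] theorem total_append (l l' : List (List A)) : total (l ++ l') = total l + total l' := by
  simp [total]

/-- The program that copies the first `m` of `n` stacks to the stacks from `n` on. -/
def copyAll (n : ℕ) : ℕ → Prog A
  | 0 => .skip
  | m + 1 => .seq (copyAll n m) (copy m (n + m))

theorem runLe_copyAll (g r : List (List A)) {m n : ℕ} (hm : g.length = m)
    (hn : (g ++ r).length = n) :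
    RunLe (copyAll n m) (store (g ++ r)) (store (g ++ r ++ g)) (5 * total g + 2 * m + 1) := by
  suffices h : ∀ k ≤ m, RunLe (copyAll n k) (store (g ++ r)) (store (g ++ r ++ g.take k))
      (5 * total (g.take k) + 2 * k + 1) by
    simpa [← hm] using h m le_rfl
  intro k hk
  induction k with
  | zero => simpa [copyAll] using RunLe.skip.mono (by omega)
  | succ k ih =>
    have hkg : k < g.length := by omega
    have hlen : (g ++ r ++ g.take k).length = n + k := by
      rw [List.length_append, hn, List.length_take_of_le hkg.le]
    have htake : g.take k ++ [g[k]] = g.take (k + 1) := List.take_concat_get' g k hkg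
    have hget : (g ++ r ++ g.take k)[k]'(by simp; omega) = g[k] := by
      rw [List.getElem_append_left (by simp; omega), List.getElem_append_left hkg]
    have hcopy := runLe_copy (l := g ++ r ++ g.take k) (j := k) (by simp; omega)
    rw [hget, hlen, List.append_assoc _ _ [g[k]], htake] at hcopy
    refine ((ih (by omega)).seq hcopy).mono ?_
    have htotal : total (g.take (k + 1)) = total (g.take k) + g[k].length := by
      rw [← htake, total_append, total_cons, total_nil, Nat.add_zero]
    omega

/-- The program that empties the first `n` stacks. -/
def clearAll : ℕ → Prog A
  | 0 => .skip
  | n + 1 => .seq (clear 0) ((clearAll n).shift 1)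

theorem runLe_clearAll (l : List (List A)) :
    RunLe (clearAll l.length) (store l) (store []) (2 * total l + l.length + 1) := by
  induction l with
  | nil => exact .skip
  | cons x l ih =>
    refine ((runLe_clear_zero x l).seq (ih.shift [[]] rfl)).congr (store_append_nil [] 1) ?_
    simp only [total_cons, List.length_cons]
    omega

/-- The program that removes the first of `n + 1` stacks. -/
def dropOne : ℕ → Prog A
  | 0 => clear 0
  | n + 1 => .seq (clear 0)
      (.seq (.seq (move 1 (n + 2)) (move (n + 2) 0)) ((dropOne n).shift 1))

theorem runLe_dropOne (x : List A) (l : List (List A)) :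
    RunLe (dropOne l.length) (store (x :: l)) (store l)
      (2 * x.length + 4 * total l + 3 * l.length + 1) := by
  induction l generalizing x with
  | nil => exact (runLe_clear_zero x []).congr (store_append_nil [] 1) (by simp)
  | cons y l ih =>
    have hmove : RunLe (.seq (move 1 (l.length + 2)) (move (l.length + 2) 0))
        (store ([] :: y :: l)) (store (y :: [] :: l)) (4 * y.length + 2) := by
      refine ((runLe_move (by omega) _).seq (runLe_move (by omega) _)).congr
        (funext fun i => ?_) (by simp; omega)
      rcases i with _ | _ | i
      · simp
      · simp
      · by_cases hi : i = l.length <;> simp [hi]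
    have hdrop : RunLe ((dropOne l.length).shift 1) (store (y :: [] :: l)) (store (y :: l)) _ :=
      (ih []).shift [y] rfl
    refine ((runLe_clear_zero x (y :: l)).seq (hmove.seq hdrop)).mono ?_
    simp only [total_cons, List.length_cons, List.length_nil]
    omega

/-- The program that removes the first `m` of `m + n` stacks. -/
def dropAll (n : ℕ) : ℕ → Prog A
  | 0 => .skip
  | m + 1 => .seq (dropOne (m + n)) (dropAll n m)

theorem runLe_dropAll (g l : List (List A)) {m n : ℕ} (hm : g.length = m) (hn : l.length = n) :
    RunLe (dropAll n m) (store (g ++ l)) (store l)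
      (m * (4 * (total g + total l) + 3 * (m + n) + 1) + 1) := by
  subst hm hn
  induction g with
  | nil => exact RunLe.skip.mono (by simp)
  | cons x g ih =>
    have h := runLe_dropOne x (g ++ l)
    rw [List.length_append] at h
    refine (h.seq ih).mono ?_
    simp only [total_append, total_cons, List.length_cons]
    nlinarith [Nat.zero_le (g.length * x.length)]

end StackProg

namespace UCQNeg

open StackProg Function

/-! ### Polynomial-time functions -/

/-- The letters are the two bits and five punctuation marks. -/
def Letter.equiv : Letter ≃ Bool ⊕ Fin 5 where
  toFun
    | .bit b => .inl b
    | .endName => .inr 0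
    | .endAtom => .inr 1
    | .endAtoms => .inr 2
    | .endCQ => .inr 3
    | .endUCQ => .inr 4
  invFun
    | .inl b => .bit b
    | .inr 0 => .endName
    | .inr 1 => .endAtom
    | .inr 2 => .endAtoms
    | .inr 3 => .endCQ
    | .inr 4 => .endUCQ
  left_inv x := by cases x <;> rfl
  right_inv x := by
    rcases x with b | i
    · rfl
    · fin_cases i <;> rfl

instance : DecidableEq Letter := Letter.equiv.injective.decidableEq

instance : Finite Letter := .of_equiv _ Letter.equiv.symm

/-- The stack symbols: the letters of an input, the bits of a certificate, and a separator
`none`. -/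
abbrev Sym := Option (Letter ⊕ Bool)

/-- The contents of a stack. -/
abbrev Str := List Sym

/-- Types whose elements are represented by a fixed number of stacks. -/
class StackRep (Γ : Type) where
  arity : ℕ
  rep : Γ → List Str
  length_rep : ∀ g, (rep g).length = arity

open StackRep

instance : StackRep Str := ⟨1, fun s => [s], fun _ => rfl⟩

instance : StackRep Bool := ⟨1, fun b => [if b then [none] else []], fun _ => rfl⟩

instance {Γ Γ' : Type} [StackRep Γ] [StackRep Γ'] : StackRep (Γ × Γ') :=
  ⟨arity Γ + arity Γ', fun p => rep p.1 ++ rep p.2, fun p => by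
    rw [List.length_append, length_rep, length_rep]⟩

variable {Γ Γ' Δ : Type} [StackRep Γ] [StackRep Γ'] [StackRep Δ]

/-- The total length of the stacks that represent `g`. -/
def size (g : Γ) : ℕ := total (rep g)

@[simp] theorem size_str (s : Str) : size s = s.length := by simp [size, rep]

@[simp] theorem size_prod (p : Γ × Γ') : size p = size p.1 + size p.2 := total_append _ _

theorem size_bool_le (b : Bool) : size b ≤ 1 := by cases b <;> simp [size, rep]

/-- The function is bounded by a polynomial in the size of its argument. -/
def PolyBounded (b : Γ → ℕ) : Prop := ∃ p : Polynomial ℕ, ∀ g, b g ≤ p.eval (size g)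

namespace PolyBounded

variable {b b' : Γ → ℕ}

theorem mono (h : PolyBounded b') (hb : ∀ g, b g ≤ b' g) : PolyBounded b :=
  let ⟨p, hp⟩ := h
  ⟨p, fun g => (hb g).trans (hp g)⟩

theorem const (c : ℕ) : PolyBounded fun _ : Γ => c :=
  ⟨Polynomial.C c, fun _ => by simp⟩

theorem size : PolyBounded fun g : Γ => size g :=
  ⟨Polynomial.X, fun _ => by simp⟩

theorem add (h : PolyBounded b) (h' : PolyBounded b') : PolyBounded fun g => b g + b' g :=
  let ⟨p, hp⟩ := h
  let ⟨p', hp'⟩ := h'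
  ⟨p + p', fun g => by simpa using Nat.add_le_add (hp g) (hp' g)⟩

theorem mul (h : PolyBounded b) (h' : PolyBounded b') : PolyBounded fun g => b g * b' g :=
  let ⟨p, hp⟩ := h
  let ⟨p', hp'⟩ := h'
  ⟨p * p', fun g => by simpa using Nat.mul_le_mul (hp g) (hp' g)⟩

theorem comp {c : Γ' → ℕ} (hc : PolyBounded c) {f : Γ → Γ'}
    (hf : PolyBounded fun g => UCQNeg.size (f g)) : PolyBounded fun g => c (f g) :=
  let ⟨p, hp⟩ := hc
  let ⟨q, hq⟩ := hf
  ⟨p.comp q, fun g => (hp (f g)).trans (by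
    simpa [Polynomial.eval_comp] using monotone_polynomial_eval p (hq g))⟩

theorem polynomial (p : Polynomial ℕ) (h : PolyBounded b) : PolyBounded fun g => p.eval (b g) :=
  let ⟨q, hq⟩ := h
  ⟨p.comp q, fun g => by simpa [Polynomial.eval_comp] using monotone_polynomial_eval p (hq g)⟩

theorem sum {ι : Type*} [Fintype ι] {b : ι → Γ → ℕ} (h : ∀ i, PolyBounded (b i)) :
    PolyBounded fun g => ∑ i, b i g := by
  choose p hp using h
  exact ⟨∑ i, p i, fun g => by
    simpa [Polynomial.eval_finsetSum] using Finset.sum_le_sum fun i _ => hp i g⟩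

theorem fst {b : Γ → ℕ} (h : PolyBounded b) : PolyBounded fun p : Γ × Γ' => b p.1 :=
  h.comp (size.mono fun p => by simp)

theorem snd {b : Γ' → ℕ} (h : PolyBounded b) : PolyBounded fun p : Γ × Γ' => b p.2 :=
  h.comp (size.mono fun p => by simp)

end PolyBounded

/-- The function is computed by a program whose running time is bounded by a polynomial, as is the
size of the values. -/
def PolyTime (f : Γ → Γ') : Prop :=
  ∃ (P : Prog Sym) (b : Γ → ℕ), (∀ g, RunLe P (store (rep g)) (store (rep (f g))) (b g)) ∧
    PolyBounded b ∧ PolyBounded fun g => size (f g)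

namespace PolyTime

theorem id : PolyTime (fun g : Γ => g) := ⟨.skip, _, fun _ => .skip, .const 1, .size⟩

theorem comp {h : Γ' → Δ} {f : Γ → Γ'} (hh : PolyTime h) (hf : PolyTime f) :
    PolyTime fun g => h (f g) :=
  let ⟨P, b, hP, hb, hs⟩ := hf
  let ⟨Q, b', hQ, hb', hs'⟩ := hh
  ⟨.seq P Q, fun g => b g + b' (f g), fun g => (hP g).seq (hQ (f g)), hb.add (hb'.comp hs),
    hs'.comp hs⟩

theorem pair {f : Γ → Γ'} {h : Γ → Δ} (hf : PolyTime f) (hh : PolyTime h) :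
    PolyTime fun g => (f g, h g) := by
  obtain ⟨P, b, hP, hb, hs⟩ := hf
  obtain ⟨Q, b', hQ, hb', hs'⟩ := hh
  let m := arity Γ
  let m' := arity Γ'
  let m'' := arity Δ
  have hpair : PolyBounded fun g => size (f g, h g) := (hs.add hs').mono fun g => by simp
  refine ⟨.seq (copyAll m m) (.seq (P.shift m) (.seq (copyAll (m + m') m)
    (.seq (Q.shift (m + m')) (dropAll (m' + m'') m)))), fun g => 5 * size g + 2 * m + 1 +
    (b g + (5 * size g + 2 * m + 1 + (b' g +
      (m * (4 * (size g + size (f g, h g)) + 3 * (m + (m' + m'')) + 1) + 1)))), fun g => ?_, ?_,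
    hpair⟩
  · have hm : (rep g).length = m := length_rep g
    have hm' : (rep (f g)).length = m' := length_rep _
    have hcopy := runLe_copyAll (rep g) [] hm (by simpa using hm)
    have hcopy' := runLe_copyAll (rep g) (rep (f g)) (n := m + m') hm (by simp [hm, hm'])
    have hrun' := (hQ g).shift (rep g ++ rep (f g)) (n := m + m') (by simp [hm, hm'])
    have hdrop := runLe_dropAll (rep g) (rep (f g, h g)) (n := m' + m'') hm (length_rep _)
    rw [List.append_nil] at hcopy
    rw [List.append_assoc (rep g) _ (rep (h g))] at hrun'
    exact hcopy.seq (((hP g).shift (rep g) hm).seq (hcopy'.seq (hrun'.seq hdrop)))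
  · apply_rules [PolyBounded.add, PolyBounded.mul, PolyBounded.const, PolyBounded.size]

theorem fst : PolyTime (fun p : Γ × Γ' => p.1) := by
  refine ⟨(clearAll (arity Γ')).shift (arity Γ), fun p => 2 * size p.2 + arity Γ' + 1,
    fun p => ?_, ?_, .fst .size⟩
  · have h := (runLe_clearAll (rep p.2)).shift (rep p.1) (length_rep p.1)
    rwa [length_rep, List.append_nil] at h
  · exact (((PolyBounded.const 2).mul (.snd .size)).add (.const _)).add (.const 1)

theorem snd : PolyTime (fun p : Γ × Γ' => p.2) := by
  let m := arity Γ
  let m' := arity Γ'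
  refine ⟨dropAll m' m, fun p => m * (4 * (size p.1 + size p.2) + 3 * (m + m') + 1) + 1,
    fun p => runLe_dropAll (rep p.1) (rep p.2) (length_rep _) (length_rep _), ?_, .snd .size⟩
  apply_rules [PolyBounded.add, PolyBounded.mul, PolyBounded.const, PolyBounded.fst,
    PolyBounded.snd, PolyBounded.size]

/-- The program that writes a string onto the empty stack `0`. -/
def writeStr : Str → Prog Sym
  | [] => .skip
  | a :: s => .seq (writeStr s) (.push 0 a)

theorem runLe_writeStr (s : Str) : RunLe (writeStr s) (store []) (store [s]) (s.length + 1) := by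
  induction s with
  | nil => exact RunLe.skip.congr (store_append_nil [] 1).symm (by simp)
  | cons a s ih =>
    refine (ih.seq (.push (S' := store [a :: s]) ?_)).mono (by simp)
    exact update_store ..

/-- The program that writes strings onto empty stacks. -/
def writeAll : List Str → Prog Sym
  | [] => .skip
  | s :: l => .seq (writeStr s) ((writeAll l).shift 1)

theorem runLe_writeAll (l : List Str) :
    RunLe (writeAll l) (store []) (store l) (total l + l.length + 1) := by
  induction l with
  | nil => exact .skip
  | cons s l ih =>
    refine ((runLe_writeStr s).seq (ih.shift [s] rfl)).mono ?_
    simp only [total_cons, List.length_cons]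
    omega

theorem const (c : Γ') : PolyTime (fun _ : Γ => c) := by
  refine ⟨.seq (clearAll (arity Γ)) (writeAll (rep c)),
    fun g => 2 * size g + arity Γ + 1 + (total (rep c) + (rep c).length + 1), fun g => ?_, ?_,
    .const _⟩
  · have h := runLe_clearAll (rep g)
    rw [length_rep] at h
    exact h.seq (runLe_writeAll (rep c))
  · apply_rules [PolyBounded.add, PolyBounded.mul, PolyBounded.const, PolyBounded.size]

theorem of_rep_eq {f : Γ → Γ'} {h : Γ → Δ} (hh : PolyTime h)
    (e : ∀ g, rep (f g) = rep (h g)) : PolyTime f := by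
  obtain ⟨P, b, hP, hb, hs⟩ := hh
  refine ⟨P, b, fun g => by simpa only [e] using hP g, hb, hs.mono fun g => ?_⟩
  simp only [size, e, le_refl]

theorem congr {f h : Γ → Γ'} (hh : PolyTime h) (e : ∀ g, f g = h g) : PolyTime f :=
  hh.of_rep_eq fun g => by rw [e]

theorem casesHead {F : Option Sym → Str × Γ → Γ'} (hF : ∀ o, PolyTime (F o)) :
    PolyTime fun p : Str × Γ => F p.1.head? (p.1.tail, p.2) := by
  have := Fintype.ofFinite (Option Sym)
  choose P b hP hb hs using hF
  have htail : PolyBounded fun p : Str × Γ => size (p.1.tail, p.2) :=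
    PolyBounded.size.mono fun p => by simp
  have hle (c : Option Sym → ℕ) (o : Option Sym) : c o ≤ ∑ o, c o :=
    Finset.single_le_sum (fun _ _ => Nat.zero_le _) (Finset.mem_univ o)
  refine ⟨.case 0 P, fun p => (∑ o, b o (p.1.tail, p.2)) + 1, fun p => .case ?_,
    (PolyBounded.sum fun o => (hb o).comp htail).add (.const 1),
    (PolyBounded.sum fun o => (hs o).comp htail).mono fun p =>
      hle (fun o => size (F o (p.1.tail, p.2))) p.1.head?⟩
  obtain ⟨s, g⟩ := p
  rw [update_store]
  exact (hP s.head? (s.tail, g)).mono (hle (fun o => b o (s.tail, g)) s.head?)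

theorem ite {b : Γ → Bool} {f h : Γ → Γ'} (hb : PolyTime b) (hf : PolyTime f)
    (hh : PolyTime h) : PolyTime fun g => if b g then f g else h g := by
  have hbStr : PolyTime fun g => if b g then ([none] : Str) else [] := hb.of_rep_eq fun _ => rfl
  let F : Option Sym → Str × Γ → Γ' := fun o p => if o.isSome then f p.2 else h p.2
  have hF (o : Option Sym) : PolyTime (F o) := by
    cases o with
    | none => exact hh.comp snd
    | some a => exact hf.comp snd
  exact ((casesHead hF).comp (hbStr.pair id)).congr fun g => by cases b g <;> simp [F]

theorem runLe_foldl {f : Γ → Sym → Γ} {P : Sym → Prog Sym} {b : Sym → Γ → ℕ}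
    (hP : ∀ a g, RunLe (P a) (store (rep g)) (store (rep (f g a))) (b a g)) (s : Str) (g : Γ)
    (t : ℕ) (ht : ∀ (s₁ s₂ : Str) (a : Sym), s = s₁ ++ a :: s₂ → b a (s₁.foldl f g) ≤ t) :
    RunLe (.loop 0 fun a => (P a).shift 1) (store (s :: rep g)) (store ([] :: rep (s.foldl f g)))
      (s.length * (t + 1) + 1) := by
  induction s generalizing g with
  | nil => exact (RunLe.loop_nil rfl).mono (by simp)
  | cons a s ih =>
    have hstep := ((hP a g).shift [s] rfl).mono (ht [] s a rfl)
    have hrest := ih (f g a) fun s₁ s₂ c hs => ht (a :: s₁) s₂ c (by rw [hs]; rfl)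
    refine (RunLe.loop_cons rfl ?_ hrest).mono (by rw [List.length_cons]; linarith)
    rw [update_store]
    exact hstep

theorem foldl {f : Γ → Sym → Γ} (hf : ∀ a, PolyTime fun g => f g a)
    (hsize : PolyBounded fun p : Str × Γ => size (p.1.foldl f p.2)) :
    PolyTime fun p : Str × Γ => p.1.foldl f p.2 := by
  have := Fintype.ofFinite Sym
  choose P b hP hb _ using hf
  obtain ⟨r, hr⟩ := PolyBounded.sum hb
  obtain ⟨q, hq⟩ := hsize
  refine snd.comp (Γ' := Str × Γ) (f := fun p : Str × Γ => (([] : Str), p.1.foldl f p.2))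
    ⟨.loop 0 fun a => (P a).shift 1,
      fun p => size p * (r.eval (q.eval (size p)) + 1) + 1, fun p => ?_, ?_, ?_⟩
  · obtain ⟨s, g⟩ := p
    refine (runLe_foldl hP s g (r.eval (q.eval (size (s, g)))) fun s₁ s₂ a hs => ?_).mono ?_
    · refine (Finset.single_le_sum (f := fun a => b a (s₁.foldl f g))
        (fun _ _ => Nat.zero_le _) (Finset.mem_univ a)).trans ((hr _).trans ?_)
      refine monotone_polynomial_eval r ((hq (s₁, g)).trans (monotone_polynomial_eval q ?_))
      simp only [size_prod, size_str, hs, List.length_append]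
      omega
    · exact Nat.add_le_add_right (Nat.mul_le_mul_right _ (by simp)) 1
  · exact (PolyBounded.size.mul ((PolyBounded.polynomial r
      (.polynomial q .size)).add (.const 1))).add (.const 1)
  · exact PolyBounded.mono ⟨q, hq⟩ fun p => by simp

/-! ### Booleans and strings -/

theorem not {b : Γ → Bool} (hb : PolyTime b) : PolyTime fun g => !b g :=
  (hb.ite (const false) (const true)).congr fun g => by cases b g <;> rfl

theorem and {b c : Γ → Bool} (hb : PolyTime b) (hc : PolyTime c) : PolyTime fun g => b g && c g :=
  (hb.ite hc (const false)).congr fun g => by cases b g <;> rfl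

theorem or {b c : Γ → Bool} (hb : PolyTime b) (hc : PolyTime c) : PolyTime fun g => b g || c g :=
  (hb.ite (const true) hc).congr fun g => by cases b g <;> rfl

theorem isEmpty : PolyTime (List.isEmpty : Str → Bool) := by
  have hF (o : Option Sym) : PolyTime fun _ : Str × Bool => o.isNone := const _
  exact ((casesHead hF).comp (id.pair (const true))).congr fun s => by cases s <;> rfl

theorem tail : PolyTime (List.tail : Str → Str) := by
  have hF (_ : Option Sym) : PolyTime fun p : Str × Bool => p.1 := fst
  exact (casesHead hF).comp (id.pair (const true))

theorem cons (a : Sym) : PolyTime (List.cons a : Str → Str) :=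
  ⟨.push 0 a, fun _ => 1, fun s => .push (update_store [s] 0 _), .const 1,
    (PolyBounded.size.add (.const 1)).mono fun s => by simp⟩

theorem reverse_append : PolyTime fun p : Str × Str => p.1.reverse ++ p.2 := by
  have hfold (p : Str × Str) : p.1.foldl (fun s a => a :: s) p.2 = p.1.reverse ++ p.2 := by simp
  exact (foldl cons (PolyBounded.size.mono fun p => by simp [hfold])).congr fun p => (hfold p).symm

theorem reverse : PolyTime (List.reverse : Str → Str) :=
  (reverse_append.comp (id.pair (const []))).congr fun s => by simp

theorem append {f h : Γ → Str} (hf : PolyTime f) (hh : PolyTime h) :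
    PolyTime fun g => f g ++ h g :=
  (reverse_append.comp ((reverse.comp hf).pair hh)).congr fun g => by simp

theorem eqStr : PolyTime fun p : Str × Str => decide (p.1 = p.2) := by
  let f (p : Str × Bool) (a : Sym) : Str × Bool := (p.1.tail, p.2 && p.1.head? = some a)
  have hfold (s : Str) (p : Str × Bool) :
      ((s.foldl f p).2 && (s.foldl f p).1.isEmpty) = (p.2 && decide (s = p.1)) := by
    induction s generalizing p with
    | nil => cases h : p.1 <;> simp [h]
    | cons a s ih =>
      rw [List.foldl_cons, ih, Bool.eq_iff_iff]
      cases h : p.1 <;> simp [f, h]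
      grind
  have hf (a : Sym) : PolyTime fun p => f p a := by
    let F (o : Option Sym) (p : Str × Bool) : Str × Bool := (p.1, p.2 && o = some a)
    have hF (o : Option Sym) : PolyTime (F o) := fst.pair (snd.and (const _))
    exact casesHead hF
  have hlength (s : Str) (p : Str × Bool) : (s.foldl f p).1.length ≤ p.1.length := by
    induction s generalizing p with
    | nil => exact le_rfl
    | cons a s ih => exact (ih _).trans (by simp [f])
  have hsize : PolyBounded fun p : Str × (Str × Bool) => size (p.1.foldl f p.2) :=
    (PolyBounded.size.add (.const 1)).mono fun p => by
      have := hlength p.1 p.2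
      have := size_bool_le (p.1.foldl f p.2).2
      simp only [size_prod, size_str]
      omega
  have hfinal : PolyTime fun p : Str × Bool => p.2 && p.1.isEmpty := snd.and (isEmpty.comp fst)
  exact (hfinal.comp ((foldl hf hsize).comp (fst.pair (snd.pair (const true))))).congr fun p => by
    simp [hfold]

theorem decide_eq_of_injective {α : Type} [StackRep α] [DecidableEq α] {e : α → Str}
    (he : PolyTime e) (hinj : Injective e) {f h : Γ → α} (hf : PolyTime f) (hh : PolyTime h) :
    PolyTime fun g => decide (f g = h g) :=
  (eqStr.comp ((he.comp hf).pair (he.comp hh))).congr fun g => by simp [hinj.eq_iff]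

end PolyTime

/-! ### Transducers -/

/-- The output on a string of a letter-by-letter transducer, whose states are `none` and the
symbols. -/
def transduce (δ : Option Sym → Sym → Option Sym × Str) : Option Sym → Str → Str
  | _, [] => []
  | q, a :: s => (δ q a).2 ++ transduce δ (δ q a).1 s

instance : StackRep (Option Sym) := ⟨1, fun q => [q.toList], fun _ => rfl⟩

theorem exists_length_transduce_le (δ : Option Sym → Sym → Option Sym × Str) :
    ∃ c, ∀ q s, (transduce δ q s).length ≤ c * s.length := by
  obtain ⟨c, hc⟩ := Finite.exists_le fun p : Option Sym × Sym => (δ p.1 p.2).2.length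
  refine ⟨c, fun q s => ?_⟩
  induction s generalizing q with
  | nil => simp [transduce]
  | cons a s ih =>
    have := ih (δ q a).1
    have := hc (q, a)
    simp only [transduce, List.length_append, List.length_cons]
    linarith

theorem PolyTime.transduce (δ : Option Sym → Sym → Option Sym × Str) (q : Option Sym) :
    PolyTime (transduce δ q) := by
  let f (p : Option Sym × Str) (a : Sym) : Option Sym × Str := ((δ p.1 a).1, p.2 ++ (δ p.1 a).2)
  have hfold (s : Str) (p : Option Sym × Str) :
      (s.foldl f p).2 = p.2 ++ UCQNeg.transduce δ p.1 s := by
    induction s generalizing p with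
    | nil => simp [UCQNeg.transduce]
    | cons a s ih => simp [ih, f, UCQNeg.transduce]
  have hf (a : Sym) : PolyTime fun p => f p a := by
    let F (q : Option Sym) (p : Str × Str) : Option Sym × Str := ((δ q a).1, p.2 ++ (δ q a).2)
    have hF (q : Option Sym) : PolyTime (F q) := (const _).pair (snd.append (const _))
    have hid : PolyTime fun p : Option Sym × Str => (p.1.toList, p.2) := id.of_rep_eq fun _ => rfl
    exact ((casesHead hF).comp hid).congr fun ⟨q, s⟩ => by cases q <;> rfl
  obtain ⟨c, hc⟩ := exists_length_transduce_le δ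
  have hstate (q : Option Sym) : size q ≤ 1 := by cases q <;> simp [size, rep]
  have hsize : PolyBounded fun p : Str × (Option Sym × Str) => size (p.1.foldl f p.2) := by
    refine (((PolyBounded.const 1).add .size).add ((PolyBounded.const c).mul .size)).mono
      fun p => ?_
    have := hc p.2.1 p.1
    have := hstate (p.1.foldl f p.2).1
    simp only [size_prod, size_str, hfold, List.length_append]
    nlinarith
  exact (snd.comp ((foldl hf hsize).comp (id.pair (const (q, []))))).congr fun s => by
    simp [hfold]

/-! ### Splitting strings -/

/-- The part of a string before the first `c`. -/
def before (c : Sym) (s : Str) : Str := s.takeWhile (· ≠ c)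

/-- The part of a string after the first `c`. -/
def after (c : Sym) (s : Str) : Str := (s.dropWhile (· ≠ c)).tail

theorem before_append {c : Sym} {u : Str} (h : c ∉ u) (r : Str) : before c (u ++ c :: r) = u := by
  induction u with
  | nil => simp [before]
  | cons a u ih =>
    simp only [List.mem_cons, not_or] at h
    simpa [before, Ne.symm h.1] using ih h.2

theorem after_append {c : Sym} {u : Str} (h : c ∉ u) (r : Str) : after c (u ++ c :: r) = r := by
  induction u with
  | nil => simp [after]
  | cons a u ih =>
    simp only [List.mem_cons, not_or] at h
    simpa [after, Ne.symm h.1] using ih h.2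

theorem PolyTime.before (c : Sym) : PolyTime (before c) := by
  let δ (q : Option Sym) (a : Sym) : Option Sym × Str :=
    if q = none ∧ a ≠ c then (none, [a]) else (some c, [])
  refine (PolyTime.transduce δ none).congr fun s => ?_
  have hsome (s : Str) : UCQNeg.transduce δ (some c) s = [] := by
    induction s with
    | nil => rfl
    | cons a s ih => simpa [UCQNeg.transduce, δ] using ih
  induction s with
  | nil => rfl
  | cons a s ih =>
    by_cases hac : a = c
    · simp [UCQNeg.before, UCQNeg.transduce, δ, hac, hsome]
    · simpa [UCQNeg.before, UCQNeg.transduce, δ, hac] using ih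

theorem PolyTime.after (c : Sym) : PolyTime (after c) := by
  let δ (q : Option Sym) (a : Sym) : Option Sym × Str :=
    if q = none then (if a = c then (some c, []) else (none, [])) else (some c, [a])
  refine (PolyTime.transduce δ none).congr fun s => ?_
  have hsome (s : Str) : UCQNeg.transduce δ (some c) s = s := by
    induction s with
    | nil => rfl
    | cons a s ih => simpa [UCQNeg.transduce, δ] using ih
  induction s with
  | nil => rfl
  | cons a s ih =>
    by_cases hac : a = c
    · simp [UCQNeg.after, UCQNeg.transduce, δ, hac, hsome]
    · simpa [UCQNeg.after, UCQNeg.transduce, δ, hac] using ih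

/-- The segments of `u ++ s` that end at an occurrence of `c` in `s`. -/
def segmentsFrom (c : Sym) (u : Str) : Str → List Str
  | [] => []
  | a :: s => if a = c then u :: segmentsFrom c [] s else segmentsFrom c (u ++ [a]) s

/-- The segments of a string that end with `c`, without the final `c`. -/
def segments (c : Sym) (s : Str) : List Str := segmentsFrom c [] s

theorem segmentsFrom_append {c : Sym} {s : Str} (h : c ∉ s) (u r : Str) :
    segmentsFrom c u (s ++ c :: r) = (u ++ s) :: segments c r := by
  induction s generalizing u with
  | nil => simp [segmentsFrom, segments]
  | cons a s ih =>
    simp only [List.mem_cons, not_or] at h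
    simp [segmentsFrom, Ne.symm h.1, ih h.2]

theorem segmentsFrom_eq_nil {c : Sym} {s : Str} (h : c ∉ s) (u : Str) :
    segmentsFrom c u s = [] := by
  induction s generalizing u with
  | nil => rfl
  | cons a s ih =>
    simp only [List.mem_cons, not_or] at h
    rw [segmentsFrom, if_neg (Ne.symm h.1), ih h.2]

theorem length_segmentsFrom_le (c : Sym) (u s : Str) : (segmentsFrom c u s).length ≤ s.length := by
  induction s generalizing u with
  | nil => exact le_rfl
  | cons a s ih =>
    have h := ih []
    have h' := ih (u ++ [a])
    simp only [segmentsFrom, List.length_cons]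
    split_ifs <;> grind

theorem length_le_of_mem_segmentsFrom {c : Sym} {u s v : Str} (h : v ∈ segmentsFrom c u s) :
    v.length ≤ u.length + s.length := by
  induction s generalizing u with
  | nil => simp [segmentsFrom] at h
  | cons a s ih =>
    simp only [segmentsFrom] at h
    split_ifs at h
    · rcases List.mem_cons.1 h with rfl | h
      · exact Nat.le_add_right _ _
      · exact (ih h).trans (by simp; omega)
    · exact (ih h).trans (by simp; omega)

theorem length_flatMap_le {α β : Type*} {l : List α} {f : α → List β} {n : ℕ}
    (h : ∀ a ∈ l, (f a).length ≤ n) : (l.flatMap f).length ≤ l.length * n := by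
  rw [List.length_flatMap]
  simpa using List.sum_le_card_nsmul (l.map fun a => (f a).length) n (by simpa using h)

/-- One step of the computation of a concatenation over segments: the state `(g, u, o)` consists of
the parameter, the part already read of the current segment, and the output so far. -/
def segmentStep (c : Sym) (F : Γ → Str → Str) (p : Γ × Str × Str) (a : Sym) : Γ × Str × Str :=
  if a = c then (p.1, [], p.2.2 ++ F p.1 p.2.1) else (p.1, p.2.1 ++ [a], p.2.2)

theorem foldl_segmentStep {α : Type} (c : Sym) (F : α → Str → Str) (s : Str) (g : α)
    (u o : Str) : ∃ v : Str, v.length ≤ u.length + s.length ∧ s.foldl (segmentStep c F) (g, u, o) =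
      (g, v, o ++ (segmentsFrom c u s).flatMap (F g)) := by
  induction s generalizing u o with
  | nil => exact ⟨u, by simp, by simp [segmentsFrom]⟩
  | cons a s ih =>
    by_cases hac : a = c
    · obtain ⟨v, hv, h⟩ := ih [] (o ++ F g u)
      exact ⟨v, by grind, by simp [segmentStep, hac, h, segmentsFrom]⟩
    · obtain ⟨v, hv, h⟩ := ih (u ++ [a]) o
      exact ⟨v, by grind, by simp [segmentStep, hac, h, segmentsFrom]⟩

theorem PolyTime.segmentStep {F : Γ → Str → Str} (hF : PolyTime fun p : Γ × Str => F p.1 p.2)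
    (c a : Sym) : PolyTime fun p => segmentStep c F p a := by
  have hu : PolyTime fun p : Γ × Str × Str => p.2.1 := fst.comp snd
  have ho : PolyTime fun p : Γ × Str × Str => p.2.2 := snd.comp snd
  by_cases hac : a = c
  · simpa only [UCQNeg.segmentStep, if_pos hac] using
      fst.pair ((const []).pair (ho.append (hF.comp (fst.pair hu))))
  · simpa only [UCQNeg.segmentStep, if_neg hac] using fst.pair ((hu.append (const [a])).pair ho)

theorem PolyTime.flatMap_segments (c : Sym) {F : Γ → Str → Str}
    (hF : PolyTime fun p : Γ × Str => F p.1 p.2) :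
    PolyTime fun p : Γ × Str => (segments c p.2).flatMap (F p.1) := by
  obtain ⟨q, hq⟩ : PolyBounded fun p : Γ × Str => (F p.1 p.2).length := by
    obtain ⟨-, -, -, -, hs⟩ := hF
    exact hs.mono fun p => by simp
  have hsize : PolyBounded fun p : Str × Γ × Str × Str =>
      size (p.1.foldl (UCQNeg.segmentStep c F) p.2) := by
    refine (((PolyBounded.const 3).mul .size).add
      (PolyBounded.size.mul (.polynomial q .size))).mono fun ⟨s, g, u, o⟩ => ?_
    obtain ⟨v, hv, h⟩ := foldl_segmentStep c F s g u o
    have hflatMap : ((segmentsFrom c u s).flatMap (F g)).length ≤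
        s.length * q.eval (size (s, g, u, o)) := by
      refine (length_flatMap_le fun w hw => (hq (g, w)).trans
        (monotone_polynomial_eval q ?_)).trans
        (Nat.mul_le_mul_right _ (length_segmentsFrom_le c u s))
      have := length_le_of_mem_segmentsFrom hw
      simp only [size_prod, size_str]
      omega
    have hs : s.length ≤ size (s, g, u, o) := by simp
    have := hflatMap.trans (Nat.mul_le_mul_right _ hs)
    simp only [h, size_prod, size_str, List.length_append] at this hs ⊢
    omega
  refine (snd.comp (snd.comp ((foldl (PolyTime.segmentStep hF c) hsize).comp
    (snd.pair (fst.pair (const ([], []))))))).congr fun p => ?_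
  obtain ⟨v, -, h⟩ := foldl_segmentStep c F p.2 p.1 [] []
  simp [h, segments]

/-! ### Lists of items -/

/-- Types whose elements can be the items of lists: they are coded by strings, and a list is
written with the symbol `term` after each item. -/
class Item (α : Type) [StackRep α] where
  term : Sym
  enc : α → Str
  dec : Str → α
  dec_enc : ∀ a, dec (enc a) = a
  term_notMem : ∀ a, term ∉ enc a
  polyTime_enc : PolyTime enc
  polyTime_dec : PolyTime dec

section Lists

variable {α β : Type} [StackRep α] [Item α] [StackRep β] [Item β]

/-- The string that represents a list of items. -/
def encList (l : List α) : Str := l.flatMap fun a => Item.enc a ++ [Item.term α]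

variable (α) in
/-- The list of the items in a string; what follows the last terminator is ignored. -/
def decList (s : Str) : List α := (segments (Item.term α) s).map Item.dec

instance : StackRep (List α) := ⟨1, fun l => [encList l], fun _ => rfl⟩

@[simp] theorem encList_nil : encList ([] : List α) = [] := rfl

@[simp] theorem encList_append (l l' : List α) : encList (l ++ l') = encList l ++ encList l' := by
  simp [encList]

theorem encList_cons (a : α) (l : List α) :
    encList (a :: l) = Item.enc a ++ Item.term α :: encList l := by
  simp [encList]

theorem segments_encList_append (l : List α) {r : Str} (hr : Item.term α ∉ r) :
    segments (Item.term α) (encList l ++ r) = l.map Item.enc := by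
  induction l with
  | nil => exact segmentsFrom_eq_nil hr []
  | cons a l ih =>
    rw [encList_cons, List.append_assoc, List.cons_append, segments,
      segmentsFrom_append (Item.term_notMem a), ih, List.nil_append, List.map_cons]

theorem segments_encList (l : List α) : segments (Item.term α) (encList l) = l.map Item.enc := by
  simpa using segments_encList_append l List.not_mem_nil

theorem decList_encList_append (l : List α) {r : Str} (hr : Item.term α ∉ r) :
    decList α (encList l ++ r) = l := by
  simp [decList, segments_encList_append l hr, comp_def, Item.dec_enc]

@[simp] theorem decList_encList (l : List α) : decList α (encList l) = l := by
  simpa using decList_encList_append l List.not_mem_nil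

theorem mem_encList {l : List α} {a : Sym} (h : a ∈ encList l) :
    a = Item.term α ∨ ∃ x ∈ l, a ∈ Item.enc x := by
  simp only [encList, List.mem_flatMap, List.mem_append, List.mem_singleton] at h
  obtain ⟨x, hx, h | h⟩ := h
  · exact Or.inr ⟨x, hx, h⟩
  · exact Or.inl h

namespace PolyTime

variable (α) in
theorem encList : PolyTime (encList (α := α)) := id.of_rep_eq fun _ => rfl

theorem decide_eq [DecidableEq α] {f h : Γ → α} (hf : PolyTime f) (hh : PolyTime h) :
    PolyTime fun g => decide (f g = h g) :=
  decide_eq_of_injective Item.polyTime_enc (LeftInverse.injective Item.dec_enc) hf hh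

theorem flatMap_str {l : Γ → List α} {F : Γ → α → Str} (hl : PolyTime l)
    (hF : PolyTime fun x : Γ × α => F x.1 x.2) : PolyTime fun g => (l g).flatMap (F g) := by
  have hdec : PolyTime fun x : Γ × Str => F x.1 (Item.dec x.2) :=
    hF.comp (fst.pair (Item.polyTime_dec.comp snd))
  refine ((flatMap_segments (Item.term α) (F := fun g s => F g (Item.dec s)) hdec).comp
    (id.pair ((encList α).comp hl))).congr fun g => ?_
  simp [segments_encList, List.flatMap_map, Item.dec_enc]

theorem flatMap {l : Γ → List α} {F : Γ → α → List β} (hl : PolyTime l)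
    (hF : PolyTime fun x : Γ × α => F x.1 x.2) : PolyTime fun g => (l g).flatMap (F g) := by
  refine (flatMap_str (F := fun g a => UCQNeg.encList (F g a)) hl
    ((encList β).comp hF)).of_rep_eq fun g => ?_
  simp only [rep, UCQNeg.encList, List.flatMap_assoc]

theorem singleton {f : Γ → α} (hf : PolyTime f) : PolyTime fun g => [f g] :=
  ((Item.polyTime_enc.comp hf).append (const [Item.term α])).of_rep_eq fun g => by
    simp [rep, UCQNeg.encList]

theorem map {l : Γ → List α} {F : Γ → α → β} (hl : PolyTime l)
    (hF : PolyTime fun x : Γ × α => F x.1 x.2) : PolyTime fun g => (l g).map (F g) :=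
  (flatMap (F := fun g a => [F g a]) hl (singleton hF)).congr fun g =>
    (List.flatMap_pure_eq_map (F g) (l g)).symm

theorem append_list {f h : Γ → List α} (hf : PolyTime f) (hh : PolyTime h) :
    PolyTime fun g => f g ++ h g :=
  (((encList α).comp hf).append ((encList α).comp hh)).of_rep_eq fun g => by
    simp [rep]

theorem any {l : Γ → List α} {F : Γ → α → Bool} (hl : PolyTime l)
    (hF : PolyTime fun x : Γ × α => F x.1 x.2) : PolyTime fun g => (l g).any (F g) := by
  refine (isEmpty.comp (flatMap_str (F := fun g a => if F g a then [none] else []) hl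
    (hF.ite (const [none]) (const [])))).not.congr fun g => ?_
  rw [Bool.eq_iff_iff]
  simp [List.flatMap_eq_nil_iff]

theorem all {l : Γ → List α} {F : Γ → α → Bool} (hl : PolyTime l)
    (hF : PolyTime fun x : Γ × α => F x.1 x.2) : PolyTime fun g => (l g).all (F g) :=
  (any (F := fun g a => !F g a) hl hF.not).not.congr fun g => by simp [List.all_eq_not_any_not]

variable (α) in
theorem decList : PolyTime (decList α) := by
  have hitem : PolyTime fun x : Str × Str => Item.enc (Item.dec x.2 : α) ++ [Item.term α] :=
    (Item.polyTime_enc.comp (Item.polyTime_dec.comp snd)).append (const _)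
  refine ((flatMap_segments (Item.term α)
    (F := fun _ t => Item.enc (Item.dec t : α) ++ [Item.term α]) hitem).comp
      (id.pair id)).of_rep_eq fun s => ?_
  simp [rep, UCQNeg.encList, UCQNeg.decList, List.flatMap_map]

end PolyTime

end Lists

/-! ### Names and atoms -/

/-- A letter as a stack symbol. -/
abbrev sym (l : Letter) : Sym := some (Sum.inl l)

/-- The string that represents a name. -/
def nameStr (n : Name) : Str := n.map fun b => sym (.bit b)

instance : StackRep Name := ⟨1, fun n => [nameStr n], fun _ => rfl⟩

/-- The bit that a symbol stands for. -/
def symBit : Sym → Option Bool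
  | some (Sum.inl (.bit b)) => some b
  | _ => none

/-- The name formed by the bits in a string. -/
def decName (s : Str) : Name := s.filterMap symBit

theorem mem_nameStr {a : Sym} {n : Name} (h : a ∈ nameStr n) : ∃ b, a = sym (.bit b) := by
  obtain ⟨b, -, rfl⟩ := List.mem_map.1 h
  exact ⟨b, rfl⟩

theorem decName_nameStr (n : Name) : decName (nameStr n) = n := by
  simp only [decName, nameStr, List.filterMap_map]
  exact (List.filterMap_congr fun _ _ => rfl).trans List.filterMap_some

theorem endName_notMem_nameStr (n : Name) : sym .endName ∉ nameStr n := fun h => by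
  obtain ⟨b, hb⟩ := mem_nameStr h
  simp at hb

theorem polyTime_nameStr : PolyTime nameStr := PolyTime.id.of_rep_eq fun _ => rfl

theorem polyTime_decName : PolyTime decName := by
  let δ (_ : Option Sym) (a : Sym) : Option Sym × Str :=
    (none, ((symBit a).map fun b => sym (.bit b)).toList)
  refine (PolyTime.transduce δ none).of_rep_eq fun s => ?_
  suffices nameStr (decName s) = transduce δ none s from
    congrArg (fun u => [u]) this
  induction s with
  | nil => rfl
  | cons a s ih =>
    cases h : symBit a <;> simpa [decName, nameStr, transduce, δ, h] using ih

instance : Item Name where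
  term := sym .endName
  enc := nameStr
  dec := decName
  dec_enc := decName_nameStr
  term_notMem := endName_notMem_nameStr
  polyTime_enc := polyTime_nameStr
  polyTime_dec := polyTime_decName

theorem PolyTime.flatMap_name {α : Type} [StackRep α] [Item α] {l : Γ → List α}
    {F : Γ → α → Name} (hl : PolyTime l) (hF : PolyTime fun x : Γ × α => F x.1 x.2) :
    PolyTime fun g => ((l g).flatMap (F g) : Name) := by
  refine (PolyTime.flatMap_str (F := fun g a => nameStr (F g a)) hl
    (polyTime_nameStr.comp hF)).of_rep_eq fun g => ?_
  simp only [rep, nameStr, List.map_flatMap]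

instance : StackRep (Atom Name) :=
  ⟨arity (Name × List Name), fun A => rep (A.rel, A.args), fun _ => length_rep _⟩

theorem polyTime_rel : PolyTime (fun A : Atom Name => A.rel) :=
  PolyTime.fst.comp (Γ' := Name × List Name) (f := fun A : Atom Name => (A.rel, A.args))
    (PolyTime.id.of_rep_eq fun _ => rfl)

theorem polyTime_args : PolyTime (fun A : Atom Name => A.args) :=
  PolyTime.snd.comp (Γ' := Name × List Name) (f := fun A : Atom Name => (A.rel, A.args))
    (PolyTime.id.of_rep_eq fun _ => rfl)

theorem PolyTime.atom_mk {r : Γ → Name} {l : Γ → List Name} (hr : PolyTime r) (hl : PolyTime l) :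
    PolyTime fun g => (⟨r g, l g⟩ : Atom Name) :=
  (hr.pair hl).of_rep_eq fun _ => rfl

/-- The string that represents an atom in a list of atoms. -/
def atomStr (A : Atom Name) : Str := nameStr A.rel ++ sym .endName :: encList A.args

/-- The atom described by a string. -/
def decAtom (s : Str) : Atom Name :=
  ⟨decName (before (sym .endName) s), decList Name (after (sym .endName) s)⟩

theorem mem_atomStr {a : Sym} {A : Atom Name} (h : a ∈ atomStr A) :
    (∃ b, a = sym (.bit b)) ∨ a = sym .endName := by
  simp only [atomStr, List.mem_append, List.mem_cons] at h
  rcases h with h | h | h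
  · exact Or.inl (mem_nameStr h)
  · exact Or.inr h
  · rcases mem_encList h with h | ⟨x, -, h⟩
    · exact Or.inr h
    · exact Or.inl (mem_nameStr h)

theorem endAtom_notMem_atomStr (A : Atom Name) : sym .endAtom ∉ atomStr A := fun h => by
  rcases mem_atomStr h with ⟨b, h⟩ | h <;> simp at h

theorem decAtom_atomStr (A : Atom Name) : decAtom (atomStr A) = A := by
  simp only [decAtom, atomStr, before_append (endName_notMem_nameStr _),
    after_append (endName_notMem_nameStr _), decList_encList, decName_nameStr]

instance : Item (Atom Name) where
  term := sym .endAtom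
  enc := atomStr
  dec := decAtom
  dec_enc := decAtom_atomStr
  term_notMem := endAtom_notMem_atomStr
  polyTime_enc := (polyTime_nameStr.comp polyTime_rel).append
    ((PolyTime.const [sym .endName]).append ((PolyTime.encList Name).comp polyTime_args))
  polyTime_dec := PolyTime.atom_mk (polyTime_decName.comp (PolyTime.before _))
    ((PolyTime.decList Name).comp (PolyTime.after _))

theorem mem_encList_atom {a : Sym} {l : List (Atom Name)} (h : a ∈ encList l) :
    (∃ b, a = sym (.bit b)) ∨ a = sym .endName ∨ a = sym .endAtom := by
  rcases mem_encList h with h | ⟨A, -, h⟩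
  · exact Or.inr (Or.inr h)
  · exact (mem_atomStr h).imp_right Or.inl

theorem endAtoms_notMem_encList (l : List (Atom Name)) : sym .endAtoms ∉ encList l := fun h => by
  rcases mem_encList_atom h with ⟨b, h⟩ | h | h <;> simp at h

/-! ### Queries -/

/-- The inequality `b.1 ≠ b.2`, written as the atom `b.1(b.2)`, so that lists of inequalities are
lists of items. -/
def ineqAtom (b : Name × Name) : Atom Name := ⟨b.1, [b.2]⟩

namespace CQ

/-- The inequalities of a query as atoms. -/
def ineqAtoms (q : CQ) : List (Atom Name) := q.ineqs.map ineqAtom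

/-- The components of a query. -/
def parts (q : CQ) : Atom Name × List (Atom Name) × List (Atom Name) × List (Atom Name) :=
  (q.head, q.pos, q.neg, q.ineqAtoms)

instance : StackRep CQ :=
  ⟨arity (Atom Name × List (Atom Name) × List (Atom Name) × List (Atom Name)),
    fun q => rep q.parts, fun _ => length_rep _⟩

theorem polyTime_parts : PolyTime parts := PolyTime.id.of_rep_eq fun _ => rfl

theorem polyTime_head : PolyTime head := PolyTime.fst.comp polyTime_parts

theorem polyTime_pos : PolyTime pos := PolyTime.fst.comp (PolyTime.snd.comp polyTime_parts)

theorem polyTime_neg : PolyTime neg :=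
  PolyTime.fst.comp (PolyTime.snd.comp (PolyTime.snd.comp polyTime_parts))

theorem polyTime_ineqAtoms : PolyTime ineqAtoms :=
  PolyTime.snd.comp (PolyTime.snd.comp (PolyTime.snd.comp polyTime_parts))

end CQ

/-- Group a list into pairs; the last element of a list of odd length is dropped. -/
def pairs : List Name → List (Name × Name)
  | a :: b :: l => (a, b) :: pairs l
  | _ => []

theorem pairs_flatMap (l : List (Name × Name)) : pairs (l.flatMap fun b => [b.1, b.2]) = l := by
  induction l with
  | nil => rfl
  | cons b l ih => simp [pairs, ih]

/-- The transducer that ends every second name with `endAtom`, so that it turns the code of a list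
of names into the code of the atoms for its pairs. -/
def pairUp (q : Option Sym) (a : Sym) : Option Sym × Str :=
  if a = sym .endName then
    if q = none then (some a, [a]) else (none, [a, sym .endAtom])
  else (q, [a])

theorem transduce_pairUp_nameStr_append (q : Option Sym) (n : Name) (r : Str) :
    transduce pairUp q (nameStr n ++ r) = nameStr n ++ transduce pairUp q r := by
  induction n with
  | nil => rfl
  | cons b n ih =>
    simp only [nameStr, List.map_cons, List.cons_append, transduce] at *
    simpa [pairUp] using ih

theorem exists_transduce_pairUp_encList (l : List Name) :
    ∃ r : Str, sym .endAtom ∉ r ∧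
      transduce pairUp none (encList l) = encList ((pairs l).map ineqAtom) ++ r := by
  induction l using pairs.induct with
  | case1 a b l ih =>
    obtain ⟨r, hr, h⟩ := ih
    refine ⟨r, hr, ?_⟩
    simp [encList_cons, Item.enc, Item.term, transduce_pairUp_nameStr_append, transduce, pairUp, h,
      pairs, ineqAtom, atomStr]
  | case2 l hl =>
    rcases l with _ | ⟨a, _ | ⟨b, l⟩⟩
    · exact ⟨[], by simp, rfl⟩
    · refine ⟨nameStr a ++ [sym .endName], fun h => ?_, ?_⟩
      · rcases List.mem_append.1 h with h | h
        · obtain ⟨b, hb⟩ := mem_nameStr h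
          simp at hb
        · simp at h
      · simp [encList_cons, Item.enc, Item.term, transduce_pairUp_nameStr_append, transduce, pairUp,
          pairs]
    · exact absurd rfl (hl a b l)

theorem polyTime_map_ineqAtom_pairs : PolyTime fun l : List Name => (pairs l).map ineqAtom :=
  ((PolyTime.decList (Atom Name)).comp ((PolyTime.transduce pairUp none).comp
    (PolyTime.encList Name))).congr fun l => by
    obtain ⟨r, hr, h⟩ := exists_transduce_pairUp_encList l
    rw [h, decList_encList_append _ hr]

/-- The string that represents the inequalities of a query. -/
def ineqStr (l : List (Name × Name)) : Str := encList (l.flatMap fun b => [b.1, b.2])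

theorem ineqStr_eq_flatMap (l : List (Name × Name)) :
    ineqStr l = (l.map ineqAtom).flatMap atomStr := by
  induction l with
  | nil => rfl
  | cons b l ih =>
    rw [List.map_cons, List.flatMap_cons, ← ih]
    simp [ineqStr, encList, ineqAtom, atomStr, Item.enc, Item.term]

/-- The string that represents a query in a list of queries. -/
def cqStr (q : CQ) : Str :=
  atomStr q.head ++ sym .endAtom :: (encList q.pos ++ sym .endAtoms :: (encList q.neg ++
    sym .endAtoms :: ineqStr q.ineqs))

/-- The query described by a string. -/
def decCQ (s : Str) : CQ :=
  let s' := after (sym .endAtom) s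
  let s'' := after (sym .endAtoms) s'
  ⟨decAtom (before (sym .endAtom) s), decList _ (before (sym .endAtoms) s'),
    decList _ (before (sym .endAtoms) s''), pairs (decList _ (after (sym .endAtoms) s''))⟩

theorem decCQ_cqStr_append (q : CQ) {r : Str} (hr : sym .endName ∉ r) :
    decCQ (cqStr q ++ r) = q := by
  simp only [cqStr, decCQ, List.append_assoc, List.cons_append,
    before_append (endAtom_notMem_atomStr _), after_append (endAtom_notMem_atomStr _),
    before_append (endAtoms_notMem_encList _), after_append (endAtoms_notMem_encList _),
    decList_encList, ineqStr, decList_encList_append (α := Name) _ hr, pairs_flatMap,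
    decAtom_atomStr]

theorem mem_cqStr {a : Sym} {q : CQ} (h : a ∈ cqStr q) :
    (∃ b, a = sym (.bit b)) ∨ a = sym .endName ∨ a = sym .endAtom ∨ a = sym .endAtoms := by
  simp only [cqStr, ineqStr, List.mem_append, List.mem_cons] at h
  have hatoms {l : List (Atom Name)} (h : a ∈ encList l) :
      (∃ b, a = sym (.bit b)) ∨ a = sym .endName ∨ a = sym .endAtom ∨ a = sym .endAtoms :=
    (mem_encList_atom h).imp_right fun h => h.imp_right .inl
  rcases h with h | h | h | h | h | h | h
  · exact (mem_atomStr h).imp_right .inl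
  · exact .inr (.inr (.inl h))
  · exact hatoms h
  · exact .inr (.inr (.inr h))
  · exact hatoms h
  · exact .inr (.inr (.inr h))
  · rcases mem_encList h with h | ⟨n, -, h⟩
    · exact .inr (.inl h)
    · exact .inl (mem_nameStr h)

theorem polyTime_cqStr : PolyTime cqStr := by
  have hineqs : PolyTime fun q : CQ => ineqStr q.ineqs :=
    (PolyTime.flatMap_str (F := fun _ A => atomStr A) CQ.polyTime_ineqAtoms
      ((Item.polyTime_enc (α := Atom Name)).comp PolyTime.snd)).congr
      fun q => ineqStr_eq_flatMap q.ineqs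
  exact (Item.polyTime_enc.comp CQ.polyTime_head).append ((PolyTime.const [_]).append
    (((PolyTime.encList _).comp CQ.polyTime_pos).append ((PolyTime.const [_]).append
    (((PolyTime.encList _).comp CQ.polyTime_neg).append ((PolyTime.const [_]).append hineqs)))))

theorem polyTime_decCQ : PolyTime decCQ := by
  have hbody := PolyTime.after (sym .endAtom)
  have hrest := (PolyTime.after (sym .endAtoms)).comp hbody
  exact (((Item.polyTime_dec (α := Atom Name)).comp (PolyTime.before _)).pair
    (((PolyTime.decList (Atom Name)).comp ((PolyTime.before (sym .endAtoms)).comp hbody)).pair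
    (((PolyTime.decList (Atom Name)).comp ((PolyTime.before (sym .endAtoms)).comp hrest)).pair
    (polyTime_map_ineqAtom_pairs.comp ((PolyTime.decList Name).comp
      ((PolyTime.after (sym .endAtoms)).comp hrest)))))).of_rep_eq fun _ => rfl

instance : Item CQ where
  term := sym .endCQ
  enc := cqStr
  dec := decCQ
  dec_enc q := by simpa using decCQ_cqStr_append q List.not_mem_nil
  term_notMem q h := by rcases mem_cqStr h with ⟨b, h⟩ | h | h | h <;> simp at h
  polyTime_enc := polyTime_cqStr
  polyTime_dec := polyTime_decCQ

/-! ### Encodings of queries -/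

theorem map_encodeName (n : Name) : (encodeName n).map sym = nameStr n ++ [sym .endName] := by
  simp [encodeName, nameStr]

theorem map_encodeAtom (A : Atom Name) :
    (encodeAtom A).map sym = atomStr A ++ [sym .endAtom] := by
  simp [encodeAtom, List.map_flatMap, map_encodeName, atomStr, encList, Item.enc, Item.term]

theorem map_encodeCQ (q : CQ) : (encodeCQ q).map sym = cqStr q ++ [sym .endCQ] := by
  simp [encodeCQ, List.map_flatMap, map_encodeName, map_encodeAtom, cqStr, encList, Item.enc,
    Item.term, ineqStr, List.flatMap_assoc]

theorem map_encodeUCQ (Q : UCQ) : (encodeUCQ Q).map sym = encList Q ++ [sym .endUCQ] := by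
  simp [encodeUCQ, List.map_flatMap, map_encodeCQ, encList, Item.enc, Item.term]

/-! ### Semantics -/

section

variable {X Y Z : Type*}

theorem Atom.map_map (f : X → Y) (h : Y → Z) (A : Atom X) : (A.map f).map h = A.map (h ∘ f) := by
  simp [Atom.map]

theorem Atom.map_congr {f h : X → Y} {A : Atom X} (e : ∀ x ∈ A.args, f x = h x) :
    A.map f = A.map h := by
  simpa [Atom.map] using e

theorem Atom.map_injective {f : X → Y} (hf : Injective f) : Injective (Atom.map f) := by
  rintro ⟨r, l⟩ ⟨r', l'⟩ h
  simpa [Atom.map, hf.list_map.eq_iff] using h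

theorem Atom.over_map {S : Schema} {A : Atom X} {V : X → Y} : (A.map V).Over S ↔ A.Over S := by
  simp [Atom.Over, Atom.map]

namespace CQ

/-- The variables of `q` that occur in positive atoms; for a safe query these are all. -/
def vars (q : CQ) : List Name := q.pos.flatMap Atom.args

theorem mem_vars {q : CQ} {x : Name} : x ∈ q.vars ↔ q.PosVar x := by
  simp [vars, PosVar]

theorem mem_vars_of_pos {q : CQ} {A : Atom Name} (hA : A ∈ q.pos) {x : Name} (hx : x ∈ A.args) :
    x ∈ q.vars :=
  mem_vars.2 ⟨A, hA, hx⟩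

/-- All variables of `q` occur in positive atoms. -/
structure Safe (q : CQ) : Prop where
  head : ∀ x ∈ q.head.args, x ∈ q.vars
  neg : ∀ A ∈ q.neg, ∀ x ∈ A.args, x ∈ q.vars
  ineqs : ∀ b ∈ q.ineqs, b.1 ∈ q.vars ∧ b.2 ∈ q.vars

theorem Safe.body {q : CQ} (hq : q.Safe) {A : Atom Name} (hA : A ∈ q.pos ++ q.neg) {x : Name}
    (hx : x ∈ A.args) : x ∈ q.vars :=
  (List.mem_append.1 hA).elim (mem_vars_of_pos · hx) (hq.neg A · x hx)

theorem WF.safe {S : Schema} {q : CQ} (h : WF S q) : q.Safe where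
  head x hx := mem_vars.2 (h.head_safe x hx)
  neg A hA x hx := mem_vars.2 (h.neg_safe x ⟨A, hA, hx⟩)
  ineqs b hb := by
    simp only [mem_vars]
    exact (h.ineqs_vars b hb).imp (fun o => o.elim id (h.neg_safe _))
      (fun o => o.elim id (h.neg_safe _))

theorem WF.over {S : Schema} {q : CQ} (h : WF S q) {A : Atom Name} (hA : A ∈ q.pos ++ q.neg) :
    A.Over S :=
  (List.mem_append.1 hA).elim (h.pos_over A) (h.neg_over A)

/-- On the possibly infinite instance `I`, the valuation `V` satisfies `q` and produces the fact
`f`. -/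
structure Yields (q : CQ) (I : Set (Atom X)) (V : Name → X) (f : Atom X) : Prop where
  pos : ∀ A ∈ q.pos, A.map V ∈ I
  neg : ∀ A ∈ q.neg, A.map V ∉ I
  ineqs : ∀ b ∈ q.ineqs, V b.1 ≠ V b.2
  head : q.head.map V = f

theorem mem_result {q : CQ} {I : Finset (Atom X)} {f : Atom X} :
    f ∈ q.result I ↔ ∃ V, q.Yields I V f := by
  constructor
  · rintro ⟨V, ⟨⟨-, h⟩, h', h''⟩, rfl⟩
    exact ⟨V, h', h'', h, rfl⟩
  · rintro ⟨V, h, h', h'', rfl⟩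
    exact ⟨V, ⟨⟨fun A hA B hB e => h' B hB (e ▸ h A hA), h''⟩, h, h'⟩, rfl⟩

theorem Yields.map {q : CQ} {I : Set (Atom X)} {V : Name → X} {f : Atom X} (h : q.Yields I V f)
    {J : Set (Atom Y)} {r : X → Y}
    (hIJ : ∀ A ∈ q.pos ++ q.neg, (A.map V).map r ∈ J ↔ A.map V ∈ I)
    (hr : ∀ b ∈ q.ineqs, r (V b.1) = r (V b.2) → V b.1 = V b.2) :
    q.Yields J (r ∘ V) (f.map r) where
  pos A hA := by
    rw [← Atom.map_map]
    exact (hIJ A (List.mem_append_left _ hA)).2 (h.pos A hA)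
  neg A hA hJ := by
    rw [← Atom.map_map] at hJ
    exact h.neg A hA ((hIJ A (List.mem_append_right _ hA)).1 hJ)
  ineqs b hb e := h.ineqs b hb (hr b hb e)
  head := by rw [← Atom.map_map, h.head]

theorem Yields.congr_instance {q : CQ} {I J : Set (Atom X)} {V : Name → X} {f : Atom X}
    (h : q.Yields I V f) (hIJ : ∀ A ∈ q.pos ++ q.neg, A.map V ∈ J ↔ A.map V ∈ I) :
    q.Yields J V f where
  pos A hA := (hIJ A (List.mem_append_left _ hA)).2 (h.pos A hA)
  neg A hA hJ := h.neg A hA ((hIJ A (List.mem_append_right _ hA)).1 hJ)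
  ineqs := h.ineqs
  head := h.head

theorem Yields.congr {q : CQ} {I : Set (Atom X)} {V W : Name → X} {f : Atom X}
    (h : q.Yields I V f) (hq : q.Safe) (e : ∀ x ∈ q.vars, V x = W x) : q.Yields I W f where
  pos A hA := Atom.map_congr (fun x hx => e x (mem_vars_of_pos hA hx)) ▸ h.pos A hA
  neg A hA := Atom.map_congr (fun x hx => e x (hq.neg A hA x hx)) ▸ h.neg A hA
  ineqs b hb := e _ (hq.ineqs b hb).1 ▸ e _ (hq.ineqs b hb).2 ▸ h.ineqs b hb
  head := Atom.map_congr (fun x hx => e x (hq.head x hx)) ▸ h.head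

theorem Yields.exists_mem_args {q : CQ} {I : Set (Atom X)} {V : Name → X} {f : Atom X}
    (h : q.Yields I V f) {x : Name} (hx : x ∈ q.vars) : ∃ A ∈ I, V x ∈ A.args := by
  obtain ⟨A, hA, hx⟩ := mem_vars.1 hx
  exact ⟨_, h.pos A hA, List.mem_map_of_mem hx⟩

end CQ

namespace UCQ

/-- The positive and negated atoms of the disjuncts. -/
def body (Q : UCQ) : List (Atom Name) := Q.flatMap fun q => q.pos ++ q.neg

/-- The heads of the disjuncts. -/
def heads (Q : UCQ) : List (Atom Name) := Q.map CQ.head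

/-- The variables of the disjuncts. -/
def vars (Q : UCQ) : List Name := Q.flatMap CQ.vars

theorem mem_body {Q : UCQ} {A : Atom Name} : A ∈ body Q ↔ ∃ q ∈ Q, A ∈ q.pos ++ q.neg :=
  List.mem_flatMap

theorem mem_heads {Q : UCQ} {A : Atom Name} : A ∈ heads Q ↔ ∃ q ∈ Q, q.head = A :=
  List.mem_map

theorem mem_vars_of_mem {Q : UCQ} {q : CQ} (hq : q ∈ Q) {x : Name} (hx : x ∈ q.vars) : x ∈ vars Q :=
  List.mem_flatMap.2 ⟨q, hq, hx⟩

/-- On the possibly infinite instance `I`, the valuation `V` satisfies a disjunct of `Q` and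
produces the fact `f`. -/
def Yields (Q : UCQ) (I : Set (Atom X)) (V : Name → X) (f : Atom X) : Prop :=
  ∃ q ∈ Q, q.Yields I V f

theorem mem_result {Q : UCQ} {I : Finset (Atom X)} {f : Atom X} :
    f ∈ result Q I ↔ ∃ V, Yields Q I V f := by
  simp only [result, Set.mem_ofPred_eq, CQ.mem_result, Yields]
  exact ⟨fun ⟨q, hq, V, h⟩ => ⟨V, q, hq, h⟩, fun ⟨V, q, hq, h⟩ => ⟨q, hq, V, h⟩⟩

open scoped Classical in
theorem result_filter_over {S : Schema} {Q : UCQ} (h : WF S Q) (I : Finset (Atom X)) :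
    result Q (I.filter (Atom.Over S)) = result Q I := by
  have agree {q : CQ} (hq : q ∈ Q) (V : Name → X) : ∀ A ∈ q.pos ++ q.neg,
      (A.map V ∈ (I.filter (Atom.Over S) : Set (Atom X)) ↔ A.map V ∈ (I : Set (Atom X))) := by
    intro A hA
    have hover := Atom.over_map (V := V) |>.2 ((h.disjuncts q hq).over hA)
    simp [hover]
  ext f
  simp only [mem_result]
  constructor
  · rintro ⟨V, q, hq, hf⟩
    exact ⟨V, q, hq, hf.congr_instance fun A hA => (agree hq V A hA).symm⟩
  · rintro ⟨V, q, hq, hf⟩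
    exact ⟨V, q, hq, hf.congr_instance (agree hq V)⟩

theorem Contained.result_subset {S : Schema} {Q₁ Q₂ : UCQ} (h : Contained X S Q₁ Q₂)
    (h₁ : WF S Q₁) (h₂ : WF S Q₂) (I : Finset (Atom X)) : result Q₁ I ⊆ result Q₂ I := by
  classical
  rw [← result_filter_over h₁, ← result_filter_over h₂]
  exact h _ fun f hf => (Finset.mem_filter.1 hf).2

/-! ### Canonical counterexamples -/

/- A valuation `W` into the image of `I` takes, by safety, only values in the range of `ι`, so it
can be pulled back along `ι`. -/
theorem Contained.of_injective {S : Schema} {Q₁ Q₂ : UCQ} (h : Contained Y S Q₁ Q₂)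
    (hsafe : ∀ q ∈ Q₂, q.Safe) {ι : X → Y} (hι : Injective ι) : Contained X S Q₁ Q₂ := by
  classical
  intro I hI f hf
  obtain ⟨V, q, hq, hV⟩ := mem_result.1 hf
  have : Nonempty X := ⟨V []⟩
  let J : Finset (Atom Y) := I.image (Atom.map ι)
  have hJ {A : Atom X} : A.map ι ∈ (J : Set (Atom Y)) ↔ A ∈ (I : Set (Atom X)) := by
    simp [J, (Atom.map_injective hι).eq_iff]
  have hover : ∀ B ∈ J, B.Over S := by
    simp only [J, Finset.forall_mem_image, Atom.over_map]
    exact fun {A} hA => hI A hA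
  have hVJ : f.map ι ∈ result Q₁ J :=
    mem_result.2 ⟨_, q, hq, hV.map (fun _ _ => hJ) fun _ _ e => hι e⟩
  obtain ⟨W, q', hq', hW⟩ := mem_result.1 (h J hover hVJ)
  have hinv : ∀ x ∈ q'.vars, ι (invFun ι (W x)) = W x := by
    intro x hx
    obtain ⟨_, hB, hxB⟩ := hW.exists_mem_args hx
    obtain ⟨A, -, rfl⟩ := Finset.mem_image.1 hB
    obtain ⟨y, -, hy⟩ := List.mem_map.1 hxB
    exact invFun_eq ⟨y, hy⟩
  have hback {A : Atom Name} (hA : ∀ x ∈ A.args, x ∈ q'.vars) :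
      ((A.map W).map (invFun ι)).map ι = A.map W := by
    simp only [Atom.map_map]
    exact Atom.map_congr fun x hx => hinv x (hA x hx)
  have hWI : q'.Yields I (invFun ι ∘ W) ((f.map ι).map (invFun ι)) := by
    refine hW.map (fun A hA => ?_) fun b hb e => ?_
    · rw [← hJ, hback fun x => (hsafe q' hq').body hA]
    · have hb := (hsafe q' hq').ineqs b hb
      rw [← hinv _ hb.1, ← hinv _ hb.2, e]
  have hf : (f.map ι).map (invFun ι) = f := by
    rw [Atom.map_map, invFun_comp hι]
    simp [Atom.map]
  exact mem_result.2 ⟨_, q', hq', hf ▸ hWI⟩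

theorem Contained.exists_yields [Infinite X] {S : Schema} {Q₁ Q₂ : UCQ}
    (h : Contained X S Q₁ Q₂) (h₁ : WF S Q₁) (h₂ : WF S Q₂) {I : List (Atom Name)}
    {V : Name → Name} {f : Atom Name} (hV : Yields Q₁ {A | A ∈ I} V f) :
    ∃ W, Yields Q₂ {A | A ∈ I} W f := by
  classical
  have hι : Injective (Infinite.natEmbedding X ∘ Encodable.encode (α := Name)) :=
    (Infinite.natEmbedding X).injective.comp Encodable.encode_injective
  have hNames : Contained Name S Q₁ Q₂ :=
    h.of_injective (fun q hq => (h₂.disjuncts q hq).safe) hι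
  rw [← List.coe_toFinset] at hV ⊢
  exact mem_result.1 (hNames.result_subset h₁ h₂ _ (mem_result.2 ⟨V, hV⟩))

end UCQ

end

/-- The lists of length `n` with entries in `E`. -/
def tuples (E : List Name) : ℕ → List (List Name)
  | 0 => [[]]
  | n + 1 => E.flatMap fun a => (tuples E n).map (a :: ·)

theorem mem_tuples {E : List Name} {n : ℕ} {l : List Name} :
    l ∈ tuples E n ↔ l.length = n ∧ ∀ x ∈ l, x ∈ E := by
  induction n generalizing l with
  | zero => cases l <;> simp [tuples]
  | succ n ih =>
    cases l with
    | nil => simp [tuples]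
    | cons a l =>
      simp only [tuples, List.mem_flatMap, List.mem_map, ih, List.length_cons, List.mem_cons,
        forall_eq_or_imp, Nat.add_right_cancel_iff, List.cons.injEq]
      constructor
      · rintro ⟨b, hb, m, hm, rfl, rfl⟩
        exact ⟨hm.1, hb, hm.2⟩
      · rintro ⟨h, ha, hl⟩
        exact ⟨a, ha, l, ⟨h, hl⟩, rfl, rfl⟩

theorem length_tuples (E : List Name) (n : ℕ) : (tuples E n).length = E.length ^ n := by
  induction n with
  | zero => rfl
  | succ n ih => simp [tuples, List.length_flatMap, ih, pow_succ, Nat.mul_comm]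

/-- The atoms with entries in `E` over the relations of the atoms in `B`. -/
def atomsOver (B : List (Atom Name)) (E : List Name) : List (Atom Name) :=
  B.flatMap fun A => (tuples E A.args.length).map (Atom.mk A.rel)

theorem mem_atomsOver {B : List (Atom Name)} {E : List Name} {T : Atom Name} :
    T ∈ atomsOver B E ↔
      (∃ A ∈ B, A.rel = T.rel ∧ T.args.length = A.args.length) ∧ ∀ x ∈ T.args, x ∈ E := by
  simp only [atomsOver, List.mem_flatMap, List.mem_map, mem_tuples]
  constructor
  · rintro ⟨A, hA, l, ⟨hl, hE⟩, rfl⟩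
    exact ⟨⟨A, hA, rfl, hl⟩, hE⟩
  · rintro ⟨⟨A, hA, e, hl⟩, hE⟩
    exact ⟨A, hA, T.args, ⟨hl, hE⟩, by rw [e]⟩

theorem map_mem_atomsOver {B : List (Atom Name)} {E : List Name} {A : Atom Name} (hA : A ∈ B)
    {W : Name → Name} (hW : ∀ x ∈ A.args, W x ∈ E) : A.map W ∈ atomsOver B E :=
  mem_atomsOver.2 ⟨⟨A, hA, rfl, by simp [Atom.map]⟩, by simpa [Atom.map] using hW⟩

theorem length_atomsOver_le {B : List (Atom Name)} {E : List Name} {k : ℕ}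
    (hB : ∀ A ∈ B, A.args.length ≤ k) :
    (atomsOver B E).length ≤ B.length * (E.length + 1) ^ k :=
  length_flatMap_le fun A hA => by
    rw [List.length_map, length_tuples]
    exact (Nat.pow_le_pow_left (Nat.le_succ _) _).trans
      (Nat.pow_le_pow_right (Nat.succ_pos _) (hB A hA))

theorem exists_retraction {D : Type*} (l : List Name) (V : Name → D) :
    ∃ r : D → Name, ∀ x ∈ l, r (V x) ∈ l ∧ V (r (V x)) = V x := by
  classical
  refine ⟨fun d => if h : ∃ y ∈ l, V y = d then h.choose else [], fun x hx => ?_⟩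
  have h : ∃ y ∈ l, V y = V x := ⟨x, hx, rfl⟩
  simp only [dif_pos h]
  exact h.choose_spec

/-- The facts over the relations of `B`, with names from `E` as data values, that `V` maps into the
instance `J`. -/
noncomputable def pullback {D : Type*} (B : List (Atom Name)) (E : List Name) (V : Name → D)
    (J : Set (Atom D)) : List (Atom Name) :=
  open scoped Classical in (atomsOver B E).filter fun T => T.map V ∈ J

theorem mem_pullback {D : Type*} {B : List (Atom Name)} {E : List Name} {V : Name → D}
    {J : Set (Atom D)} {T : Atom Name} :
    T ∈ pullback B E V J ↔ T ∈ atomsOver B E ∧ T.map V ∈ J := by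
  simp [pullback]

theorem UCQ.Yields.of_pullback {D : Type*} {Q : UCQ} {B : List (Atom Name)} {E : List Name}
    {V : Name → D} {J : Set (Atom D)} {W : Name → Name} {f : Atom Name}
    (h : UCQ.Yields Q {A | A ∈ pullback B E V J} W f) (hB : ∀ A ∈ UCQ.body Q, A ∈ B)
    (hsafe : ∀ q ∈ Q, q.Safe) (hinj : ∀ x ∈ E, ∀ y ∈ E, V x = V y → x = y) :
    UCQ.Yields Q J (V ∘ W) (f.map V) := by
  obtain ⟨q, hq, hW⟩ := h
  have hWE : ∀ x ∈ q.vars, W x ∈ E := fun x hx => by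
    obtain ⟨A, hA, hxA⟩ := hW.exists_mem_args hx
    exact (mem_atomsOver.1 (mem_pullback.1 hA).1).2 _ hxA
  refine ⟨q, hq, hW.map (fun A hA => ?_) fun b hb => ?_⟩
  · rw [Set.mem_ofPred_eq, mem_pullback, iff_and_self]
    exact fun _ => map_mem_atomsOver (hB A (UCQ.mem_body.2 ⟨q, hq, hA⟩))
      fun x hx => hWE x ((hsafe q hq).body hA hx)
  · have hb := (hsafe q hq).ineqs b hb
    exact hinj _ (hWE _ hb.1) _ (hWE _ hb.2)

/- With `r` a section of the valuation `V` of a disjunct `q`, the counterexample over `D` is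
replaced by its pullback to the names `r (V x)`, on which `V` is injective. -/
theorem UCQ.exists_counterexample {D : Type*} {S : Schema} {Q₁ Q₂ : UCQ} (h₁ : UCQ.WF S Q₁)
    (h₂ : UCQ.WF S Q₂) (h : ¬ UCQ.Contained D S Q₁ Q₂) :
    ∃ q ∈ Q₁, ∃ (V : Name → Name) (I : List (Atom Name)) (f : Atom Name),
      (∀ x ∈ q.vars, V x ∈ q.vars) ∧
      I.Sublist (atomsOver (body Q₁ ++ body Q₂) (q.vars.map V)) ∧
      q.Yields {A | A ∈ I} V f ∧ ∀ W, ¬ UCQ.Yields Q₂ {A | A ∈ I} W f := by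
  simp only [UCQ.Contained, not_forall, Set.not_subset] at h
  obtain ⟨J, -, f, hf₁, hf₂⟩ := h
  obtain ⟨V, q, hq, hV⟩ := UCQ.mem_result.1 hf₁
  have hsafe := (h₁.disjuncts q hq).safe
  obtain ⟨r, hr⟩ := exists_retraction q.vars V
  let E := q.vars.map (r ∘ V)
  have hinj : ∀ x ∈ E, ∀ y ∈ E, V x = V y → x = y := by
    simp only [E, List.forall_mem_map, comp_apply]
    intro x hx y hy e
    rw [(hr x hx).2, (hr y hy).2] at e
    rw [e]
  have hback {A : Atom Name} (hA : ∀ x ∈ A.args, x ∈ q.vars) :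
      ((A.map V).map r).map V = A.map V := by
    simp only [Atom.map_map]
    exact Atom.map_congr fun x hx => (hr x (hA x hx)).2
  refine ⟨q, hq, r ∘ V, pullback (body Q₁ ++ body Q₂) E V J, f.map r, fun x hx => (hr x hx).1,
    List.filter_sublist, hV.map (fun A hA => ?_) fun b hb e => ?_, fun W hW => hf₂ ?_⟩
  · rw [Set.mem_ofPred_eq, mem_pullback, hback fun x => hsafe.body hA, Atom.map_map, and_iff_right]
    exact map_mem_atomsOver (List.mem_append_left _ (UCQ.mem_body.2 ⟨q, hq, hA⟩))
      fun x hx => List.mem_map_of_mem (hsafe.body hA hx)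
  · rw [← (hr _ (hsafe.ineqs b hb).1).2, ← (hr _ (hsafe.ineqs b hb).2).2, e]
  · have hWJ := hW.of_pullback (fun A => List.mem_append_right _)
      (fun q' hq' => (h₂.disjuncts q' hq').safe) hinj
    rw [← hV.head, hback hsafe.head, hV.head] at hWJ
    exact UCQ.mem_result.2 ⟨_, hWJ⟩

/-! ### Common schemas -/

namespace UCQ

/-- The conditions on a single query that do not refer to a schema. -/
structure Proper (Q : UCQ) : Prop where
  ne_nil : Q ≠ []
  safe : ∀ q ∈ Q, q.Safe
  ineqs_ne : ∀ q ∈ Q, ∀ b ∈ q.ineqs, b.1 ≠ b.2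
  head_rel : ∀ H ∈ heads Q, ∀ H' ∈ heads Q, H.rel = H'.rel

/-- The conditions under which the atoms `B` can be over the relations of a schema, and the atoms
`H` over relations outside of it. -/
structure Compatible (B H : List (Atom Name)) : Prop where
  rel_ne : ∀ A ∈ B, ∀ A' ∈ H, A.rel ≠ A'.rel
  arity : ∀ A ∈ B ++ H, ∀ A' ∈ B ++ H, A.rel = A'.rel → A.args.length = A'.args.length

/-- The two queries are over a common schema. -/
def Admissible (Q₁ Q₂ : UCQ) : Prop :=
  (Proper Q₁ ∧ Proper Q₂) ∧ Compatible (body Q₁ ++ body Q₂) (heads Q₁ ++ heads Q₂)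

/-- The least schema with the relations of `B`, and with the arities of the atoms in `B` and
`H`. -/
def schemaOf (B H : List (Atom Name)) : Schema where
  rels := (B.map Atom.rel).toFinset
  ar R := ((B ++ H).find? fun A => A.rel = R).elim 0 fun A => A.args.length

theorem WF.proper {S : Schema} {Q : UCQ} (h : WF S Q) : Proper Q where
  ne_nil := h.ne_nil
  safe q hq := (h.disjuncts q hq).safe
  ineqs_ne q hq := (h.disjuncts q hq).ineqs_ne
  head_rel := by simpa only [heads, List.forall_mem_map] using h.head_rel

theorem WF.over_of_mem_body {S : Schema} {Q : UCQ} (h : WF S Q) {A : Atom Name}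
    (hA : A ∈ body Q) : A.Over S := by
  obtain ⟨q, hq, hA⟩ := mem_body.1 hA
  exact (h.disjuncts q hq).over hA

theorem WF.of_mem_heads {S : Schema} {Q : UCQ} (h : WF S Q) {A : Atom Name} (hA : A ∈ heads Q) :
    A.rel ∉ S.rels ∧ A.args.length = S.ar A.rel := by
  obtain ⟨q, hq, rfl⟩ := mem_heads.1 hA
  exact ⟨(h.disjuncts q hq).head_rel, (h.disjuncts q hq).head_ar⟩

theorem WF.admissible {S : Schema} {Q₁ Q₂ : UCQ} (h₁ : WF S Q₁) (h₂ : WF S Q₂) :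
    Admissible Q₁ Q₂ := by
  have hB : ∀ A ∈ body Q₁ ++ body Q₂, A.Over S := fun A hA =>
    (List.mem_append.1 hA).elim h₁.over_of_mem_body h₂.over_of_mem_body
  have hH : ∀ A ∈ heads Q₁ ++ heads Q₂, A.rel ∉ S.rels ∧ A.args.length = S.ar A.rel :=
    fun A hA => (List.mem_append.1 hA).elim h₁.of_mem_heads h₂.of_mem_heads
  have har : ∀ A ∈ (body Q₁ ++ body Q₂) ++ (heads Q₁ ++ heads Q₂), A.args.length = S.ar A.rel :=
    fun A hA => (List.mem_append.1 hA).elim (fun h => (hB A h).2) fun h => (hH A h).2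
  refine ⟨⟨h₁.proper, h₂.proper⟩, fun A hA A' hA' e => (hH A' hA').1 (e ▸ (hB A hA).1), ?_⟩
  intro A hA A' hA' e
  rw [har A hA, har A' hA', e]

section

variable {B H : List (Atom Name)}

theorem mem_rels_schemaOf {R : Name} : R ∈ (schemaOf B H).rels ↔ ∃ A ∈ B, A.rel = R := by
  simp [schemaOf]

theorem Compatible.length_args_eq (h : Compatible B H) {A : Atom Name} (hA : A ∈ B ++ H) :
    A.args.length = (schemaOf B H).ar A.rel := by
  obtain ⟨A', hA'⟩ : ∃ A', (B ++ H).find? (fun A' => A'.rel = A.rel) = some A' :=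
    Option.isSome_iff_exists.1 (List.find?_isSome.2 ⟨A, hA, by simp⟩)
  simp only [schemaOf, hA', Option.elim_some]
  exact h.arity A hA A' (List.mem_of_find?_eq_some hA')
    (by simpa [eq_comm] using List.find?_some hA')

theorem Compatible.over (h : Compatible B H) {A : Atom Name} (hA : A ∈ B) :
    A.Over (schemaOf B H) :=
  ⟨mem_rels_schemaOf.2 ⟨A, hA, rfl⟩, h.length_args_eq (List.mem_append_left _ hA)⟩

theorem Compatible.wf (h : Compatible B H) {Q : UCQ} (hQ : Proper Q) (hB : ∀ A ∈ body Q, A ∈ B)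
    (hH : ∀ A ∈ heads Q, A ∈ H) : WF (schemaOf B H) Q where
  ne_nil := hQ.ne_nil
  head_rel := by simpa only [heads, List.forall_mem_map] using hQ.head_rel
  disjuncts q hq := by
    have hover : ∀ A ∈ q.pos ++ q.neg, A.Over (schemaOf B H) := fun A hA =>
      h.over (hB A (mem_body.2 ⟨q, hq, hA⟩))
    have hhead : q.head ∈ H := hH _ (mem_heads.2 ⟨q, hq, rfl⟩)
    have hsafe := hQ.safe q hq
    exact
      { pos_over := fun A hA => hover A (List.mem_append_left _ hA)
        neg_over := fun A hA => hover A (List.mem_append_right _ hA)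
        ineqs_ne := hQ.ineqs_ne q hq
        ineqs_vars := fun b hb => (hsafe.ineqs b hb).imp (fun h => .inl (CQ.mem_vars.1 h))
          fun h => .inl (CQ.mem_vars.1 h)
        head_rel := fun hR => by
          obtain ⟨A, hA, e⟩ := mem_rels_schemaOf.1 hR
          exact h.rel_ne A hA _ hhead e
        head_ar := h.length_args_eq (List.mem_append_right _ hhead)
        head_safe := fun x hx => CQ.mem_vars.1 (hsafe.head x hx)
        neg_safe := fun x ⟨A, hA, hx⟩ => CQ.mem_vars.1 (hsafe.neg A hA x hx) }

end

theorem Admissible.exists_schema {Q₁ Q₂ : UCQ} (h : Admissible Q₁ Q₂) :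
    ∃ S : Schema, WF S Q₁ ∧ WF S Q₂ ∧
      ∀ R ∈ S.rels, ∃ A ∈ body Q₁ ++ body Q₂, A.args.length = S.ar R := by
  obtain ⟨⟨hQ₁, hQ₂⟩, hc⟩ := h
  refine ⟨_, hc.wf hQ₁ (fun A => List.mem_append_left _) fun A => List.mem_append_left _,
    hc.wf hQ₂ (fun A => List.mem_append_right _) fun A => List.mem_append_right _, fun R hR => ?_⟩
  obtain ⟨A, hA, rfl⟩ := mem_rels_schemaOf.1 hR
  exact ⟨A, hA, (hc.over hA).2⟩

end UCQ

/-! ### Predicates decidable in polynomial time -/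

/-- The predicate is decidable in polynomial time by stack programs. -/
def PolyTimeDecidable (p : Γ → Prop) : Prop :=
  ∃ b : Γ → Bool, PolyTime b ∧ ∀ g, b g = true ↔ p g

namespace PolyTimeDecidable

variable {p q : Γ → Prop}

theorem congr (hq : PolyTimeDecidable q) (h : ∀ g, p g ↔ q g) : PolyTimeDecidable p :=
  let ⟨b, hb, hbq⟩ := hq
  ⟨b, hb, fun g => (hbq g).trans (h g).symm⟩

theorem comp {p : Γ' → Prop} (hp : PolyTimeDecidable p) {f : Γ → Γ'} (hf : PolyTime f) :
    PolyTimeDecidable fun g => p (f g) :=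
  let ⟨_, hb, hbp⟩ := hp
  ⟨_, hb.comp hf, fun g => hbp (f g)⟩

theorem not (hp : PolyTimeDecidable p) : PolyTimeDecidable fun g => ¬ p g :=
  let ⟨_, hb, hbp⟩ := hp
  ⟨_, hb.not, fun g => by simp [← hbp g]⟩

theorem and (hp : PolyTimeDecidable p) (hq : PolyTimeDecidable q) :
    PolyTimeDecidable fun g => p g ∧ q g :=
  let ⟨_, hb, hbp⟩ := hp
  let ⟨_, hc, hcq⟩ := hq
  ⟨_, hb.and hc, fun g => by simp [← hbp g, ← hcq g]⟩

theorem imp (hp : PolyTimeDecidable p) (hq : PolyTimeDecidable q) :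
    PolyTimeDecidable fun g => p g → q g :=
  let ⟨_, hb, hbp⟩ := hp
  let ⟨_, hc, hcq⟩ := hq
  ⟨_, hb.not.or hc, fun g => by simp [← hbp g, ← hcq g, imp_iff_not_or]⟩

theorem eq_str {f h : Γ → Str} (hf : PolyTime f) (hh : PolyTime h) :
    PolyTimeDecidable fun g => f g = h g :=
  ⟨_, PolyTime.eqStr.comp (hf.pair hh), fun _ => decide_eq_true_iff⟩

theorem length_str_le (k : ℕ) : PolyTimeDecidable fun s : Str => s.length ≤ k := by
  induction k with
  | zero => exact ⟨_, PolyTime.isEmpty, fun s => by simp⟩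
  | succ k ih => exact (ih.comp PolyTime.tail).congr fun s => by simp

section

variable {α : Type} [StackRep α] [Item α]

theorem eq {f h : Γ → α} (hf : PolyTime f) (hh : PolyTime h) :
    PolyTimeDecidable fun g => f g = h g := by
  classical exact ⟨_, hf.decide_eq hh, fun _ => decide_eq_true_iff⟩

variable {l : Γ → List α}

theorem forall_mem (hl : PolyTime l) {p : Γ → α → Prop}
    (hp : PolyTimeDecidable fun x : Γ × α => p x.1 x.2) :
    PolyTimeDecidable fun g => ∀ a ∈ l g, p g a :=
  let ⟨b, hb, hbp⟩ := hp
  ⟨_, PolyTime.all (F := fun g a => b (g, a)) hl hb, fun g => by simp [hbp]⟩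

theorem exists_mem (hl : PolyTime l) {p : Γ → α → Prop}
    (hp : PolyTimeDecidable fun x : Γ × α => p x.1 x.2) :
    PolyTimeDecidable fun g => ∃ a ∈ l g, p g a :=
  let ⟨b, hb, hbp⟩ := hp
  ⟨_, PolyTime.any (F := fun g a => b (g, a)) hl hb, fun g => by simp [hbp]⟩

theorem mem {f : Γ → α} (hf : PolyTime f) (hl : PolyTime l) :
    PolyTimeDecidable fun g => f g ∈ l g :=
  (exists_mem (p := fun g a => f g = a) hl (eq (hf.comp PolyTime.fst) PolyTime.snd)).congr
    fun g => by simp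

theorem ne_nil (hl : PolyTime l) : PolyTimeDecidable fun g => l g ≠ [] :=
  ⟨_, (PolyTime.isEmpty.comp ((PolyTime.encList α).comp hl)).not, fun g => by
    cases h : l g <;> simp [h, encList_cons]⟩

end

end PolyTimeDecidable

theorem PolyTime.replicate_length {α : Type} [StackRep α] [Item α] {l : Γ → List α}
    (hl : PolyTime l) : PolyTime fun g => (List.replicate (l g).length none : Str) :=
  (PolyTime.flatMap_str (F := fun _ _ => [none]) hl (PolyTime.const _)).congr fun g => by
    simp [List.flatMap_def]

namespace PolyTimeDecidable

variable {α : Type} [StackRep α] [Item α] {l m : Γ → List α}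

theorem length_eq (hl : PolyTime l) (hm : PolyTime m) :
    PolyTimeDecidable fun g => (l g).length = (m g).length :=
  (eq_str hl.replicate_length hm.replicate_length).congr fun g => by
    simp [List.replicate_inj]

theorem length_le (hl : PolyTime l) (k : ℕ) : PolyTimeDecidable fun g => (l g).length ≤ k :=
  ((length_str_le k).comp hl.replicate_length).congr fun g => by simp

end PolyTimeDecidable

/-! ### Checking queries in polynomial time -/

/-- The name assigned to `x` by a list of atoms `x(V(x))`; these describe a valuation `V`. -/
def lookup (V : List (Atom Name)) (x : Name) : Name :=
  V.flatMap fun A => if A.rel = x then A.args.flatten else []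

namespace PolyTime

theorem flatten {l : Γ → List Name} (hl : PolyTime l) : PolyTime fun g => ((l g).flatten : Name) :=
  (flatMap_name (F := fun _ n => n) hl snd).congr fun g => by simp [List.flatMap_def]

theorem lookup {V : Γ → List (Atom Name)} {x : Γ → Name} (hV : PolyTime V) (hx : PolyTime x) :
    PolyTime fun g => lookup (V g) (x g) := by
  refine flatMap_name (F := fun g A => if A.rel = x g then A.args.flatten else []) hV ?_
  refine (ite (decide_eq (polyTime_rel.comp snd) (hx.comp fst)) (flatten (polyTime_args.comp snd))
    (const [])).congr fun _ => ?_
  simp only [decide_eq_true_eq]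

theorem map_lookup {V : Γ → List (Atom Name)} {A : Γ → Atom Name} (hV : PolyTime V)
    (hA : PolyTime A) : PolyTime fun g => (A g).map (UCQNeg.lookup (V g)) :=
  atom_mk (polyTime_rel.comp hA) (map (F := fun g => UCQNeg.lookup (V g)) (polyTime_args.comp hA)
    (lookup (hV.comp fst) snd))

end PolyTime

namespace CQ

theorem polyTime_vars : PolyTime vars :=
  PolyTime.flatMap (F := fun (_ : CQ) (A : Atom Name) => A.args) polyTime_pos
    (polyTime_args.comp .snd)

theorem polyTimeDecidable_forall_ineqs {q : Γ → CQ} (hq : PolyTime q) {p : Γ → Name → Name → Prop}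
    (hp : PolyTimeDecidable fun x : Γ × Name × Name => p x.1 x.2.1 x.2.2) :
    PolyTimeDecidable fun g => ∀ b ∈ (q g).ineqs, p g b.1 b.2 :=
  (PolyTimeDecidable.forall_mem (p := fun g A => p g A.rel A.args.flatten)
    (polyTime_ineqAtoms.comp hq) (hp.comp (PolyTime.fst.pair ((polyTime_rel.comp PolyTime.snd).pair
      (polyTime_args.comp PolyTime.snd).flatten)))).congr fun g => by
    simp only [ineqAtoms, List.forall_mem_map]
    simp [ineqAtom]

theorem polyTimeDecidable_yields {I V : Γ → List (Atom Name)} {f : Γ → Atom Name} {q : Γ → CQ}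
    (hI : PolyTime I) (hV : PolyTime V) (hf : PolyTime f) (hq : PolyTime q) :
    PolyTimeDecidable fun g => (q g).Yields {A | A ∈ I g} (lookup (V g)) (f g) := by
  have hmem : PolyTimeDecidable fun x : Γ × Atom Name => x.2.map (lookup (V x.1)) ∈ I x.1 :=
    .mem (.map_lookup (hV.comp .fst) .snd) (hI.comp .fst)
  have hineq : PolyTimeDecidable fun x : Γ × Name × Name =>
      lookup (V x.1) x.2.1 ≠ lookup (V x.1) x.2.2 :=
    (PolyTimeDecidable.eq ((hV.comp .fst).lookup (PolyTime.fst.comp .snd))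
      ((hV.comp .fst).lookup (PolyTime.snd.comp .snd))).not
  exact ((PolyTimeDecidable.forall_mem (polyTime_pos.comp hq) hmem).and
    ((PolyTimeDecidable.forall_mem (polyTime_neg.comp hq) hmem.not).and
    ((polyTimeDecidable_forall_ineqs (p := fun g x y => lookup (V g) x ≠ lookup (V g) y) hq
      hineq).and (.eq (.map_lookup hV (polyTime_head.comp hq)) hf)))).congr fun g =>
    ⟨fun h => ⟨h.pos, h.neg, h.ineqs, h.head⟩, fun ⟨h, h', h'', e⟩ => ⟨h, h', h'', e⟩⟩

theorem polyTimeDecidable_safe : PolyTimeDecidable Safe := by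
  have hx : PolyTimeDecidable fun x : CQ × Name => x.2 ∈ x.1.vars :=
    .mem .snd (polyTime_vars.comp .fst)
  have hneg : PolyTimeDecidable fun q : CQ => ∀ A ∈ q.neg, ∀ x ∈ A.args, x ∈ q.vars :=
    .forall_mem polyTime_neg (.forall_mem (p := fun (y : CQ × Atom Name) x => x ∈ y.1.vars)
      (polyTime_args.comp .snd) (hx.comp ((PolyTime.fst.comp .fst).pair .snd)))
  have hineq : PolyTimeDecidable fun x : CQ × Name × Name =>
      x.2.1 ∈ x.1.vars ∧ x.2.2 ∈ x.1.vars :=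
    (hx.comp (.pair .fst (PolyTime.fst.comp .snd))).and
      (hx.comp (.pair .fst (PolyTime.snd.comp .snd)))
  exact ((PolyTimeDecidable.forall_mem (polyTime_args.comp polyTime_head) hx).and
    (hneg.and (polyTimeDecidable_forall_ineqs (p := fun q x y => x ∈ q.vars ∧ y ∈ q.vars) .id
      hineq))).congr fun q =>
    ⟨fun h => ⟨h.head, h.neg, h.ineqs⟩, fun ⟨h, h', h''⟩ => ⟨h, h', h''⟩⟩

end CQ

namespace UCQ

theorem polyTime_body : PolyTime body :=
  PolyTime.flatMap (F := fun (_ : UCQ) (q : CQ) => q.pos ++ q.neg) .id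
    ((CQ.polyTime_pos.comp .snd).append_list (CQ.polyTime_neg.comp .snd))

theorem polyTime_heads : PolyTime heads :=
  PolyTime.map (F := fun (_ : UCQ) (q : CQ) => q.head) .id (CQ.polyTime_head.comp .snd)

theorem polyTime_vars : PolyTime vars :=
  PolyTime.flatMap (F := fun (_ : UCQ) (q : CQ) => q.vars) .id (CQ.polyTime_vars.comp .snd)

theorem polyTimeDecidable_yields {I V : Γ → List (Atom Name)} {f : Γ → Atom Name} {Q : Γ → UCQ}
    (hI : PolyTime I) (hV : PolyTime V) (hf : PolyTime f) (hQ : PolyTime Q) :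
    PolyTimeDecidable fun g => Yields (Q g) {A | A ∈ I g} (lookup (V g)) (f g) :=
  .exists_mem hQ (CQ.polyTimeDecidable_yields (hI.comp .fst) (hV.comp .fst) (hf.comp .fst) .snd)

theorem polyTimeDecidable_forall_pairs {l m : Γ → List (Atom Name)} (hl : PolyTime l)
    (hm : PolyTime m) {p : Atom Name → Atom Name → Prop}
    (hp : PolyTimeDecidable fun x : Atom Name × Atom Name => p x.1 x.2) :
    PolyTimeDecidable fun g => ∀ A ∈ l g, ∀ A' ∈ m g, p A A' :=
  .forall_mem hl (.forall_mem (p := fun (x : Γ × Atom Name) A' => p x.2 A') (hm.comp .fst)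
    (hp.comp ((PolyTime.snd.comp .fst).pair .snd)))

theorem polyTimeDecidable_rel_eq :
    PolyTimeDecidable fun x : Atom Name × Atom Name => x.1.rel = x.2.rel :=
  .eq (polyTime_rel.comp .fst) (polyTime_rel.comp .snd)

theorem polyTimeDecidable_proper : PolyTimeDecidable Proper := by
  have hsafe : PolyTimeDecidable fun Q : UCQ => ∀ q ∈ Q, q.Safe :=
    .forall_mem .id (CQ.polyTimeDecidable_safe.comp .snd)
  have hineq : PolyTimeDecidable fun x : (UCQ × CQ) × Name × Name => x.2.1 ≠ x.2.2 :=
    (PolyTimeDecidable.eq (PolyTime.fst.comp .snd) (PolyTime.snd.comp .snd)).not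
  have hineqs : PolyTimeDecidable fun Q : UCQ => ∀ q ∈ Q, ∀ b ∈ q.ineqs, b.1 ≠ b.2 :=
    .forall_mem .id (CQ.polyTimeDecidable_forall_ineqs .snd hineq)
  exact ((PolyTimeDecidable.ne_nil .id).and (hsafe.and (hineqs.and (polyTimeDecidable_forall_pairs
    polyTime_heads polyTime_heads polyTimeDecidable_rel_eq)))).congr fun Q =>
    ⟨fun h => ⟨h.ne_nil, h.safe, h.ineqs_ne, h.head_rel⟩, fun ⟨h, h', h'', e⟩ => ⟨h, h', h'', e⟩⟩

theorem polyTimeDecidable_compatible {B H : Γ → List (Atom Name)} (hB : PolyTime B)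
    (hH : PolyTime H) : PolyTimeDecidable fun g => Compatible (B g) (H g) := by
  have hlen : PolyTimeDecidable fun x : Atom Name × Atom Name =>
      x.1.args.length = x.2.args.length :=
    .length_eq (polyTime_args.comp .fst) (polyTime_args.comp .snd)
  have hBH := hB.append_list hH
  exact ((polyTimeDecidable_forall_pairs hB hH polyTimeDecidable_rel_eq.not).and
    (polyTimeDecidable_forall_pairs hBH hBH (polyTimeDecidable_rel_eq.imp hlen))).congr fun g =>
    ⟨fun h => ⟨h.rel_ne, h.arity⟩, fun ⟨h, h'⟩ => ⟨h, h'⟩⟩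

variable {Q₁ Q₂ : Γ → UCQ}

theorem polyTime_bodies (h₁ : PolyTime Q₁) (h₂ : PolyTime Q₂) :
    PolyTime fun g => body (Q₁ g) ++ body (Q₂ g) :=
  (polyTime_body.comp h₁).append_list (polyTime_body.comp h₂)

theorem polyTimeDecidable_admissible (h₁ : PolyTime Q₁) (h₂ : PolyTime Q₂) :
    PolyTimeDecidable fun g => Admissible (Q₁ g) (Q₂ g) :=
  ((polyTimeDecidable_proper.comp h₁).and (polyTimeDecidable_proper.comp h₂)).and
    (polyTimeDecidable_compatible (polyTime_bodies h₁ h₂)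
      ((polyTime_heads.comp h₁).append_list (polyTime_heads.comp h₂)))

end UCQ

/-! ### The two checks -/

/-- The first of the two queries described by a string. -/
def firstQuery (s : Str) : UCQ := decList CQ (before (sym .endUCQ) s)

/-- The second of the two queries described by a string. -/
def secondQuery (s : Str) : UCQ := decList CQ (before (sym .endUCQ) (after (sym .endUCQ) s))

/-- The string is the code of two queries. -/
def IsPairCode (s : Str) : Prop :=
  encList (firstQuery s) ++ ([sym .endUCQ] ++ (encList (secondQuery s) ++ [sym .endUCQ])) = s

theorem polyTime_firstQuery : PolyTime firstQuery := (PolyTime.decList CQ).comp (.before _)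

theorem polyTime_secondQuery : PolyTime secondQuery :=
  (PolyTime.decList CQ).comp ((PolyTime.before _).comp (.after _))

theorem polyTimeDecidable_isPairCode : PolyTimeDecidable IsPairCode :=
  .eq_str (((PolyTime.encList CQ).comp polyTime_firstQuery).append ((PolyTime.const _).append
    (((PolyTime.encList CQ).comp polyTime_secondQuery).append (.const _)))) .id

/-- A query also serves as the code of an instance (its positive atoms), of a valuation (read off
its negated atoms), and of a fact (its head): on the instance of `c`, the valuation of `w` satisfies
a disjunct of `Q` and produces the fact of `c`. -/
def YieldsCode (Q : UCQ) (c w : CQ) : Prop :=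
  UCQ.Yields Q {A | A ∈ c.pos} (lookup w.neg) c.head

theorem polyTimeDecidable_yieldsCode {Q : Γ → UCQ} {c w : Γ → CQ} (hQ : PolyTime Q)
    (hc : PolyTime c) (hw : PolyTime w) : PolyTimeDecidable fun g => YieldsCode (Q g) (c g) (w g) :=
  UCQ.polyTimeDecidable_yields (CQ.polyTime_pos.comp hc) (CQ.polyTime_neg.comp hw)
    (CQ.polyTime_head.comp hc) hQ

/-- If `c` is the code of a counterexample to the containment of the first query described by `s`
in the second one, where both have arity at most `k`, then `w` refutes it. The condition on the
variables of `c` keeps `w` short. -/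
def RefutesBounded (k : ℕ) (s : Str) (c w : CQ) : Prop :=
  (IsPairCode s ∧ UCQ.Admissible (firstQuery s) (secondQuery s) ∧
    ∀ A ∈ UCQ.body (firstQuery s) ++ UCQ.body (secondQuery s), A.args.length ≤ k) ∧
  ((∀ x ∈ c.vars, x ∈ UCQ.vars (firstQuery s)) → YieldsCode (firstQuery s) c c →
    YieldsCode (secondQuery s) c w)

theorem polyTimeDecidable_refutesBounded (k : ℕ) {s : Γ → Str} {c w : Γ → CQ} (hs : PolyTime s)
    (hc : PolyTime c) (hw : PolyTime w) :
    PolyTimeDecidable fun g => RefutesBounded k (s g) (c g) (w g) := by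
  have h₁ := polyTime_firstQuery.comp hs
  have h₂ := polyTime_secondQuery.comp hs
  have harity : PolyTimeDecidable fun g =>
      ∀ A ∈ UCQ.body (firstQuery (s g)) ++ UCQ.body (secondQuery (s g)), A.args.length ≤ k :=
    .forall_mem (UCQ.polyTime_bodies h₁ h₂) (.length_le (polyTime_args.comp .snd) k)
  have hvars : PolyTimeDecidable fun g => ∀ x ∈ (c g).vars, x ∈ UCQ.vars (firstQuery (s g)) :=
    .forall_mem (CQ.polyTime_vars.comp hc) (.mem .snd ((UCQ.polyTime_vars.comp h₁).comp .fst))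
  exact ((polyTimeDecidable_isPairCode.comp hs).and
    ((UCQ.polyTimeDecidable_admissible h₁ h₂).and harity)).and
    (hvars.imp ((polyTimeDecidable_yieldsCode h₁ hc hc).imp
      (polyTimeDecidable_yieldsCode h₂ hc hw)))

/-- The valuations described by `L`, restricted to `Z`, are closed under giving a variable in `Z` a
value in `E`. -/
def ClosedUnderUpdates (Z E : List Name) (L : List CQ) : Prop :=
  ∀ w ∈ L, ∀ z ∈ Z, ∀ d ∈ E, ∃ w' ∈ L, ∀ x ∈ Z, lookup w'.neg x = update (lookup w.neg) z d x

theorem PolyTime.update {V : Γ → List (Atom Name)} {z d x : Γ → Name} (hV : PolyTime V)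
    (hz : PolyTime z) (hd : PolyTime d) (hx : PolyTime x) :
    PolyTime fun g => update (UCQNeg.lookup (V g)) (z g) (d g) (x g) :=
  ((hx.decide_eq hz).ite hd (hV.lookup hx)).congr fun g => by
    simp [Function.update_apply]

theorem polyTimeDecidable_closedUnderUpdates {Z E : Γ → List Name} {L : Γ → List CQ}
    (hZ : PolyTime Z) (hE : PolyTime E) (hL : PolyTime L) :
    PolyTimeDecidable fun g => ClosedUnderUpdates (Z g) (E g) (L g) := by
  have hupdate : PolyTimeDecidable fun y : ((((Γ × CQ) × Name) × Name) × CQ) × Name =>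
      lookup y.1.2.neg y.2 = update (lookup y.1.1.1.1.2.neg) y.1.1.1.2 y.1.1.2 y.2 :=
    .eq ((CQ.polyTime_neg.comp (PolyTime.snd.comp .fst)).lookup .snd)
      ((CQ.polyTime_neg.comp (PolyTime.snd.comp (PolyTime.fst.comp
        (PolyTime.fst.comp (PolyTime.fst.comp .fst))))).update
        (PolyTime.snd.comp (PolyTime.fst.comp (PolyTime.fst.comp .fst)))
        (PolyTime.snd.comp (PolyTime.fst.comp .fst)) .snd)
  have hagree : PolyTimeDecidable fun y : (((Γ × CQ) × Name) × Name) × CQ =>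
      ∀ x ∈ Z y.1.1.1.1, lookup y.2.neg x = update (lookup y.1.1.1.2.neg) y.1.1.2 y.1.2 x :=
    .forall_mem (hZ.comp (PolyTime.fst.comp (PolyTime.fst.comp (PolyTime.fst.comp .fst)))) hupdate
  have hexists : PolyTimeDecidable fun y : ((Γ × CQ) × Name) × Name => ∃ w' ∈ L y.1.1.1,
      ∀ x ∈ Z y.1.1.1, lookup w'.neg x = update (lookup y.1.1.2.neg) y.1.2 y.2 x :=
    .exists_mem (hL.comp (PolyTime.fst.comp (PolyTime.fst.comp .fst))) hagree
  have hvalues : PolyTimeDecidable fun y : (Γ × CQ) × Name => ∀ d ∈ E y.1.1, ∃ w' ∈ L y.1.1,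
      ∀ x ∈ Z y.1.1, lookup w'.neg x = update (lookup y.1.2.neg) y.2 d x :=
    .forall_mem (hE.comp (PolyTime.fst.comp .fst)) hexists
  exact .forall_mem hL (.forall_mem (hZ.comp .fst) hvalues)

/-- If `s` describes two queries over a common schema, then `c` is the code of a counterexample to
the containment of the first one in the second one, and `L` contains the codes of all valuations of
the second one into `c`. -/
def RefutesContainment (s : Str) (c : CQ) (L : List CQ) : Prop :=
  IsPairCode s ∧ UCQ.Admissible (firstQuery s) (secondQuery s) →
    YieldsCode (firstQuery s) c c ∧ L ≠ [] ∧
    ClosedUnderUpdates (UCQ.vars (secondQuery s)) c.vars L ∧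
    ∀ w ∈ L, ¬ YieldsCode (secondQuery s) c w

theorem polyTimeDecidable_refutesContainment {s : Γ → Str} {c : Γ → CQ} {L : Γ → List CQ}
    (hs : PolyTime s) (hc : PolyTime c) (hL : PolyTime L) :
    PolyTimeDecidable fun g => RefutesContainment (s g) (c g) (L g) := by
  have h₁ := polyTime_firstQuery.comp hs
  have h₂ := polyTime_secondQuery.comp hs
  have hno : PolyTimeDecidable fun g => ∀ w ∈ L g, ¬ YieldsCode (secondQuery (s g)) (c g) w :=
    .forall_mem hL (polyTimeDecidable_yieldsCode (h₂.comp .fst) (hc.comp .fst) .snd).not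
  exact ((polyTimeDecidable_isPairCode.comp hs).and
    (UCQ.polyTimeDecidable_admissible h₁ h₂)).imp
    ((polyTimeDecidable_yieldsCode h₁ hc hc).and ((PolyTimeDecidable.ne_nil hL).and
    ((polyTimeDecidable_closedUnderUpdates (UCQ.polyTime_vars.comp h₂)
      (CQ.polyTime_vars.comp hc) hL).and hno)))

open Complexity

/-! ### Lengths of codes -/

section

variable {α β : Type*} {l : List α} {f : α → List β}

theorem length_le_flatMap_of_mem {a : α} (ha : a ∈ l) : (f a).length ≤ (l.flatMap f).length := by
  rw [List.length_flatMap]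
  exact List.le_sum_of_mem (List.mem_map_of_mem (f := fun a => (f a).length) ha)

theorem length_flatMap_le_flatMap {γ : Type*} {g : α → List γ}
    (h : ∀ a ∈ l, (f a).length ≤ (g a).length) :
    (l.flatMap f).length ≤ (l.flatMap g).length := by
  rw [List.length_flatMap, List.length_flatMap]
  exact List.sum_le_sum h

theorem length_le_flatMap (h : ∀ a ∈ l, 1 ≤ (f a).length) : l.length ≤ (l.flatMap f).length := by
  simpa using length_flatMap_le_flatMap (f := fun a => [a]) (g := f) (by simpa using h)

end

theorem length_encodeName (x : Name) : (encodeName x).length = x.length + 1 := by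
  simp [encodeName]

theorem length_encodeAtom (A : Atom Name) :
    (encodeAtom A).length = A.rel.length + 1 + (A.args.flatMap encodeName).length + 1 := by
  simp only [encodeAtom, List.length_append, length_encodeName, List.length_singleton]

theorem length_args_le (A : Atom Name) : A.args.length ≤ (A.args.flatMap encodeName).length :=
  length_le_flatMap fun x _ => by simp [length_encodeName]

theorem length_encodeCQ (q : CQ) : (encodeCQ q).length = (encodeAtom q.head).length +
    ((q.pos ++ q.neg).flatMap encodeAtom).length +
    (q.ineqs.flatMap fun b => encodeName b.1 ++ encodeName b.2).length + 3 := by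
  simp only [encodeCQ, List.length_append, List.length_singleton, List.flatMap_append]
  omega

theorem length_encodeUCQ (Q : UCQ) : (encodeUCQ Q).length = (Q.flatMap encodeCQ).length + 1 := by
  simp [encodeUCQ]

/-- The relation name, the number of entries, and the entries of `A` have length at most `n`. -/
structure Atom.Short (n : ℕ) (A : Atom Name) : Prop where
  rel : A.rel.length ≤ n
  args : A.args.length ≤ n
  arg : ∀ x ∈ A.args, x.length ≤ n

theorem Atom.short_of_length_le {A : Atom Name} {n : ℕ} (h : (encodeAtom A).length ≤ n) :
    A.Short n := by
  rw [length_encodeAtom] at h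
  refine ⟨by omega, (length_args_le A).trans (by omega), fun x hx => ?_⟩
  have := length_le_flatMap_of_mem (f := encodeName) hx
  rw [length_encodeName] at this
  omega

theorem Atom.Short.map {n : ℕ} {A : Atom Name} (h : A.Short n) {V : Name → Name}
    (hV : ∀ x ∈ A.args, (V x).length ≤ n) : (A.map V).Short n :=
  ⟨h.rel, by simpa [Atom.map] using h.args, by simpa [Atom.map] using hV⟩

theorem Atom.Short.length_encodeAtom_le {A : Atom Name} {n : ℕ} (h : A.Short n) :
    (encodeAtom A).length ≤ (n + 1) * (n + 1) + 1 := by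
  have hargs : (A.args.flatMap encodeName).length ≤ n * (n + 1) :=
    (length_flatMap_le fun x hx => by
      rw [length_encodeName]
      exact Nat.succ_le_succ (h.arg x hx)).trans (Nat.mul_le_mul_right _ h.args)
  rw [length_encodeAtom]
  nlinarith [h.rel]

/-- A bound on the length of the code of a query without inequalities that has at most `m` atoms in
its body and all of whose atoms are short. -/
def codeBound (n m : ℕ) : ℕ := ((n + 1) * (n + 1) + 1) * (1 + m) + 3

theorem codeBound_mono (n : ℕ) {m m' : ℕ} (h : m ≤ m') : codeBound n m ≤ codeBound n m' := by
  unfold codeBound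
  gcongr

theorem length_encodeCQ_le {n m : ℕ} {f : Atom Name} {I N : List (Atom Name)} (hf : f.Short n)
    (hIN : ∀ A ∈ I ++ N, A.Short n) (hm : (I ++ N).length ≤ m) :
    (encodeCQ ⟨f, I, N, []⟩).length ≤ codeBound n m := by
  have hbody := (length_flatMap_le (f := encodeAtom) fun A hA =>
    (hIN A hA).length_encodeAtom_le).trans (Nat.mul_le_mul_right _ hm)
  rw [length_encodeCQ, codeBound]
  simp only [List.flatMap_nil, List.length_nil]
  nlinarith [hf.length_encodeAtom_le]

theorem length_body_le_encodeCQ (q : CQ) : (q.pos ++ q.neg).length ≤ (encodeCQ q).length := by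
  have := length_le_flatMap (l := q.pos ++ q.neg) (f := encodeAtom) fun A _ => by
    rw [length_encodeAtom]
    omega
  rw [length_encodeCQ]
  omega

theorem length_vars_le_encodeCQ (q : CQ) : q.vars.length ≤ (encodeCQ q).length := by
  have : q.vars.length ≤ (q.pos.flatMap encodeAtom).length :=
    length_flatMap_le_flatMap fun A _ => (length_args_le A).trans (by
      rw [length_encodeAtom]
      omega)
  rw [length_encodeCQ, List.flatMap_append, List.length_append]
  omega

namespace UCQ

variable {Q : UCQ} {q : CQ}

theorem one_le_length_encode (Q : UCQ) : 1 ≤ (encodeUCQ Q).length := by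
  rw [length_encodeUCQ]
  exact Nat.le_add_left 1 _

theorem length_encodeCQ_le_of_mem (hq : q ∈ Q) : (encodeCQ q).length ≤ (encodeUCQ Q).length := by
  rw [length_encodeUCQ]
  exact (length_le_flatMap_of_mem hq).trans (Nat.le_succ _)

theorem length_body_le (Q : UCQ) : (body Q).length ≤ (encodeUCQ Q).length := by
  rw [length_encodeUCQ]
  exact (length_flatMap_le_flatMap fun q _ => length_body_le_encodeCQ q).trans (Nat.le_succ _)

theorem length_vars_le (Q : UCQ) : (vars Q).length ≤ (encodeUCQ Q).length := by
  rw [length_encodeUCQ]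
  exact (length_flatMap_le_flatMap fun q _ => length_vars_le_encodeCQ q).trans (Nat.le_succ _)

variable {n : ℕ}

theorem length_cq_vars_le_of_mem (hn : (encodeUCQ Q).length ≤ n) (hq : q ∈ Q) :
    q.vars.length ≤ n :=
  (length_vars_le_encodeCQ q).trans ((length_encodeCQ_le_of_mem hq).trans hn)

theorem short_head_of_mem (hn : (encodeUCQ Q).length ≤ n) (hq : q ∈ Q) : q.head.Short n := by
  have := length_encodeCQ_le_of_mem hq
  rw [length_encodeCQ] at this
  exact Atom.short_of_length_le (by omega)

theorem short_of_mem_body (hn : (encodeUCQ Q).length ≤ n) {A : Atom Name} (hA : A ∈ body Q) :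
    A.Short n := by
  obtain ⟨q, hq, hA⟩ := mem_body.1 hA
  have hq := length_encodeCQ_le_of_mem hq
  have hA := length_le_flatMap_of_mem (f := encodeAtom) hA
  rw [length_encodeCQ] at hq
  exact Atom.short_of_length_le (by omega)

theorem length_le_of_mem_vars (hn : (encodeUCQ Q).length ≤ n) {x : Name} (hx : x ∈ vars Q) :
    x.length ≤ n := by
  obtain ⟨q, hq, hx⟩ := List.mem_flatMap.1 hx
  obtain ⟨A, hA, hx⟩ := CQ.mem_vars.1 hx
  exact (short_of_mem_body hn (mem_body.2 ⟨q, hq, List.mem_append_left _ hA⟩)).arg x hx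

end UCQ

/-! ### Codes of valuations and counterexamples -/

/-- The list of the atoms `x(V(x))` for the names `x` in `l`. -/
def graph (l : List Name) (V : Name → Name) : List (Atom Name) := l.dedup.map fun x => ⟨x, [V x]⟩

theorem lookup_map_of_nodup (V : Name → Name) {l : List Name} (hl : l.Nodup) (x : Name) :
    lookup (l.map fun x => ⟨x, [V x]⟩) x = if x ∈ l then V x else [] := by
  induction l with
  | nil => rfl
  | cons y l ih =>
    obtain ⟨hy, hl⟩ := List.nodup_cons.1 hl
    specialize ih hl
    unfold lookup at ih ⊢
    rw [List.map_cons, List.flatMap_cons, ih]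
    by_cases hyx : y = x
    · subst hyx
      simp [hy]
    · simp [hyx, Ne.symm hyx]

theorem lookup_graph {l : List Name} (V : Name → Name) {x : Name} (hx : x ∈ l) :
    lookup (graph l V) x = V x := by
  rw [graph, lookup_map_of_nodup V l.nodup_dedup, if_pos (List.mem_dedup.2 hx)]

theorem length_graph_le (l : List Name) (V : Name → Name) : (graph l V).length ≤ l.length := by
  rw [graph, List.length_map]
  exact (List.dedup_sublist l).length_le

theorem short_of_mem_graph {n : ℕ} (hn : 1 ≤ n) {l : List Name} {V : Name → Name}
    (hl : ∀ x ∈ l, x.length ≤ n) (hV : ∀ x ∈ l, (V x).length ≤ n) :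
    ∀ A ∈ graph l V, A.Short n := by
  intro A hA
  obtain ⟨x, hx, rfl⟩ := List.mem_map.1 hA
  have hx := List.mem_dedup.1 hx
  exact ⟨hl x hx, by simpa using hn, by simpa using hV x hx⟩

/-- The code of the restriction of `V` to `l`. -/
def valuationCode (l : List Name) (V : Name → Name) : CQ := ⟨⟨[], []⟩, [], graph l V, []⟩

theorem length_encodeCQ_valuationCode_le {n m : ℕ} (hn : 1 ≤ n) {l : List Name} {V : Name → Name}
    (hl : ∀ x ∈ l, x.length ≤ n) (hV : ∀ x ∈ l, (V x).length ≤ n) (hm : l.length ≤ m) :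
    (encodeCQ (valuationCode l V)).length ≤ codeBound n m :=
  length_encodeCQ_le ⟨by simp, by simp, by simp⟩ (short_of_mem_graph hn hl hV)
    ((length_graph_le l V).trans hm)

theorem CQ.Yields.lookup_graph {q : CQ} {I : Set (Atom Name)} {V : Name → Name}
    {f : Atom Name} (h : q.Yields I V f) (hq : q.Safe) :
    q.Yields I (lookup (graph q.vars V)) f :=
  h.congr hq fun _ hx => (UCQNeg.lookup_graph V hx).symm

/-- A bound on the number of facts of a canonical counterexample for queries of arity at most
`k`. -/
def factBound (n k : ℕ) : ℕ := n * (n + 1) ^ k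

theorem short_of_mem_atomsOver {n : ℕ} {B : List (Atom Name)} {E : List Name}
    (hB : ∀ A ∈ B, A.Short n) (hE : ∀ x ∈ E, x.length ≤ n) {A : Atom Name}
    (hA : A ∈ atomsOver B E) : A.Short n := by
  obtain ⟨⟨C, hC, hrel, hargs⟩, hAE⟩ := mem_atomsOver.1 hA
  exact ⟨hrel ▸ (hB C hC).rel, hargs ▸ (hB C hC).args, fun x hx => hE x (hAE x hx)⟩

section

variable {Q₁ Q₂ : UCQ} {n : ℕ}

theorem UCQ.length_bodies_le (hn : (encodeUCQ Q₁ ++ encodeUCQ Q₂).length ≤ n) :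
    (body Q₁ ++ body Q₂).length ≤ n := by
  rw [List.length_append] at hn ⊢
  exact (Nat.add_le_add (length_body_le Q₁) (length_body_le Q₂)).trans hn

theorem UCQ.short_of_mem_bodies (hn : (encodeUCQ Q₁ ++ encodeUCQ Q₂).length ≤ n) :
    ∀ A ∈ body Q₁ ++ body Q₂, A.Short n := by
  rw [List.length_append] at hn
  exact fun A hA => (List.mem_append.1 hA).elim (short_of_mem_body (by omega))
    (short_of_mem_body (by omega))

theorem UCQ.exists_counterexample_code {D : Type*} {S : Schema} (h₁ : WF S Q₁) (h₂ : WF S Q₂)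
    (h : ¬ Contained D S Q₁ Q₂) (hn : (encodeUCQ Q₁ ++ encodeUCQ Q₂).length ≤ n) {k : ℕ}
    (hk : ∀ A ∈ body Q₁ ++ body Q₂, A.args.length ≤ k) :
    ∃ c : CQ, YieldsCode Q₁ c c ∧ (∀ w, ¬ YieldsCode Q₂ c w) ∧ (∀ x ∈ c.vars, x ∈ vars Q₁) ∧
      c.vars.length ≤ factBound n k * n ∧
      (encodeCQ c).length ≤ codeBound n (factBound n k + n) := by
  obtain ⟨q, hq, V, I, f, hV, hI, hf, hno⟩ := exists_counterexample h₁ h₂ h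
  have hn₁ : (encodeUCQ Q₁).length ≤ n := by
    rw [List.length_append] at hn
    omega
  have hpos : 1 ≤ n := (one_le_length_encode Q₁).trans hn₁
  have hsafe := (h₁.disjuncts q hq).safe
  have hname : ∀ x ∈ q.vars, x.length ≤ n := fun x hx =>
    length_le_of_mem_vars hn₁ (mem_vars_of_mem hq hx)
  have hvars : q.vars.length ≤ n := length_cq_vars_le_of_mem hn₁ hq
  have himage : ∀ x ∈ q.vars.map V, x ∈ q.vars := List.forall_mem_map.2 hV
  have hshort : ∀ A ∈ I, A.Short n := fun A hA =>
    short_of_mem_atomsOver (short_of_mem_bodies hn) (fun x hx => hname x (himage x hx))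
      (hI.subset hA)
  have hcard : I.length ≤ factBound n k := by
    refine hI.length_le.trans ((length_atomsOver_le hk).trans ?_)
    rw [List.length_map, factBound]
    gcongr
    exact length_bodies_le hn
  have hhead : f.Short n := hf.head ▸ (short_head_of_mem hn₁ hq).map fun x hx =>
    hname _ (hV x (hsafe.head x hx))
  refine ⟨⟨f, I, graph q.vars V, []⟩, ⟨q, hq, hf.lookup_graph hsafe⟩, fun w => hno _,
    fun x hx => ?_, ?_, length_encodeCQ_le hhead ?_ ?_⟩
  · obtain ⟨A, hA, hx⟩ := CQ.mem_vars.1 hx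
    exact mem_vars_of_mem hq (himage x ((mem_atomsOver.1 (hI.subset hA)).2 x hx))
  · exact (length_flatMap_le fun A hA => (hshort A hA).args).trans (Nat.mul_le_mul_right _ hcard)
  · exact List.forall_mem_append.2
      ⟨hshort, short_of_mem_graph hpos hname fun x hx => hname _ (hV x hx)⟩
  · rw [List.length_append]
    exact Nat.add_le_add hcard ((length_graph_le _ _).trans hvars)

end

/-! ### Certificates as strings of bits -/

/-- The letter after the given one, in the order used to write letters in unary; here `none` stands
for the first letter, `bit false`. -/
def nextLetter : Option Sym → Option Sym
  | none => some (sym (.bit true))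
  | some (some (Sum.inl (.bit _))) => some (sym .endName)
  | some (some (Sum.inl .endName)) => some (sym .endAtom)
  | some (some (Sum.inl .endAtom)) => some (sym .endAtoms)
  | some (some (Sum.inl .endAtoms)) => some (sym .endCQ)
  | some (some (Sum.inl .endCQ)) => some (sym .endUCQ)
  | _ => none

/-- The transducer that reads letters written in unary. -/
def unary (q : Option Sym) (a : Sym) : Option Sym × Str :=
  if a = some (Sum.inr true) then (nextLetter q, []) else (none, [q.getD (sym (.bit false))])

/-- A letter in unary. -/
def letterBits : Letter → List Bool
  | .bit false => [false]
  | .bit true => [true, false]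
  | .endName => [true, true, false]
  | .endAtom => [true, true, true, false]
  | .endAtoms => [true, true, true, true, false]
  | .endCQ => [true, true, true, true, true, false]
  | .endUCQ => [true, true, true, true, true, true, false]

/-- A bit as a symbol. -/
abbrev bitSym (b : Bool) : Sym := some (Sum.inr b)

theorem length_letterBits_le (l : Letter) : (letterBits l).length ≤ 7 := by
  rcases l with (_ | _) | _ | _ | _ | _ | _ <;> simp [letterBits]

/-- The string whose letters are written in unary in a list of bits. -/
def bitsStr (u : List Bool) : Str := transduce unary none (u.map bitSym)

theorem bitsStr_flatMap_letterBits (t : List Letter) :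
    bitsStr (t.flatMap letterBits) = t.map sym := by
  unfold bitsStr
  induction t with
  | nil => rfl
  | cons l t ih =>
    rw [List.flatMap_cons, List.map_append, List.map_cons, ← ih]
    rcases l with (_ | _) | _ | _ | _ | _ | _ <;>
      simp [letterBits, transduce, unary, nextLetter]

theorem exists_bitsStr_eq {t : List Letter} {n : ℕ} (ht : t.length ≤ n) :
    ∃ u : List Bool, u.length ≤ 7 * n ∧ bitsStr u = t.map sym :=
  ⟨t.flatMap letterBits, ((length_flatMap_le fun l _ => length_letterBits_le l).trans
    (Nat.mul_comm _ _).le).trans (Nat.mul_le_mul_left 7 ht), bitsStr_flatMap_letterBits t⟩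

theorem decCQ_map_encodeCQ (c : CQ) : decCQ ((encodeCQ c).map sym) = c := by
  rw [map_encodeCQ, decCQ_cqStr_append c (by simp)]

theorem endUCQ_notMem_encList (Q : UCQ) : sym .endUCQ ∉ encList Q := by
  intro h
  rcases mem_encList h with h | ⟨q, -, h⟩
  · simp [Item.term] at h
  · rcases mem_cqStr h with ⟨b, h⟩ | h | h | h <;> simp at h

theorem sym_injective : Injective sym := fun a b h => by simpa [sym] using h

theorem map_encode_append_encode (Q₁ Q₂ : UCQ) : (encodeUCQ Q₁ ++ encodeUCQ Q₂).map sym =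
    encList Q₁ ++ sym .endUCQ :: (encList Q₂ ++ sym .endUCQ :: []) := by
  simp [map_encodeUCQ]

theorem before_encode (Q₁ Q₂ : UCQ) :
    before (sym .endUCQ) ((encodeUCQ Q₁ ++ encodeUCQ Q₂).map sym) = encList Q₁ := by
  rw [map_encode_append_encode, before_append (endUCQ_notMem_encList _)]

theorem firstQuery_encode (Q₁ Q₂ : UCQ) :
    firstQuery ((encodeUCQ Q₁ ++ encodeUCQ Q₂).map sym) = Q₁ := by
  rw [firstQuery, before_encode, decList_encList]

theorem secondQuery_encode (Q₁ Q₂ : UCQ) :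
    secondQuery ((encodeUCQ Q₁ ++ encodeUCQ Q₂).map sym) = Q₂ := by
  rw [map_encode_append_encode, secondQuery, after_append (endUCQ_notMem_encList _),
    before_append (endUCQ_notMem_encList _), decList_encList]

theorem isPairCode_iff {x : List Letter} :
    IsPairCode (x.map sym) ↔ ∃ Q₁ Q₂ : UCQ, x = encodeUCQ Q₁ ++ encodeUCQ Q₂ := by
  constructor
  · intro h
    refine ⟨firstQuery (x.map sym), secondQuery (x.map sym),
      sym_injective.list_map (Eq.trans h.symm ?_)⟩
    simp [map_encodeUCQ]
  · rintro ⟨Q₁, Q₂, rfl⟩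
    rw [IsPairCode, firstQuery_encode, secondQuery_encode, map_encode_append_encode]
    simp

/-! ### Queries of bounded arity -/

theorem PolyTime.exists_runLe {Γ : Type} [StackRep Γ] {b : Γ → Bool} (hb : PolyTime b) :
    ∃ (P : Prog Sym) (p : Polynomial ℕ), ∀ g,
      RunLe P (store (rep g)) (store [if b g then [none] else []]) (p.eval (size g)) :=
  let ⟨P, _, hP, ⟨p, hp⟩, _⟩ := hb
  ⟨P, p, fun g => (hP g).mono (hp g)⟩

/-- The query described by a list of bits. -/
def bitsCQ (u : List Bool) : CQ := decCQ (bitsStr u)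

theorem exists_bitsCQ_eq {c : CQ} {n : ℕ} (hc : (encodeCQ c).length ≤ n) :
    ∃ u : List Bool, u.length ≤ 7 * n ∧ bitsCQ u = c :=
  let ⟨u, hu, e⟩ := exists_bitsStr_eq hc
  ⟨u, hu, by rw [bitsCQ, e, decCQ_map_encodeCQ]⟩

/-- The polynomial bound on the lengths of the two witnesses for queries of arity at most `k`. -/
noncomputable def boundedPoly (k : ℕ) : Polynomial ℕ :=
  7 * (((.X + 1) * (.X + 1) + 1) * (1 + (.X * (.X + 1) ^ k + .X)) + 3)

theorem eval_boundedPoly (k n : ℕ) :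
    (boundedPoly k).eval n = 7 * codeBound n (factBound n k + n) := by
  simp [boundedPoly, codeBound, factBound]

section

variable {D : Type*} {S : Schema} {Q₁ Q₂ : UCQ} {n k : ℕ}

theorem refutesBounded_encode {c w : CQ} :
    RefutesBounded k ((encodeUCQ Q₁ ++ encodeUCQ Q₂).map sym) c w ↔
      (UCQ.Admissible Q₁ Q₂ ∧ ∀ A ∈ UCQ.body Q₁ ++ UCQ.body Q₂, A.args.length ≤ k) ∧
      ((∀ x ∈ c.vars, x ∈ UCQ.vars Q₁) → YieldsCode Q₁ c c → YieldsCode Q₂ c w) := by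
  have hcode : IsPairCode ((encodeUCQ Q₁ ++ encodeUCQ Q₂).map sym) := isPairCode_iff.2 ⟨_, _, rfl⟩
  simp only [RefutesBounded, firstQuery_encode, secondQuery_encode, hcode, true_and]

namespace UCQ

theorem Contained.exists_yieldsCode [Infinite D] (h : Contained D S Q₁ Q₂) (h₁ : WF S Q₁)
    (h₂ : WF S Q₂) (hn : (encodeUCQ Q₁ ++ encodeUCQ Q₂).length ≤ n) {c : CQ}
    (hvars : ∀ x ∈ c.vars, x ∈ vars Q₁) (hc : YieldsCode Q₁ c c) :
    ∃ w, (encodeCQ w).length ≤ codeBound n n ∧ YieldsCode Q₂ c w := by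
  obtain ⟨W, q, hq, hW⟩ := h.exists_yields h₁ h₂ hc
  rw [List.length_append] at hn
  have hn₁ : (encodeUCQ Q₁).length ≤ n := by omega
  have hn₂ : (encodeUCQ Q₂).length ≤ n := by omega
  refine ⟨valuationCode q.vars W, length_encodeCQ_valuationCode_le
    ((one_le_length_encode Q₁).trans hn₁)
    (fun x hx => length_le_of_mem_vars hn₂ (mem_vars_of_mem hq hx)) (fun x hx => ?_)
    (length_cq_vars_le_of_mem hn₂ hq), q, hq, hW.lookup_graph (h₂.disjuncts q hq).safe⟩
  obtain ⟨A, hA, hx⟩ := hW.exists_mem_args hx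
  exact length_le_of_mem_vars hn₁ (hvars _ (CQ.mem_vars.2 ⟨A, hA, hx⟩))

theorem exists_refutesBounded [Infinite D] (h₁ : WF S Q₁) (h₂ : WF S Q₂)
    (h : Contained D S Q₁ Q₂) (hS : ∀ R ∈ S.rels, S.ar R ≤ k)
    (hn : (encodeUCQ Q₁ ++ encodeUCQ Q₂).length ≤ n) (c : CQ) :
    ∃ v : List Bool, v.length ≤ 7 * codeBound n n ∧
      RefutesBounded k ((encodeUCQ Q₁ ++ encodeUCQ Q₂).map sym) c (bitsCQ v) := by
  have harity : ∀ A ∈ body Q₁ ++ body Q₂, A.args.length ≤ k := fun A hA =>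
    have hover := (List.mem_append.1 hA).elim h₁.over_of_mem_body h₂.over_of_mem_body
    hover.2 ▸ hS _ hover.1
  simp only [refutesBounded_encode]
  by_cases hc : (∀ x ∈ c.vars, x ∈ vars Q₁) ∧ YieldsCode Q₁ c c
  · obtain ⟨w, hlen, hw⟩ := h.exists_yieldsCode h₁ h₂ hn hc.1 hc.2
    obtain ⟨v, hv, rfl⟩ := exists_bitsCQ_eq hlen
    exact ⟨v, hv, ⟨h₁.admissible h₂, harity⟩, fun _ _ => hw⟩
  · exact ⟨[], Nat.zero_le _, ⟨h₁.admissible h₂, harity⟩, fun hvars h => absurd ⟨hvars, h⟩ hc⟩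

theorem contained_of_refutesBounded (h₁ : WF S Q₁) (h₂ : WF S Q₂)
    (h : ∀ u : List Bool,
      u.length ≤ (boundedPoly k).eval (encodeUCQ Q₁ ++ encodeUCQ Q₂).length →
      ∃ w, RefutesBounded k ((encodeUCQ Q₁ ++ encodeUCQ Q₂).map sym) (bitsCQ u) w) :
    Contained D S Q₁ Q₂ := by
  simp only [eval_boundedPoly, refutesBounded_encode] at h
  obtain ⟨_, ⟨-, harity⟩, -⟩ := h [] (Nat.zero_le _)
  by_contra hnot
  obtain ⟨c, hc, hno, hvars, -, hlen⟩ := exists_counterexample_code h₁ h₂ hnot le_rfl harity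
  obtain ⟨u, hu, rfl⟩ := exists_bitsCQ_eq hlen
  obtain ⟨w, -, hw⟩ := h u hu
  exact hno w (hw hvars hc)

end UCQ

theorem mem_boundedContainment_iff [Infinite D] {x : List Letter} :
    x ∈ BoundedContainment D k ↔
      ∀ u : List Bool, u.length ≤ (boundedPoly k).eval x.length →
      ∃ v : List Bool, v.length ≤ (boundedPoly k).eval x.length ∧
        RefutesBounded k (x.map sym) (bitsCQ u) (bitsCQ v) := by
  constructor
  · rintro ⟨S, Q₁, Q₂, hS, h₁, h₂, rfl, h⟩ u -
    obtain ⟨v, hv, hr⟩ := UCQ.exists_refutesBounded h₁ h₂ h hS le_rfl (bitsCQ u)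
    refine ⟨v, hv.trans ?_, hr⟩
    rw [eval_boundedPoly]
    exact Nat.mul_le_mul_left 7 (codeBound_mono _ (Nat.le_add_left _ _))
  · intro h
    obtain ⟨v, -, hv⟩ := h [] (Nat.zero_le _)
    obtain ⟨Q₁, Q₂, rfl⟩ := isPairCode_iff.1 hv.1.1
    obtain ⟨hadm, harity⟩ := (refutesBounded_encode.1 hv).1
    obtain ⟨S, h₁, h₂, hS⟩ := hadm.exists_schema
    refine ⟨S, Q₁, Q₂, fun R hR => ?_, h₁, h₂, rfl, UCQ.contained_of_refutesBounded h₁ h₂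
      fun u hu => (h u hu).imp' _ fun _ => And.right⟩
    obtain ⟨A, hA, e⟩ := hS R hR
    exact e ▸ harity A hA

theorem pi2P_boundedContainment (D : Type*) [Infinite D] (k : ℕ) :
    Pi2P (BoundedContainment D k) := by
  have hrest : PolyTime fun s : Str => after none s.reverse := (PolyTime.after none).comp .reverse
  have hcode {f : Str → Str} (hf : PolyTime f) :
      PolyTime fun s => decCQ (transduce unary none (f s)) :=
    polyTime_decCQ.comp ((PolyTime.transduce unary none).comp hf)
  obtain ⟨b, hb, hbr⟩ := polyTimeDecidable_refutesBounded k
    ((PolyTime.before none).comp .reverse) (hcode ((PolyTime.before none).comp hrest))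
    (hcode ((PolyTime.after none).comp hrest))
  obtain ⟨P, p, hP⟩ := hb.exists_runLe
  refine ⟨boundedPoly k, fun w => b (encodeTriple w).reverse,
    computableInPolyTime_of_run (P := P) _root_.id none p fun w => ?_, fun x => ?_⟩
  · simpa [rep] using hP (encodeTriple w).reverse
  · have hsep (u v : List Bool) : b (encodeTriple (x, u, v)).reverse = true ↔
        RefutesBounded k (x.map sym) (bitsCQ u) (bitsCQ v) := by
      have hx : (none : Sym) ∉ x.map sym := by simp [sym]
      have hu : (none : Sym) ∉ u.map bitSym := by simp
      have e : encodeTriple (x, u, v) =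
          x.map sym ++ none :: (u.map bitSym ++ none :: v.map bitSym) := rfl
      simp only [hbr, List.reverse_reverse, e, before_append hx, after_append hx, before_append hu,
        after_append hu, bitsCQ, bitsStr]
    simp only [hsep]
    exact mem_boundedContainment_iff

end

/-! ### Queries of unbounded arity -/

theorem exists_agree_of_closedUnderUpdates {Z E : List Name} {L : List CQ}
    (h : ClosedUnderUpdates Z E L) (hL : L ≠ []) {W : Name → Name} {l : List Name}
    (hl : ∀ x ∈ l, x ∈ Z) (hW : ∀ x ∈ l, W x ∈ E) :
    ∃ w ∈ L, ∀ x ∈ l, lookup w.neg x = W x := by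
  induction l with
  | nil =>
    obtain ⟨w, hw⟩ := List.exists_mem_of_ne_nil L hL
    exact ⟨w, hw, by simp⟩
  | cons z l ih =>
    simp only [List.mem_cons, forall_eq_or_imp] at hl hW
    obtain ⟨w, hw, hwl⟩ := ih hl.2 hW.2
    obtain ⟨w', hw', hupdate⟩ := h w hw z hl.1 _ hW.1
    refine ⟨w', hw', List.forall_mem_cons.2 ⟨by simp [hupdate z hl.1], fun x hx => ?_⟩⟩
    rw [hupdate x (hl.2 x hx), update_apply]
    split_ifs with e
    · rw [e]
    · exact hwl x hx

/-- The function that maps the entries of `Z` to those of `l`. -/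
def tupleMap (Z l : List Name) (x : Name) : Name := l.getD (Z.idxOf x) []

theorem tupleMap_mem {Z l E : List Name} (hl : l ∈ tuples E Z.length) {x : Name} (hx : x ∈ Z) :
    tupleMap Z l x ∈ E := by
  obtain ⟨hlen, hE⟩ := mem_tuples.1 hl
  have hidx : Z.idxOf x < l.length := hlen ▸ List.idxOf_lt_length_of_mem hx
  rw [tupleMap, List.getD_eq_getElem _ _ hidx]
  exact hE _ (List.getElem_mem _)

theorem tupleMap_map {Z : List Name} {W : Name → Name} {x : Name} (hx : x ∈ Z) :
    tupleMap Z (Z.map W) x = W x := by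
  have hidx : Z.idxOf x < (Z.map W).length := by
    simpa using List.idxOf_lt_length_of_mem hx
  rw [tupleMap, List.getD_eq_getElem _ _ hidx]
  simp

/-- The codes of all maps from `Z` to `E`. -/
def valuationCodes (Z E : List Name) : List CQ :=
  (tuples E Z.length).map fun l => valuationCode Z (tupleMap Z l)

theorem closedUnderUpdates_valuationCodes {Z E E' : List Name} (hE : ∀ x ∈ E', x ∈ E) :
    ClosedUnderUpdates Z E' (valuationCodes Z E) := by
  rintro w hw z - d hd
  obtain ⟨l, hl, rfl⟩ := List.mem_map.1 hw
  set W := update (tupleMap Z l) z d with hW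
  have hWE : ∀ x ∈ Z, W x ∈ E := fun x hx => by
    rw [hW, update_apply]
    split_ifs
    exacts [hE d hd, tupleMap_mem hl hx]
  have hmem : Z.map W ∈ tuples E Z.length := mem_tuples.2 ⟨by simp, by simpa using hWE⟩
  refine ⟨_, List.mem_map_of_mem hmem, fun x hx => ?_⟩
  simp only [valuationCode, lookup_graph _ hx, tupleMap_map hx, hW, update_apply]

theorem length_valuationCodes (Z E : List Name) :
    (valuationCodes Z E).length = E.length ^ Z.length := by
  rw [valuationCodes, List.length_map, length_tuples]

/-- The bound on the lengths of certificates for non-containment. -/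
def expBound (n : ℕ) : ℕ :=
  7 * ((codeBound n (factBound n n + n) + 1) +
    ((factBound n n * n + 1) ^ n * codeBound n n + 1))

theorem expBounded_expBound : ExpBounded expBound := by
  have hfact : ExpBounded fun n => factBound n n := by
    simpa [factBound] using ExpBounded.id.mul ((ExpBounded.id.add (.const 1)).pow .X)
  have hcode {m : ℕ → ℕ} (hm : ExpBounded m) : ExpBounded fun n => codeBound n (m n) :=
    (((((ExpBounded.id.add (.const 1)).mul (ExpBounded.id.add (.const 1))).add (.const 1)).mul
      ((ExpBounded.const 1).add hm)).add (.const 3))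
  have hcount : ExpBounded fun n => (factBound n n * n + 1) ^ n := by
    simpa using ((hfact.mul .id).add (.const 1)).pow .X
  exact (ExpBounded.const 7).mul (((hcode (hfact.add .id)).add (.const 1)).add
    ((hcount.mul (hcode .id)).add (.const 1)))

variable {D : Type*} {S : Schema} {Q₁ Q₂ : UCQ} {c : CQ} {L : List CQ}

theorem refutesContainment_encode :
    RefutesContainment ((encodeUCQ Q₁ ++ encodeUCQ Q₂).map sym) c L ↔
      (UCQ.Admissible Q₁ Q₂ → YieldsCode Q₁ c c ∧ L ≠ [] ∧
        ClosedUnderUpdates (UCQ.vars Q₂) c.vars L ∧ ∀ w ∈ L, ¬ YieldsCode Q₂ c w) := by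
  have hcode : IsPairCode ((encodeUCQ Q₁ ++ encodeUCQ Q₂).map sym) := isPairCode_iff.2 ⟨_, _, rfl⟩
  simp only [RefutesContainment, firstQuery_encode, secondQuery_encode, hcode, true_and]

theorem RefutesContainment.notMem_containment [Infinite D] {x : List Letter}
    (h : RefutesContainment (x.map sym) c L) : x ∉ Containment D := by
  rintro ⟨S, Q₁, Q₂, h₁, h₂, rfl, hcont⟩
  obtain ⟨hc, hne, hclosed, hno⟩ := refutesContainment_encode.1 h (h₁.admissible h₂)
  obtain ⟨W, q, hq, hW⟩ := hcont.exists_yields h₁ h₂ hc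
  obtain ⟨w, hw, hagree⟩ := exists_agree_of_closedUnderUpdates hclosed hne
    (fun x hx => UCQ.mem_vars_of_mem hq hx) fun x hx =>
      let ⟨A, hA, hx⟩ := hW.exists_mem_args hx
      CQ.mem_vars.2 ⟨A, hA, hx⟩
  exact hno w hw ⟨q, hq, hW.congr (h₂.disjuncts q hq).safe fun x hx => (hagree x hx).symm⟩

theorem length_flatMap_valuationCodes_le {n m : ℕ} (hn : 1 ≤ n) {Z E : List Name}
    (hZ : Z.length ≤ n) (hZn : ∀ x ∈ Z, x.length ≤ n) (hE : E.length ≤ m + 1)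
    (hEn : ∀ x ∈ E, x.length ≤ n) :
    ((valuationCodes Z E).flatMap encodeCQ).length ≤ (m + 1) ^ n * codeBound n n := by
  have hcount : (valuationCodes Z E).length ≤ (m + 1) ^ n := by
    rw [length_valuationCodes]
    exact (Nat.pow_le_pow_left hE _).trans (Nat.pow_le_pow_right (Nat.succ_pos m) hZ)
  refine (length_flatMap_le fun w hw => ?_).trans (Nat.mul_le_mul_right _ hcount)
  obtain ⟨l, hl, rfl⟩ := List.mem_map.1 hw
  exact length_encodeCQ_valuationCode_le hn hZn (fun x hx => hEn _ (tupleMap_mem hl hx)) hZ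

theorem exists_refutesContainment_encode (h₁ : UCQ.WF S Q₁) (h₂ : UCQ.WF S Q₂)
    (h : ¬ UCQ.Contained D S Q₁ Q₂) {n : ℕ} (hn : (encodeUCQ Q₁ ++ encodeUCQ Q₂).length ≤ n) :
    ∃ (c : CQ) (L : List CQ),
      7 * (encodeUCQ [c] ++ encodeUCQ L).length ≤ expBound n ∧
      RefutesContainment ((encodeUCQ Q₁ ++ encodeUCQ Q₂).map sym) c L := by
  obtain ⟨c, hc, hno, hvars, hcount, hlen⟩ := UCQ.exists_counterexample_code h₁ h₂ h hn
    fun A hA => (UCQ.short_of_mem_bodies hn A hA).args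
  rw [List.length_append] at hn
  have hn₁ : (encodeUCQ Q₁).length ≤ n := by omega
  have hn₂ : (encodeUCQ Q₂).length ≤ n := by omega
  -- The extra value `[]` makes the list of valuations nonempty.
  refine ⟨c, valuationCodes (UCQ.vars Q₂) ([] :: c.vars), ?_, refutesContainment_encode.2
    fun _ => ⟨hc, ?_, closedUnderUpdates_valuationCodes fun x => List.mem_cons_of_mem _,
      fun w _ => hno w⟩⟩
  · have hvaluations := length_flatMap_valuationCodes_le ((UCQ.one_le_length_encode Q₁).trans hn₁)
      ((UCQ.length_vars_le Q₂).trans hn₂) (fun x hx => UCQ.length_le_of_mem_vars hn₂ hx)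
      (E := [] :: c.vars) (Nat.succ_le_succ hcount)
      (List.forall_mem_cons.2 ⟨Nat.zero_le n, fun x hx =>
        UCQ.length_le_of_mem_vars hn₁ (hvars x hx)⟩)
    rw [List.length_append, length_encodeUCQ, length_encodeUCQ, List.flatMap_singleton, expBound]
    gcongr
  · rw [← List.length_pos_iff, length_valuationCodes]
    exact pow_pos (Nat.succ_pos _) _

/-- The counterexample described by a list of bits. -/
def bitsCounterexample (y : List Bool) : CQ := decCQ (before (sym .endUCQ) (bitsStr y))

/-- The list of valuations described by a list of bits. -/
def bitsValuations (y : List Bool) : List CQ := secondQuery (bitsStr y)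

theorem exists_bits_eq {n : ℕ} (h : 7 * (encodeUCQ [c] ++ encodeUCQ L).length ≤ n) :
    ∃ y : List Bool, y.length ≤ n ∧ bitsCounterexample y = c ∧ bitsValuations y = L := by
  obtain ⟨y, hy, e⟩ := exists_bitsStr_eq (t := encodeUCQ [c] ++ encodeUCQ L) le_rfl
  refine ⟨y, hy.trans h, ?_, by rw [bitsValuations, e, secondQuery_encode]⟩
  rw [bitsCounterexample, e, before_encode]
  simpa [encList, Item.enc, Item.term, map_encodeCQ] using decCQ_map_encodeCQ c

theorem exists_refutesContainment {x : List Letter} (hx : x ∉ Containment D) :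
    ∃ y : List Bool, y.length ≤ expBound x.length ∧
      RefutesContainment (x.map sym) (bitsCounterexample y) (bitsValuations y) := by
  by_cases hadm : IsPairCode (x.map sym) ∧
      UCQ.Admissible (firstQuery (x.map sym)) (secondQuery (x.map sym))
  · obtain ⟨hcode, hadm⟩ := hadm
    obtain ⟨Q₁, Q₂, rfl⟩ := isPairCode_iff.1 hcode
    rw [firstQuery_encode, secondQuery_encode] at hadm
    obtain ⟨S, h₁, h₂, -⟩ := hadm.exists_schema
    obtain ⟨c, L, hlen, hr⟩ := exists_refutesContainment_encode h₁ h₂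
      (fun h => hx ⟨S, Q₁, Q₂, h₁, h₂, rfl, h⟩) le_rfl
    obtain ⟨y, hy, rfl, rfl⟩ := exists_bits_eq hlen
    exact ⟨y, hy, hr⟩
  · exact ⟨[], Nat.zero_le _, fun h => absurd h hadm⟩

theorem coNEXPTIME_containment (D : Type*) [Infinite D] : CoNEXPTIME (Containment D) := by
  have hbits : PolyTime fun p : Str × Str => transduce unary none p.2 :=
    (PolyTime.transduce unary none).comp .snd
  obtain ⟨b, hb, hbr⟩ := polyTimeDecidable_refutesContainment (PolyTime.reverse.comp .fst)
    (polyTime_decCQ.comp ((PolyTime.before (sym .endUCQ)).comp hbits))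
    (polyTime_secondQuery.comp hbits)
  obtain ⟨P, p, hP⟩ := hb.exists_runLe
  have hcheck (x : List Letter) (y : List Bool) : b ((x.map sym).reverse, y.map bitSym) = true ↔
      RefutesContainment (x.map sym) (bitsCounterexample y) (bitsValuations y) := by
    simp only [hbr, List.reverse_reverse, bitsCounterexample, bitsValuations, bitsStr]
  refine nexptime_of_run (P := P) sym bitSym none
    (f := fun x y => b ((x.map sym).reverse, y.map bitSym)) expBounded_expBound p
    (fun x y => ?_) (fun x y h => ((hcheck x y).1 h).notMem_containment) fun x hx => ?_
  · simpa [rep] using hP ((x.map sym).reverse, y.map bitSym)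
  · simpa only [hcheck] using exists_refutesContainment hx

end UCQNeg

theorem mainTheorem4 (D : Type*) [Infinite D] :
    Complexity.CoNEXPTIME (UCQNeg.Containment D) ∧
      ∀ k : ℕ, Complexity.Pi2P (UCQNeg.BoundedContainment D k) :=
  ⟨UCQNeg.coNEXPTIME_containment D, UCQNeg.pi2P_boundedContainment D⟩
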